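/- Let $d\geq 1$ and let $F\in\mathbb{R}[x,y,z]$ be a homogeneous polynomial of degree $2d$ defining a smooth plane curve $\{F=0\}\subset\mathbb{P}^2_{\mathbb{R}}$. Let $\mathcal{L}=\mathcal{O}_{\mathbb{P}^2_{\mathbb{R}}}(d)$, let $p:P=\mathbb{P}(\mathcal{L}^{-1}\oplus\mathcal{L}^{-1}\oplus\mathcal{O})\to\mathbb{P}^2_{\mathbb{R}}$ be the projective bundle (in the sense of Grothendieck), with its tautological sections $s,t\in H^0(P,p^*\mathcal{L}\otimes\mathcal{O}_P(1))$ and $u\in H^0(P,\mathcal{O}_P(1))$, and let $$X=\{s^2+t^2=u^2F\}\subset P.$$ Suppose that $F(v)>0$ for all $v\in\mathbb{R}^3\setminus\{0\}$. Then $X(\mathbb{R})$ is diffeomorphic to the real locus $Y(\mathbb{R})$ of some smooth projective $\mathbb{R}$-rational variety $Y$ over $\mathbb{R}$. More precisely: (i) if $d$ is even, then $X(\mathbb{R})$ is diffeomorphic to $\mathbb{S}^1\times\mathbb{P}^2(\mathbb{R})$; (ii) if $d$ is odd, then $X(\mathbb{R})$ is diffeomorphic to $(\mathbb{S}^1\times\mathbb{S}^2)/(\mathbb{Z}/2\mathbb{Z})$,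 where $\mathbb{Z}/2\mathbb{Z}$ acts diagonally by the antipodal involution on both factors. -/

import Mathlib

open CategoryTheory AlgebraicGeometry
open scoped Manifold ContDiff DirectSum

noncomputable section

namespace RealConicBundle

/-! ### Real loci of schemes over `ℝ` and their smooth structure -/

/-- The spectrum of the field of real numbers. -/
abbrev SpecR : Scheme.{0} := Spec (CommRingCat.of ℝ)

/-- The real locus `X(ℝ)` of an `ℝ`-scheme `s : X ⟶ Spec ℝ`: the set of its `ℝ`-points,
i.e. of the sections of the structure morphism. -/
def RealLocus {X : Scheme.{0}} (s : X ⟶ SpecR) : Type :=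
  {p : SpecR ⟶ X // p ≫ s = 𝟙 SpecR}

namespace RealLocus

variable {X : Scheme.{0}} {s : X ⟶ SpecR}

/-- The real point `p` lies in the open subscheme `U`. -/
def IsIn (p : RealLocus s) (U : X.Opens) : Prop := ⊤ ≤ p.1 ⁻¹ᵁ U

/-- The value `f(p) ∈ ℝ` at a real point `p` of `U` of a regular function `f` on `U`. -/
def value (U : X.Opens) (p : RealLocus s) (h : p.IsIn U) (f : Γ(X, U)) : ℝ :=
  (Scheme.ΓSpecIso (CommRingCat.of ℝ)).hom.hom ((p.1.appLE U ⊤ h).hom f)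

/-- The Euclidean topology on `X(ℝ)`: the coarsest one for which `U(ℝ)` is open for every Zariski
open `U` of `X`, and every regular function on `U` is continuous on `U(ℝ)`. -/
instance : TopologicalSpace (RealLocus s) :=
  TopologicalSpace.generateFrom
    {A | ∃ (U : X.Opens) (f : Γ(X, U)) (V : Set ℝ), IsOpen V ∧
      A = {p | ∃ h : p.IsIn U, value U p h f ∈ V}}

/-- The sheaf of `C^∞` functions on `X(ℝ)`: a real function `g` is smooth on `W ⊆ X(ℝ)` if around
every point of `W` it can be written as a `C^∞` function of finitely many regular functions. If `X`
is smooth over `ℝ` near its real points, this is the sheaf of `C^∞` functions of the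
usual `C^∞` manifold structure on `X(ℝ)` (the local coordinates of that structure are regular
functions, and regular functions are `C^∞`). -/
def SmoothOn (s : X ⟶ SpecR) (W : Set (RealLocus s)) (g : RealLocus s → ℝ) : Prop :=
  ∀ p ∈ W, ∃ (U : X.Opens) (n : ℕ) (f : Fin n → Γ(X, U)) (O : Set (Fin n → ℝ))
    (φ : (Fin n → ℝ) → ℝ), IsOpen O ∧ ContDiffOn ℝ ∞ φ O ∧
      ∀ᶠ q in nhds p, ∃ h : q.IsIn U,
        (fun i => value U q h (f i)) ∈ O ∧ g q = φ (fun i => value U q h (f i))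

end RealLocus

/-- Diffeomorphisms, for `C^∞` manifolds described as topological spaces with their sheaf of
`C^∞` functions (`SM W g` says that `g : M → ℝ` is `C^∞` on the open set `W`): a homeomorphism that
identifies the `C^∞` functions on corresponding open sets. -/
def Diffeomorphic {M N : Type*} [TopologicalSpace M] [TopologicalSpace N]
    (SM : Set M → (M → ℝ) → Prop) (SN : Set N → (N → ℝ) → Prop) : Prop :=
  ∃ e : M ≃ₜ N, ∀ W : Set N, IsOpen W → ∀ g : N → ℝ, SN W g ↔ SM (e ⁻¹' W) (g ∘ e)

/-- The real loci of two `ℝ`-schemes are diffeomorphic. -/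
def RealLociDiffeomorphic {X Y : Scheme.{0}} (sX : X ⟶ SpecR) (sY : Y ⟶ SpecR) : Prop :=
  Diffeomorphic (RealLocus.SmoothOn sX) (RealLocus.SmoothOn sY)

/-- The real locus of an `ℝ`-scheme is diffeomorphic to the manifold `M`. -/
def RealLocusDiffeomorphicTo {X : Scheme.{0}} (sX : X ⟶ SpecR)
    {E H : Type*} [NormedAddCommGroup E] [NormedSpace ℝ E] [TopologicalSpace H]
    (I : ModelWithCorners ℝ E H) (M : Type*) [TopologicalSpace M] [ChartedSpace H M] : Prop :=
  Diffeomorphic (RealLocus.SmoothOn sX)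
    (fun (W : Set M) (g : M → ℝ) => ContMDiffOn I 𝓘(ℝ, ℝ) ∞ g W)

/-! ### Projective schemes over `ℝ` -/

/-- The structure morphism to `Spec ℝ` of `Proj` of a graded `ℝ`-algebra. -/
def projToSpecR {A : Type} [CommRing A] [Algebra ℝ A] (𝒜 : ℕ → Submodule ℝ A)
    [GradedAlgebra 𝒜] : Proj 𝒜 ⟶ SpecR :=
  Proj.toSpecZero 𝒜 ≫ Spec.map (CommRingCat.ofHom (algebraMap ℝ (𝒜 0)))

attribute [local instance] MvPolynomial.gradedAlgebra

/-- A scheme over `ℝ` is projective if it is isomorphic over `ℝ` to a closed subscheme of some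
projective space `ℙⁿ = Proj ℝ[x₀, …, xₙ]`. -/
def IsProjective {Y : Scheme.{0}} (s : Y ⟶ SpecR) : Prop :=
  ∃ (n : ℕ) (i : Y ⟶ Proj (MvPolynomial.homogeneousSubmodule (Fin (n + 1)) ℝ)),
    IsClosedImmersion i ∧
      i ≫ projToSpecR (MvPolynomial.homogeneousSubmodule (Fin (n + 1)) ℝ) = s

/-! ### The ring `⨁ H k` attached to a multiplicative sequence of subspaces

For a sequence of subspaces `H k` of an `ℝ`-algebra `R`, with `1 ∈ H 0` and `H k * H l ⊆ H (k + l)`,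
the graded ring `⨁ k, H k` is realized as the subring of `R[T]` of the polynomials `∑ k, a k T ^ k`
with `a k ∈ H k`, graded by the powers of `T`. -/

section SectionRing

variable {R : Type} [CommRing R] [Algebra ℝ R] (H : ℕ → Submodule ℝ R) [SetLike.GradedMonoid H]

/-- The ring `⨁ k, H k T ^ k`. -/
def sectionRing : Subalgebra ℝ (Polynomial R) where
  carrier := {f | ∀ k, f.coeff k ∈ H k}
  mul_mem' := by
    intro f g hf hg k
    rw [Polynomial.coeff_mul]
    refine Submodule.sum_mem _ fun ij hij => ?_
    rw [← Finset.HasAntidiagonal.mem_antidiagonal.mp hij]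
    exact SetLike.GradedMul.mul_mem (hf _) (hg _)
  add_mem' := by
    intro f g hf hg k
    rw [Polynomial.coeff_add]
    exact Submodule.add_mem _ (hf k) (hg k)
  algebraMap_mem' := by
    intro r k
    rw [Polynomial.algebraMap_apply, Polynomial.coeff_C]
    split_ifs with h
    · subst h
      rw [Algebra.algebraMap_eq_smul_one]
      exact Submodule.smul_mem _ _ SetLike.GradedOne.one_mem
    · exact Submodule.zero_mem _

/-- The summand `H k T ^ k` of `⨁ k, H k T ^ k`. -/
def sectionGrading (k : ℕ) : Submodule ℝ (sectionRing H) where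
  carrier := {f | ∀ l, l ≠ k → (f : Polynomial R).coeff l = 0}
  add_mem' := by
    intro f g hf hg l hl
    simp [hf l hl, hg l hl]
  zero_mem' := by
    intro l _
    simp
  smul_mem' := by
    intro c f hf l hl
    simp [hf l hl]

/-- The component of degree `k` of an element of `⨁ k, H k T ^ k`. -/
def sectionComponent (f : sectionRing H) (k : ℕ) : sectionGrading H k :=
  ⟨⟨Polynomial.monomial k ((f : Polynomial R).coeff k), fun l => by
      rw [Polynomial.coeff_monomial]
      split_ifs with h
      · subst h
        exact f.2 _
      · exact Submodule.zero_mem _⟩,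
    fun l hl => by simp [Polynomial.coeff_monomial, hl.symm]⟩

instance : SetLike.GradedMonoid (sectionGrading H) where
  one_mem := by
    intro l hl
    simp [Polynomial.coeff_one, hl]
  mul_mem := by
    intro i j f g hf hg l hl
    simp only [MulMemClass.coe_mul, Polynomial.coeff_mul]
    refine Finset.sum_eq_zero fun ij hij => ?_
    rw [Finset.HasAntidiagonal.mem_antidiagonal] at hij
    by_cases h : ij.1 = i
    · rw [hg ij.2 (by omega), mul_zero]
    · rw [hf ij.1 h, zero_mul]

theorem coeff_coeAddMonoidHom (x : ⨁ k, sectionGrading H k) (k : ℕ) :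
    (DirectSum.coeAddMonoidHom (sectionGrading H) x : Polynomial R).coeff k
      = ((x k : sectionRing H) : Polynomial R).coeff k := by
  induction x using DirectSum.induction_on with
  | zero => simp
  | of i y =>
    rw [DirectSum.coeAddMonoidHom_of]
    by_cases h : k = i
    · subst h
      rw [DirectSum.of_eq_same]
    · rw [DirectSum.of_eq_of_ne _ _ _ h]
      simpa using y.2 k h
  | add x y hx hy => simp [hx, hy]

theorem coeAddMonoidHom_injective :
    Function.Injective (DirectSum.coeAddMonoidHom (sectionGrading H)) := by
  intro x y hxy
  refine DFinsupp.ext fun k => Subtype.ext <| Subtype.ext <| Polynomial.ext fun l => ?_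
  by_cases h : l = k
  · subst h
    have := coeff_coeAddMonoidHom H x l
    rw [hxy, coeff_coeAddMonoidHom H y l] at this
    exact this.symm
  · rw [(x k).2 l h, (y k).2 l h]

theorem coeAddMonoidHom_sectionComponent (f : sectionRing H) :
    DirectSum.coeAddMonoidHom (sectionGrading H)
      (∑ k ∈ (f : Polynomial R).support,
        DirectSum.of (fun k => sectionGrading H k) k (sectionComponent H f k)) = f := by
  apply Subtype.ext
  rw [map_sum]
  simp only [DirectSum.coeAddMonoidHom_of, AddSubmonoidClass.coe_finsetSum, sectionComponent]
  exact (Polynomial.as_sum_support _).symm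

instance : DirectSum.Decomposition (sectionGrading H) where
  decompose' f :=
    ∑ k ∈ (f : Polynomial R).support, DirectSum.of (fun k => sectionGrading H k) k
      (sectionComponent H f k)
  left_inv f := coeAddMonoidHom_sectionComponent H f
  right_inv _ := coeAddMonoidHom_injective H (coeAddMonoidHom_sectionComponent H _)

instance : GradedAlgebra (sectionGrading H) where

end SectionRing

/-! ### The conic bundle `X = {s² + t² = u² F}` over `ℙ²` -/

section ConicBundle

variable (d : ℕ) (F : MvPolynomial (Fin 3) ℝ)

/-- The bihomogeneous coordinate ring `ℝ[x, y, z, s, t, u]` of the projective bundle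
`P = ℙ(𝓛⁻¹ ⊕ 𝓛⁻¹ ⊕ 𝒪)` (in the sense of Grothendieck) over `ℙ²`, where `𝓛 = 𝒪(d)`; here
`x, y, z` are the variables `Sum.inl 0, 1, 2` and `s, t, u` are the variables `Sum.inr 0, 1, 2`. -/
abbrev CoxRing : Type := MvPolynomial (Fin 3 ⊕ Fin 3) ℝ

/-- The bidegrees of the variables: a form of bidegree `(a, b)` is a section of
`p^* 𝒪(a) ⊗ 𝒪_P(b)`, where `p : P ⟶ ℙ²`. So `x, y, z` have bidegree `(1, 0)`, while `s, t`, being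
sections of `p^* 𝓛 ⊗ 𝒪_P(1)`, have bidegree `(d, 1)`, and `u` has bidegree `(0, 1)`. -/
def bidegree : Fin 3 ⊕ Fin 3 → ℕ × ℕ :=
  Sum.elim (fun _ => (1, 0)) ![(d, 1), (d, 1), (0, 1)]

/-- The equation `s² + t² - u² F(x, y, z)` (of bidegree `(2 d, 2)` if `F` has degree `2 d`). -/
def equation : CoxRing :=
  MvPolynomial.X (Sum.inr 0) ^ 2 + MvPolynomial.X (Sum.inr 1) ^ 2
    - MvPolynomial.X (Sum.inr 2) ^ 2 * MvPolynomial.rename Sum.inl F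

/-- The bihomogeneous coordinate ring `ℝ[x, y, z, s, t, u] / (s² + t² - u² F)` of `X ⊆ P`. -/
abbrev CoordRing : Type := CoxRing ⧸ Ideal.span {equation F}

/-- The part of bidegree `(k (d + 1), k)` of the bihomogeneous coordinate ring of `X`, i.e. the
degree `k` part of the homogeneous coordinate ring of `X` for the line bundle
`p^* 𝒪(d + 1) ⊗ 𝒪_P(1)`. -/
def ampleGrading (k : ℕ) : Submodule ℝ (CoordRing F) :=
  (MvPolynomial.weightedHomogeneousSubmodule ℝ (bidegree d) (k • (d + 1, 1))).map
    (Ideal.Quotient.mkₐ ℝ (Ideal.span {equation F})).toLinearMap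

instance : SetLike.GradedMonoid (ampleGrading d F) where
  one_mem := ⟨1, by
    rw [zero_smul]
    exact MvPolynomial.isWeightedHomogeneous_one ℝ _, by simp⟩
  mul_mem := by
    rintro i j _ _ ⟨f, hf, rfl⟩ ⟨g, hg, rfl⟩
    refine ⟨f * g, ?_, by simp⟩
    rw [add_smul]
    exact MvPolynomial.IsWeightedHomogeneous.mul hf hg

/-- The conic bundle `X = {s² + t² = u² F} ⊆ P` over `ℙ²`. Since the line bundle
`p^* 𝒪(d + 1) ⊗ 𝒪_P(1)` on `P` is ample, `X` is `Proj` of its homogeneous coordinate ring for this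
line bundle: it is covered by the open sets where one of `x, y, z` and one of `s, t, u` do not
vanish, on which the regular functions are the fractions of bidegree `(0, 0)`. -/
def conicBundle : Scheme.{0} := Proj (sectionGrading (ampleGrading d F))

/-- The structure morphism of `X`. -/
def conicBundleToSpecR : conicBundle d F ⟶ SpecR := projToSpecR (sectionGrading (ampleGrading d F))

end ConicBundle

/-- The ternary form `F` with real coefficients defines a smooth plane curve (smooth over `ℝ`):
`F` and its partial derivatives have no common zero in `ℙ²(ℂ)`. -/
def IsSmoothPlaneCurve (F : MvPolynomial (Fin 3) ℝ) : Prop :=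
  ∀ v : Fin 3 → ℂ, v ≠ 0 → MvPolynomial.aeval v F = 0 →
    ∃ i, MvPolynomial.aeval v (MvPolynomial.pderiv i F) ≠ 0

/-! ### Spheres, the real projective plane, and the twisted product -/

/-- The unit sphere `Sⁿ` of `ℝⁿ⁺¹`, with the manifold structure of Mathlib. -/
abbrev UnitSphere (n : ℕ) : Type := Metric.sphere (0 : EuclideanSpace ℝ (Fin (n + 1))) 1

/-- The group `ℤ/2 = {1, -1}` acts on the sphere, `-1` acting as the antipodal involution. -/
instance (n : ℕ) : MulAction ℤˣ (UnitSphere n) where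
  smul ε x := if ε = 1 then x else -x
  one_smul x := if_pos rfl
  mul_smul ε δ x := by
    change (if ε * δ = 1 then x else -x)
      = if ε = 1 then (if δ = 1 then x else -x) else -(if δ = 1 then x else -x)
    rcases Int.units_eq_one_or ε with rfl | rfl <;> rcases Int.units_eq_one_or δ with rfl | rfl <;>
      simp

theorem neg_one_smul_sphere (n : ℕ) (x : UnitSphere n) : (-1 : ℤˣ) • x = -x := if_neg (by decide)

theorem neg_ne_self_sphere (n : ℕ) (x : UnitSphere n) : -x ≠ x := by
  intro h
  have h1 : -(x : EuclideanSpace ℝ (Fin (n + 1))) = x := congrArg Subtype.val h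
  have h2 : ‖(x : EuclideanSpace ℝ (Fin (n + 1)))‖ = 1 := by simp
  have h3 : (2 : ℝ) • (x : EuclideanSpace ℝ (Fin (n + 1))) = 0 := by
    rw [two_smul]
    nth_rewrite 1 [← h1]
    exact neg_add_cancel _
  rw [(smul_eq_zero.mp h3).resolve_left two_ne_zero, norm_zero] at h2
  exact zero_ne_one h2

instance (n : ℕ) : ContinuousConstSMul ℤˣ (UnitSphere n) where
  continuous_const_smul ε := by
    rcases Int.units_eq_one_or ε with rfl | rfl
    · simpa only [one_smul] using continuous_id'
    · simpa only [neg_one_smul_sphere] using continuous_neg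

instance (n : ℕ) : IsCancelSMul ℤˣ (UnitSphere n) := by
  rw [isCancelSMul_iff_eq_one_of_smul_eq]
  intro ε x h
  rcases Int.units_eq_one_or ε with rfl | rfl
  · rfl
  · rw [neg_one_smul_sphere] at h
    exact absurd h (neg_ne_self_sphere n x)

instance (m n : ℕ) : IsCancelSMul ℤˣ (UnitSphere m × UnitSphere n) := by
  rw [isCancelSMul_iff_eq_one_of_smul_eq]
  intro ε x h
  exact IsCancelSMul.eq_one_of_smul (congrArg Prod.fst h)

/-- The real projective plane `ℙ²(ℝ)`, as the quotient manifold of the sphere `S²` by the antipodal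
involution. -/
abbrev RealProjectivePlane : Type := MulAction.orbitRel.Quotient ℤˣ (UnitSphere 2)

/-- The quotient manifold `(S¹ × S²)/(ℤ/2)`, where `ℤ/2` acts diagonally, by the antipodal
involution on both factors. -/
abbrev TwistedProduct : Type := MulAction.orbitRel.Quotient ℤˣ (UnitSphere 1 × UnitSphere 2)

end RealConicBundle

end

/-!
Since `F` is positive, a real point of `X = {s² + t² = u² F}` has `u ≠ 0`, and over the point of
`ℙ²(ℝ)` represented by a unit vector `v` the fibre is the circle of radius `√F(v)`. Hence `(c, v) ↦
(v, √F(v) c, 1)` maps `S¹ × S²` onto `X(ℝ)`. As `s` and `t` are sections of `𝒪(d) ⊗ 𝒪_P(1)`, the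
points `(c, v)` and `((-1) ^ d c, -v)` have the same image, and these are the only identifications
(`conicPoint_eq_iff`).

To compare manifolds given by different constructions, all of them are presented as smooth quotients
of `S¹ × S²` (`IsSmoothQuotient`): a smooth quotient of a manifold is determined up to
diffeomorphism by its fibres (`IsSmoothQuotient.diffeomorphic`). The quotient manifolds `S¹ × ℙ²(ℝ)`
and `(S¹ × S²) / (ℤ/2)` are of this kind because their charts are lifted through local sections of a
covering (`isSmoothQuotient_of_chart_lift`). Real loci are of this kind by
`isSmoothQuotient_evalPoint`. Real points of `Proj` are there given by homogeneous coordinates, i.e.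
by homomorphisms from the graded ring to `ℝ` up to scaling, and it suffices to write down, on charts
that cover the real points, a smooth local section expressed by regular functions. For `X` this is
the normalization of the vectors `(x, y, z)` and `(s, t)` (`isSmoothQuotient_conicPoint`).

The rational models belong to the family of the products of `ℙ^(p - 1)` with the quadric `s_0² +
s_1² = ∑_{k < q} x_k²`, embedded by `𝒪(1, 1)`. For `d` even take `(p, q) = (3, 1)`, where `(c, v) ↦
(v, (c, 1))` has the fibres `{(c, ± v)}`; for `d` odd take `(p, q) = (1, 3)`, the quadric threefold,
where `(c, v) ↦ (c, v)` has the fibres `{± (c, v)}`. The complement of the tangent hyperplane `s_j +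
ε x_k = 0` in the quadric is an affine space, by projection from the point of tangency, so the
product is covered by charts that are affine spaces (`QuadricChart.awayEquiv`), all of which contain
a common real point. This gives smoothness (`smooth_quadric`) and rationality
(`isRationalOver_quadric`); projectivity holds because the coordinate ring is generated in degree
one (`isProjective_quadric`).

In both cases the coordinate ring consists of forms of bidegrees `k w₀` in a bigraded ring. The
charts are computed by rescaling the bihomogeneous coordinates by an element of the two-dimensional
torus in such a way that the section defining the chart becomes `1` (`map_form`).
-/

noncomputable section

namespace RealConicBundle

/-! ### Fractions of degree zero and dehomogenization -/

section GradedRing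

open HomogeneousLocalization

variable {A : Type} [CommRing A] [Algebra ℝ A] (𝒜 : ℕ → Submodule ℝ A) [GradedAlgebra 𝒜]

/-- The ring of fractions `a / f ^ n` of degree `0` as an algebra over the ground field `ℝ`, and not
only over the degree `0` part of `A`. -/
instance awayAlgebra (f : A) : Algebra ℝ (Away 𝒜 f) where
  algebraMap := (fromZeroRingHom 𝒜 _).comp (algebraMap ℝ (𝒜 0))
  commutes' _ _ := mul_comm _ _
  smul_def' r x := by
    apply val_injective
    rw [val_smul, val_mul, Algebra.smul_def]
    rfl

variable {𝒜}

theorem val_algebraMap_away (f : A) (r : ℝ) :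
    (algebraMap ℝ (Away 𝒜 f) r).val = algebraMap A (Localization.Away f) (algebraMap ℝ A r) :=
  rfl

variable (𝒜) in
/-- The evaluation `a / f ^ n ↦ ψ a / ψ f ^ n` of fractions of degree `0` defined by an algebra
homomorphism `ψ` for which `ψ f` is invertible. -/
def awayEval {K : Type} [CommRing K] [Algebra ℝ K] (ψ : A →ₐ[ℝ] K) (f : A) (h : IsUnit (ψ f)) :
    Away 𝒜 f →ₐ[ℝ] K where
  __ := (IsLocalization.Away.lift (S := Localization.Away f) (g := ψ.toRingHom) f h).comp
    (algebraMap (Away 𝒜 f) (Localization.Away f))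
  commutes' r := by
    change IsLocalization.Away.lift (S := Localization.Away f) (g := ψ.toRingHom) f h
      (algebraMap ℝ (Away 𝒜 f) r).val = _
    rw [val_algebraMap_away, IsLocalization.Away.lift_eq]
    exact ψ.commutes r

theorem awayEval_mk {K : Type} [CommRing K] [Algebra ℝ K] (ψ : A →ₐ[ℝ] K) (f : A)
    (h : IsUnit (ψ f)) {m : ℕ} (hf : f ∈ 𝒜 m) (n : ℕ) (a : A) (ha : a ∈ 𝒜 (n • m)) :
    awayEval 𝒜 ψ f h (Away.mk 𝒜 hf n a ha) * ψ f ^ n = ψ a := by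
  change IsLocalization.Away.lift (S := Localization.Away f) (g := ψ.toRingHom) f h
    (Away.mk 𝒜 hf n a ha).val * _ = _
  rw [Away.val_mk, Localization.mk_eq_mk']
  have : ψ f ^ n = IsLocalization.Away.lift (S := Localization.Away f) (g := ψ.toRingHom) f h
      (algebraMap A _ (f ^ n)) := by
    rw [IsLocalization.Away.lift_eq]; simp
  have key := IsLocalization.mk'_spec (Localization.Away f) a
    (⟨f ^ n, ⟨n, rfl⟩⟩ : Submonoid.powers f)
  rw [this, ← map_mul, key, IsLocalization.Away.lift_eq]
  rfl

/-- The fraction `a / f ^ k` attached to an element `a` of degree `k`, where `f` has degree `1`. -/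
def fractionOfDegree (f : A) (hf : f ∈ 𝒜 1) (k : ℕ) : 𝒜 k →ₗ[ℝ] Away 𝒜 f where
  toFun a := Away.mk 𝒜 hf k a (by simp)
  map_add' a b := by
    apply val_injective
    rw [val_add, Away.val_mk, Away.val_mk, Away.val_mk, Localization.add_mk_self]
    rfl
  map_smul' r a := by
    apply val_injective
    rw [RingHom.id_apply, val_smul, Away.val_mk, Away.val_mk, Localization.smul_mk]
    rfl

/-- Dehomogenization with respect to an element `f` of degree `1`: the ring homomorphism that sends
an element `a` of degree `k` to `a / f ^ k`. -/
def dehomog (f : A) (hf : f ∈ 𝒜 1) : A →ₐ[ℝ] Away 𝒜 f :=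
  (DirectSum.toAlgebra ℝ (fun k => 𝒜 k) (fractionOfDegree f hf)
    (by
      apply val_injective
      simp only [fractionOfDegree, LinearMap.coe_mk, AddHom.coe_mk, Away.val_mk, val_one]
      simp)
    (by
      intro i j a b
      apply val_injective
      simp only [fractionOfDegree, LinearMap.coe_mk, AddHom.coe_mk, Away.val_mk, val_mul,
        Localization.mk_mul]
      congr 1
      ext
      simp [pow_add])).comp
    (DirectSum.decomposeAlgEquiv 𝒜).toAlgHom

theorem dehomog_apply (f : A) (hf : f ∈ 𝒜 1) {k : ℕ} {a : A} (ha : a ∈ 𝒜 k) :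
    dehomog f hf a = Away.mk 𝒜 hf k a (by simpa using ha) := by
  simp only [dehomog, AlgHom.comp_apply]
  change DirectSum.toAlgebra _ _ _ _ _ (DirectSum.decompose 𝒜 a) = _
  rw [DirectSum.decompose_of_mem 𝒜 ha]
  exact DirectSum.toAddMonoid_of (β := fun k => 𝒜 k)
    (fun k => (fractionOfDegree f hf k).toAddMonoidHom) k ⟨a, ha⟩

theorem dehomog_surjective (f : A) (hf : f ∈ 𝒜 1) : Function.Surjective (dehomog f hf) := by
  intro x
  obtain ⟨n, a, ha, rfl⟩ := Away.mk_surjective 𝒜 hf x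
  exact ⟨a, dehomog_apply f hf (k := n) (by simpa using ha)⟩

theorem dehomog_self (f : A) (hf : f ∈ 𝒜 1) : dehomog f hf f = 1 := by
  rw [dehomog_apply f hf hf]
  apply val_injective
  rw [Away.val_mk, val_one]
  simp

/-- The evaluation `ψ` is recovered from its dehomogenization with respect to `f`, up to the factor
`ψ f ^ k` in degree `k`. -/
theorem awayEval_comp_dehomog {K : Type} [CommRing K] [Algebra ℝ K] (ψ : A →ₐ[ℝ] K) (f : A)
    (hf : f ∈ 𝒜 1) (h : IsUnit (ψ f)) {k : ℕ} {a : A} (ha : a ∈ 𝒜 k) :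
    awayEval 𝒜 ψ f h (dehomog f hf a) * ψ f ^ k = ψ a := by
  rw [dehomog_apply f hf ha, awayEval_mk]

end GradedRing

/-! ### Real points of the affine charts of `Proj` -/

section ProjPoints

open HomogeneousLocalization

variable {A : Type} [CommRing A] [Algebra ℝ A] {𝒜 : ℕ → Submodule ℝ A} [GradedAlgebra 𝒜]

theorem awayι_projToSpecR {f : A} {m : ℕ} (hf : f ∈ 𝒜 m) (hm : 0 < m) :
    Proj.awayι 𝒜 f hf hm ≫ projToSpecR 𝒜 =
      Spec.map (CommRingCat.ofHom (algebraMap ℝ (Away 𝒜 f))) := by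
  rw [projToSpecR, Proj.awayι_toSpecZero_assoc, ← Spec.map_comp]
  rfl

/-- The real point of `Proj 𝒜`, lying in the affine chart `D₊(f)`, with coordinates given by an
`ℝ`-algebra homomorphism `χ` from the coordinate ring of the chart to `ℝ`. -/
def chartPoint {f : A} {m : ℕ} (hf : f ∈ 𝒜 m) (hm : 0 < m) (χ : Away 𝒜 f →ₐ[ℝ] ℝ) :
    RealLocus (projToSpecR 𝒜) :=
  ⟨Spec.map (CommRingCat.ofHom χ.toRingHom) ≫ Proj.awayι 𝒜 f hf hm, by
    rw [Category.assoc, awayι_projToSpecR, ← Spec.map_comp, ← CommRingCat.ofHom_comp,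
      show χ.toRingHom.comp (algebraMap ℝ (Away 𝒜 f)) = RingHom.id ℝ from χ.comp_algebraMap]
    simp⟩

theorem chartPoint_injective {f : A} {m : ℕ} (hf : f ∈ 𝒜 m) (hm : 0 < m) :
    Function.Injective (chartPoint hf hm) := by
  intro χ χ' h
  have h1 := congrArg Subtype.val h
  simp only [chartPoint] at h1
  rw [cancel_mono] at h1
  have h2 := congrArg CommRingCat.Hom.hom (Spec.map_injective h1)
  exact AlgHom.ext fun x => RingHom.congr_fun h2 x

theorem exists_eq_chartPoint {f : A} {m : ℕ} (hf : f ∈ 𝒜 m) (hm : 0 < m)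
    (p : RealLocus (projToSpecR 𝒜)) (hp : p.IsIn (Proj.basicOpen 𝒜 f)) :
    ∃ χ, p = chartPoint hf hm χ := by
  have hr : Set.range p.1 ⊆ Set.range (Proj.awayι 𝒜 f hf hm) := by
    rintro _ ⟨x, rfl⟩
    have := hp (show x ∈ ⊤ from trivial)
    rw [← Proj.opensRange_awayι 𝒜 f hf hm] at this
    exact this
  let g := IsOpenImmersion.lift (Proj.awayι 𝒜 f hf hm) p.1 hr
  have hg : g ≫ Proj.awayι 𝒜 f hf hm = p.1 := IsOpenImmersion.lift_fac _ _ _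
  obtain ⟨φ, hφ⟩ := Spec.map_surjective g
  have h2 : φ.hom.comp (algebraMap ℝ (Away 𝒜 f)) = RingHom.id ℝ := by
    have h3 : Spec.map (CommRingCat.ofHom (φ.hom.comp (algebraMap ℝ (Away 𝒜 f)))) =
        Spec.map (CommRingCat.ofHom (RingHom.id ℝ)) := by
      have h4 := p.2
      rw [← hg, Category.assoc, awayι_projToSpecR, ← hφ, ← Spec.map_comp] at h4
      rw [CommRingCat.ofHom_comp]
      refine h4.trans ?_
      simp
    exact congrArg CommRingCat.Hom.hom (Spec.map_injective h3)
  refine ⟨{ φ.hom with commutes' := fun r => RingHom.congr_fun h2 r }, Subtype.ext ?_⟩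
  rw [← hg, ← hφ]
  rfl

/-- The degree `0` fractions with denominators powers of `f`, seen as sections over `D₊(f)` and then
pulled back to the affine scheme `D₊(f) = Spec A_(f)`, are the corresponding global sections. -/
theorem awayToSection_appLE_awayι {f : A} {m : ℕ} (hf : f ∈ 𝒜 m) (hm : 0 < m)
    (h : ⊤ ≤ Proj.awayι 𝒜 f hf hm ⁻¹ᵁ Proj.basicOpen 𝒜 f) :
    Proj.awayToSection 𝒜 f ≫ (Proj.awayι 𝒜 f hf hm).appLE (Proj.basicOpen 𝒜 f) ⊤ h =
      (Scheme.ΓSpecIso _).inv := by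
  have h1 := Proj.basicOpenToSpec_app_top 𝒜 f
  have h2 : Proj.basicOpenToSpec 𝒜 f ≫ Proj.awayι 𝒜 f hf hm = (Proj.basicOpen 𝒜 f).ι := by
    rw [← Proj.basicOpenIsoSpec_hom 𝒜 f hf hm, Proj.awayι, Iso.hom_inv_id_assoc]
  have e : ⊤ ≤ Proj.basicOpenToSpec 𝒜 f ⁻¹ᵁ ⊤ := le_top
  have h3 : (Proj.basicOpenToSpec 𝒜 f).appLE ⊤ ⊤ e = (Scheme.ΓSpecIso _).hom ≫
      Proj.awayToSection 𝒜 f ≫ (Proj.basicOpen 𝒜 f).topIso.inv :=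
    (Scheme.Hom.appLE_eq_app _).trans h1
  have : IsIso (Proj.awayToSection 𝒜 f) := by
    rw [← Proj.basicOpenIsoAway_hom 𝒜 f hf hm]
    infer_instance
  have : IsIso ((Proj.basicOpenToSpec 𝒜 f).appLE ⊤ ⊤ e) := by
    rw [h3]
    infer_instance
  rw [← cancel_mono ((Proj.basicOpenToSpec 𝒜 f).appLE ⊤ ⊤ e), Category.assoc,
    Scheme.Hom.appLE_comp_appLE]
  simp only [h2, h3, Iso.inv_hom_id_assoc]
  congr 1

theorem specMap_appLE_top {R S : CommRingCat.{0}} (φ : R ⟶ S)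
    (h : (⊤ : (Spec S).Opens) ≤ Spec.map φ ⁻¹ᵁ ⊤) :
    (Spec.map φ).appLE ⊤ ⊤ h ≫ (Scheme.ΓSpecIso S).hom = (Scheme.ΓSpecIso R).hom ≫ φ := by
  rw [← Scheme.ΓSpecIso_naturality]
  congr 1

/-- A fraction of degree `0`, as a regular function on `D₊(f)`, takes at the point with coordinates
`χ` the value that `χ` gives it. -/
theorem value_chartPoint {f : A} {m : ℕ} (hf : f ∈ 𝒜 m) (hm : 0 < m) (χ : Away 𝒜 f →ₐ[ℝ] ℝ)
    (h : (chartPoint hf hm χ).IsIn (Proj.basicOpen 𝒜 f)) (x : Away 𝒜 f) :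
    RealLocus.value _ (chartPoint hf hm χ) h ((Proj.awayToSection 𝒜 f).hom x) = χ x := by
  have h1 : Proj.awayToSection 𝒜 f ≫ (chartPoint hf hm χ).1.appLE (Proj.basicOpen 𝒜 f) ⊤ h ≫
      (Scheme.ΓSpecIso (CommRingCat.of ℝ)).hom = CommRingCat.ofHom χ.toRingHom := by
    have h0 : (⊤ : (Spec (.of <| Away 𝒜 f)).Opens) ≤
        Proj.awayι 𝒜 f hf hm ⁻¹ᵁ Proj.basicOpen 𝒜 f := by
      rw [← Proj.opensRange_awayι 𝒜 f hf hm]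
      exact fun x _ => ⟨x, rfl⟩
    simp only [chartPoint]
    rw [← Scheme.Hom.appLE_comp_appLE _ _ _ ⊤ ⊤ h0 le_top, Category.assoc,
      reassoc_of% awayToSection_appLE_awayι hf hm h0, Iso.inv_comp_eq]
    exact specMap_appLE_top _ _
  exact congrArg (fun g => g.hom x) h1

theorem value_map {X : Scheme.{0}} {s : X ⟶ SpecR} {U V : X.Opens} (hVU : V ≤ U)
    (p : RealLocus s) (hU : p.IsIn U) (hV : p.IsIn V) (g : Γ(X, U)) :
    RealLocus.value V p hV ((X.presheaf.map (homOfLE hVU).op).hom g) =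
      RealLocus.value U p hU g := by
  have := Scheme.Hom.map_appLE p.1 hV (homOfLE hVU).op
  simp only [RealLocus.value]
  congr 1
  exact congrArg (fun k => k.hom g) this

end ProjPoints

/-! ### Real points of `Proj` in homogeneous coordinates -/

section EvalPoints

open HomogeneousLocalization

variable {A : Type} [CommRing A] [Algebra ℝ A] {𝒜 : ℕ → Submodule ℝ A} [GradedAlgebra 𝒜]

theorem chartPoint_isIn_iff {f g : A} {m n : ℕ} (hf : f ∈ 𝒜 m) (hm : 0 < m) (hg : g ∈ 𝒜 n)
    (hn : 0 < n) (χ : Away 𝒜 f →ₐ[ℝ] ℝ) :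
    (chartPoint hf hm χ).IsIn (Proj.basicOpen 𝒜 g) ↔ χ (Away.isLocalizationElem hf hg) ≠ 0 := by
  have key : (chartPoint hf hm χ).1 ⁻¹ᵁ Proj.basicOpen 𝒜 g =
      PrimeSpectrum.basicOpen (χ (Away.isLocalizationElem hf hg)) := by
    simp only [chartPoint, Scheme.Hom.comp_preimage]
    rw [Proj.awayι_preimage_basicOpen 𝒜 hf hm hg hn]
    rfl
  unfold RealLocus.IsIn
  rw [key]
  constructor
  · intro h h0
    have := h (show (⟨⊥, Ideal.isPrime_bot⟩ : PrimeSpectrum ℝ) ∈ (⊤ : (SpecR).Opens) from trivial)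
    rw [h0] at this
    exact this rfl
  · intro h x _ hx
    exact x.2.ne_top (Ideal.eq_top_of_isUnit_mem _ hx (isUnit_iff_ne_zero.mpr h))

variable (𝒜) in
/-- An `ℝ`-algebra homomorphism `A → ℝ` is nondegenerate if it does not vanish identically on the
elements of degree `1`. -/
abbrev Nondegenerate (ψ : A →ₐ[ℝ] ℝ) : Prop := ∃ f ∈ 𝒜 1, ψ f ≠ 0

/-- The real point of `Proj 𝒜` with homogeneous coordinates given by a nondegenerate homomorphism
`ψ : A → ℝ`. It is defined through one chart `D₊(f)` with `ψ f ≠ 0`, but does not depend on the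
chart; see `evalPoint_eq_chartPoint`. -/
def evalPoint (ψ : A →ₐ[ℝ] ℝ) (h : Nondegenerate 𝒜 ψ) : RealLocus (projToSpecR 𝒜) :=
  chartPoint h.choose_spec.1 one_pos
    (awayEval 𝒜 ψ h.choose (isUnit_iff_ne_zero.mpr h.choose_spec.2))

/-- The point defined by `ψ` in the chart `D₊(f)` is the one it defines in the smaller chart
`D₊(f g)`. -/
theorem chartPoint_awayEval_mul {f g : A} {m n : ℕ} (hf : f ∈ 𝒜 m) (hm : 0 < m) (hg : g ∈ 𝒜 n)
    (ψ : A →ₐ[ℝ] ℝ) (h : IsUnit (ψ f)) (h' : IsUnit (ψ (f * g))) (hfg : f * g ∈ 𝒜 (m + n)) :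
    chartPoint hf hm (awayEval 𝒜 ψ f h) =
      chartPoint hfg (by omega) (awayEval 𝒜 ψ (f * g) h') := by
  apply Subtype.ext
  simp only [chartPoint]
  rw [← Proj.SpecMap_awayMap_awayι 𝒜 hf hm hg rfl, ← Category.assoc, ← Spec.map_comp,
    ← CommRingCat.ofHom_comp]
  congr 3
  ext x
  obtain ⟨k, a, ha, rfl⟩ := Away.mk_surjective 𝒜 hf x
  have h1 := awayEval_mk ψ f h hf k a ha
  change awayEval 𝒜 ψ f h _ = awayEval 𝒜 ψ (f * g) h' _
  rw [awayMap_mk 𝒜 hg rfl k hf a ha]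
  have h2 := awayEval_mk ψ (f * g) h' hfg k (a * g ^ k)
    (by rw [smul_add]; exact SetLike.mul_mem_graded ha (SetLike.pow_mem_graded _ hg))
  refine (mul_left_injective₀ (pow_ne_zero k h'.ne_zero)) ?_
  simp only
  refine Eq.trans ?_ h2.symm
  rw [map_mul, mul_pow, ← mul_assoc, h1]
  simp

theorem evalPoint_eq_chartPoint (ψ : A →ₐ[ℝ] ℝ) (h : Nondegenerate 𝒜 ψ) {f : A} {m : ℕ}
    (hf : f ∈ 𝒜 m) (hm : 0 < m) (hψ : ψ f ≠ 0) :
    evalPoint ψ h = chartPoint hf hm (awayEval 𝒜 ψ f (isUnit_iff_ne_zero.mpr hψ)) := by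
  have hu : IsUnit (ψ (h.choose * f)) := by
    rw [map_mul]
    exact isUnit_iff_ne_zero.mpr (mul_ne_zero h.choose_spec.2 hψ)
  have hu' : IsUnit (ψ (f * h.choose)) := by rwa [mul_comm]
  have hmem : h.choose * f ∈ 𝒜 (1 + m) := SetLike.mul_mem_graded h.choose_spec.1 hf
  have hmem' : f * h.choose ∈ 𝒜 (m + 1) := SetLike.mul_mem_graded hf h.choose_spec.1
  rw [evalPoint, chartPoint_awayEval_mul _ _ hf _ _ hu hmem,
    chartPoint_awayEval_mul hf hm h.choose_spec.1 _ _ hu' hmem']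
  congr! 1
  · exact mul_comm _ _
  · exact add_comm _ _
  · congr! 1

theorem evalPoint_isIn_iff (ψ : A →ₐ[ℝ] ℝ) (h : Nondegenerate 𝒜 ψ) {f : A} {m : ℕ}
    (hf : f ∈ 𝒜 m) (hm : 0 < m) :
    (evalPoint ψ h).IsIn (Proj.basicOpen 𝒜 f) ↔ ψ f ≠ 0 := by
  rw [evalPoint, chartPoint_isIn_iff _ _ hf hm]
  have h1 := awayEval_mk ψ h.choose (isUnit_iff_ne_zero.mpr h.choose_spec.2) h.choose_spec.1 m
    (f ^ 1) (by simpa using hf)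
  have h2 : ψ f = awayEval 𝒜 ψ h.choose (isUnit_iff_ne_zero.mpr h.choose_spec.2)
    (Away.isLocalizationElem h.choose_spec.1 hf) * ψ h.choose ^ m := by
    exact (congrArg ψ (pow_one f)).symm.trans h1.symm
  rw [h2, mul_ne_zero_iff, and_iff_left (pow_ne_zero _ h.choose_spec.2)]

/-- Two homomorphisms `A → ℝ` are proportional if they define the same point in homogeneous
coordinates: they differ by a factor `c ^ k` in degree `k`, for some `c ≠ 0`. -/
def Proportional (𝒜 : ℕ → Submodule ℝ A) (ψ ψ' : A →ₐ[ℝ] ℝ) : Prop :=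
  ∃ c : ℝ, c ≠ 0 ∧ ∀ k, ∀ a ∈ 𝒜 k, ψ' a = c ^ k * ψ a

theorem Proportional.evalPoint_eq {ψ ψ' : A →ₐ[ℝ] ℝ} (H : Proportional 𝒜 ψ ψ')
    (h : Nondegenerate 𝒜 ψ) (h' : Nondegenerate 𝒜 ψ') :
    evalPoint ψ h = evalPoint ψ' h' := by
  obtain ⟨f, hf, hψ⟩ := id h
  obtain ⟨c, hc, H⟩ := H
  have hψ' : ψ' f ≠ 0 := by
    rw [H 1 f hf]
    exact mul_ne_zero (pow_ne_zero _ hc) hψ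
  rw [evalPoint_eq_chartPoint ψ h hf one_pos hψ, evalPoint_eq_chartPoint ψ' h' hf one_pos hψ']
  congr 1
  ext x
  obtain ⟨k, a, ha, rfl⟩ := Away.mk_surjective 𝒜 hf x
  have h1 := awayEval_mk ψ f (isUnit_iff_ne_zero.mpr hψ) hf k a ha
  have h2 := awayEval_mk ψ' f (isUnit_iff_ne_zero.mpr hψ') hf k a ha
  refine (mul_left_injective₀ (pow_ne_zero k hψ')) ?_
  simp only
  rw [h2, H _ a ha, H 1 f hf, mul_pow, ← h1]
  simp only [smul_eq_mul, mul_one, pow_one]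
  ring

theorem proportional_of_evalPoint_eq {ψ ψ' : A →ₐ[ℝ] ℝ}
    (h : Nondegenerate 𝒜 ψ) (h' : Nondegenerate 𝒜 ψ') (H : evalPoint ψ h = evalPoint ψ' h') :
    Proportional 𝒜 ψ ψ' := by
  obtain ⟨f, hf, hψ⟩ := id h
  have hψ' : ψ' f ≠ 0 := by
    rw [← evalPoint_isIn_iff ψ' h' hf one_pos, ← H, evalPoint_isIn_iff ψ h hf one_pos]
    exact hψ
  rw [evalPoint_eq_chartPoint ψ h hf one_pos hψ, evalPoint_eq_chartPoint ψ' h' hf one_pos hψ'] at H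
  have H' := chartPoint_injective hf one_pos H
  refine ⟨ψ' f / ψ f, div_ne_zero hψ' hψ, fun k a ha => ?_⟩
  have h1 := awayEval_comp_dehomog ψ f hf (isUnit_iff_ne_zero.mpr hψ) ha
  have h2 := awayEval_comp_dehomog ψ' f hf (isUnit_iff_ne_zero.mpr hψ') ha
  rw [← h1, ← h2, H', div_pow]
  field_simp

/-- Every real point of a chart `D₊(f)` with `f` of degree `1` has homogeneous coordinates,
normalized by `f = 1`. -/
theorem exists_eq_evalPoint (p : RealLocus (projToSpecR 𝒜)) {f : A} (hf : f ∈ 𝒜 1)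
    (hp : p.IsIn (Proj.basicOpen 𝒜 f)) :
    ∃ (ψ : A →ₐ[ℝ] ℝ) (h : Nondegenerate 𝒜 ψ), ψ f = 1 ∧ p = evalPoint ψ h := by
  obtain ⟨χ, rfl⟩ := exists_eq_chartPoint hf one_pos p hp
  have h1 : (χ.comp (dehomog f hf)) f = 1 := by simp [dehomog_self]
  refine ⟨χ.comp (dehomog f hf), ⟨f, hf, by simp [h1]⟩, h1, ?_⟩
  rw [evalPoint_eq_chartPoint _ _ hf one_pos (by simp [h1])]
  congr 1
  ext x
  obtain ⟨a, rfl⟩ := dehomog_surjective f hf x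
  obtain ⟨k, a, ha, hx⟩ := Away.mk_surjective 𝒜 hf (dehomog f hf a)
  rw [smul_eq_mul, mul_one] at ha
  have h2 := awayEval_comp_dehomog (χ.comp (dehomog f hf)) f hf (by simp [h1]) ha
  have h3 : (χ.comp (dehomog f hf)) f ^ k = 1 := by rw [h1, one_pow]
  rw [h3, mul_one, dehomog_apply f hf ha, hx] at h2
  rw [h2, AlgHom.comp_apply, dehomog_apply f hf ha, hx]

theorem IsIn.mono {X : Scheme.{0}} {s : X ⟶ SpecR} {p : RealLocus s} {U V : X.Opens}
    (hp : p.IsIn U) (h : U ≤ V) : p.IsIn V :=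
  fun _ hx => h (hp hx)

/-- As `Spec ℝ` has a single point, a real point lies in an open subscheme if and only if the
underlying point does. -/
theorem isIn_iff_mem {X : Scheme.{0}} {s : X ⟶ SpecR} (p : RealLocus s) (U : X.Opens) :
    p.IsIn U ↔ p.1 (⊥ : PrimeSpectrum ℝ) ∈ U := by
  refine ⟨fun h => h trivial, fun h x _ => ?_⟩
  rw [Subsingleton.elim (α := PrimeSpectrum ℝ) x ⊥]
  exact h

theorem exists_mem_basicOpen (x : Proj 𝒜) :
    ∃ (m : ℕ) (f : A), 0 < m ∧ f ∈ 𝒜 m ∧ x ∈ Proj.basicOpen 𝒜 f := by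
  by_contra! H
  refine x.not_irrelevant_le ((HomogeneousIdeal.toIdeal_irrelevant_le _).mpr fun i hi f hf => ?_)
  by_contra hx
  exact H i f hi hf hx

theorem exists_homogeneous_basicOpen_le (U : (Proj 𝒜).Opens) (x : Proj 𝒜) (hx : x ∈ U) :
    ∃ (m : ℕ) (f : A), 0 < m ∧ f ∈ 𝒜 m ∧ x ∈ Proj.basicOpen 𝒜 f ∧ Proj.basicOpen 𝒜 f ≤ U := by
  obtain ⟨_, ⟨f, rfl⟩, hpf, hfU⟩ := (TopologicalSpace.Opens.isBasis_iff_nbhd.mp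
    (Proj.isBasis_basicOpen 𝒜)) hx
  rw [Proj.basicOpen_eq_iSup_proj] at hpf hfU
  obtain ⟨i, hi⟩ := TopologicalSpace.Opens.mem_iSup.mp hpf
  obtain ⟨m, g, hm, hg, hxg⟩ := exists_mem_basicOpen x
  refine ⟨i + m, GradedRing.proj 𝒜 i f * g, by omega,
    SetLike.mul_mem_graded (SetLike.coe_mem _) hg, ?_, ?_⟩
  · rw [Proj.basicOpen_mul]
    exact ⟨hi, hxg⟩
  · rw [Proj.basicOpen_mul]
    exact inf_le_left.trans ((le_iSup _ i).trans hfU)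

theorem awayToSection_surjective {f : A} {m : ℕ} (hf : f ∈ 𝒜 m) (hm : 0 < m) :
    Function.Surjective (Proj.awayToSection 𝒜 f).hom := by
  have : IsIso (Proj.awayToSection 𝒜 f) := by
    rw [← Proj.basicOpenIsoAway_hom 𝒜 f hf hm]
    infer_instance
  exact (ConcreteCategory.bijective_of_isIso (Proj.awayToSection 𝒜 f)).2

theorem value_awayToSection (ψ : A →ₐ[ℝ] ℝ) (h : Nondegenerate 𝒜 ψ) {f : A} {m : ℕ}
    (hf : f ∈ 𝒜 m) (hm : 0 < m) (hψ : ψ f ≠ 0)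
    (hV : (evalPoint ψ h).IsIn (Proj.basicOpen 𝒜 f)) (x : Away 𝒜 f) :
    RealLocus.value _ (evalPoint ψ h) hV ((Proj.awayToSection 𝒜 f).hom x) =
      awayEval 𝒜 ψ f (isUnit_iff_ne_zero.mpr hψ) x := by
  generalize hp : evalPoint ψ h = p at hV
  rw [evalPoint_eq_chartPoint ψ h hf hm hψ] at hp
  subst hp
  exact value_chartPoint hf hm _ hV x

/-- Near a real point a regular function is a fraction `a / f ^ k`: at a real point with homogeneous
coordinates `ψ` such that `ψ f ≠ 0` it takes the value `ψ a / ψ f ^ k`. -/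
theorem exists_fraction (U : (Proj 𝒜).Opens) (g : Γ(Proj 𝒜, U)) (p : RealLocus (projToSpecR 𝒜))
    (hp : p.IsIn U) :
    ∃ (m : ℕ) (f : A) (k : ℕ) (a : A), 0 < m ∧ f ∈ 𝒜 m ∧ p.IsIn (Proj.basicOpen 𝒜 f) ∧
      ∀ (ψ : A →ₐ[ℝ] ℝ) (h : Nondegenerate 𝒜 ψ), ψ f ≠ 0 → ∃ hU : (evalPoint ψ h).IsIn U,
        RealLocus.value U (evalPoint ψ h) hU g = ψ a / ψ f ^ k := by
  obtain ⟨m, f, hm, hf, hp', hfU⟩ :=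
    exists_homogeneous_basicOpen_le U _ ((isIn_iff_mem p U).mp hp)
  obtain ⟨x, hx⟩ := awayToSection_surjective hf hm ((Proj 𝒜).presheaf.map (homOfLE hfU).op g)
  obtain ⟨k, a, ha, rfl⟩ := Away.mk_surjective 𝒜 hf x
  refine ⟨m, f, k, a, hm, hf, (isIn_iff_mem p _).mpr hp', fun ψ h hψ => ?_⟩
  have hV := (evalPoint_isIn_iff ψ h hf hm).mpr hψ
  refine ⟨IsIn.mono hV hfU, ?_⟩
  rw [eq_div_iff (pow_ne_zero _ hψ), ← awayEval_mk ψ f (isUnit_iff_ne_zero.mpr hψ) hf k a ha,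
    ← value_awayToSection ψ h hf hm hψ hV, hx, ← value_map hfU _ _ hV]

end EvalPoints

/-! ### Smooth quotients -/

section SmoothQuotient

variable {E H : Type*} [NormedAddCommGroup E] [NormedSpace ℝ E] [TopologicalSpace H]
  (I : ModelWithCorners ℝ E H) {N : Type*} [TopologicalSpace N] [ChartedSpace H N]

/-- A map `π : N → M` from a `C^∞` manifold to a space with a notion `SM` of `C^∞` functions is a
smooth quotient if `M` carries the quotient topology and its `C^∞` functions are the functions which
are `C^∞` on `N` after composition with `π`. So `M`, as a topological space with a sheaf of `C^∞`
functions, is determined by the equivalence relation on `N`. -/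
structure IsSmoothQuotient {M : Type*} [TopologicalSpace M] (SM : Set M → (M → ℝ) → Prop)
    (π : N → M) : Prop where
  isQuotientMap : Topology.IsQuotientMap π
  smooth_iff : ∀ W, IsOpen W → ∀ g, SM W g ↔ ContMDiffOn I 𝓘(ℝ, ℝ) ∞ (g ∘ π) (π ⁻¹' W)

variable {I}

/-- Two smooth quotients of the same manifold by the same equivalence relation are diffeomorphic. -/
theorem IsSmoothQuotient.diffeomorphic {M M' : Type*} [TopologicalSpace M] [TopologicalSpace M']
    {SM : Set M → (M → ℝ) → Prop} {SM' : Set M' → (M' → ℝ) → Prop} {π : N → M} {π' : N → M'}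
    (h : IsSmoothQuotient I SM π) (h' : IsSmoothQuotient I SM' π')
    (hfib : ∀ n n', π n = π n' ↔ π' n = π' n') : Diffeomorphic SM SM' := by
  have hs := Function.surjInv_eq h.isQuotientMap.surjective
  have hs' := Function.surjInv_eq h'.isQuotientMap.surjective
  let a : M → M' := fun x => π' (Function.surjInv h.isQuotientMap.surjective x)
  let b : M' → M := fun x => π (Function.surjInv h'.isQuotientMap.surjective x)
  have ha : a ∘ π = π' := by
    funext n
    exact (hfib _ _).mp (hs (π n))
  have hb : b ∘ π' = π := by
    funext n
    exact (hfib _ _).mpr (hs' (π' n))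
  let e : M ≃ₜ M' :=
    { toFun := a
      invFun := b
      left_inv := fun x => by
        obtain ⟨n, rfl⟩ := h.isQuotientMap.surjective x
        rw [show a (π n) = π' n from congrFun ha n]
        exact congrFun hb n
      right_inv := fun x => by
        obtain ⟨n, rfl⟩ := h'.isQuotientMap.surjective x
        rw [show b (π' n) = π n from congrFun hb n]
        exact congrFun ha n
      continuous_toFun := by
        rw [h.isQuotientMap.continuous_iff, ha]
        exact h'.isQuotientMap.continuous
      continuous_invFun := by
        rw [h'.isQuotientMap.continuous_iff, hb]
        exact h.isQuotientMap.continuous }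
  have he : e ∘ π = π' := ha
  refine ⟨e, fun W hW g => ?_⟩
  rw [h'.smooth_iff W hW, h.smooth_iff _ (hW.preimage e.continuous), Function.comp_assoc, he,
    ← Set.preimage_comp, he]

end SmoothQuotient

section RealLocusTopology

variable {X : Scheme.{0}} {s : X ⟶ SpecR}

theorem isOpen_value (U : X.Opens) (g : Γ(X, U)) (V : Set ℝ) (hV : IsOpen V) :
    IsOpen {p : RealLocus s | ∃ h : p.IsIn U, RealLocus.value U p h g ∈ V} :=
  TopologicalSpace.isOpen_generateFrom_of_mem ⟨U, g, V, hV, rfl⟩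

theorem isOpen_isIn (U : X.Opens) : IsOpen {p : RealLocus s | p.IsIn U} := by
  convert isOpen_value (s := s) U 0 Set.univ isOpen_univ using 3
  simp

open Classical in
/-- The value at a real point `p` of a regular function on `U`, extended by `0` to the points not
in `U`. -/
def valueOrZero (U : X.Opens) (g : Γ(X, U)) (p : RealLocus s) : ℝ :=
  if h : p.IsIn U then RealLocus.value U p h g else 0

theorem valueOrZero_eq {U : X.Opens} {p : RealLocus s} (h : p.IsIn U) (g : Γ(X, U)) :
    valueOrZero U g p = RealLocus.value U p h g := dif_pos h

theorem continuousAt_valueOrZero {U : X.Opens} {p : RealLocus s} (h : p.IsIn U) (g : Γ(X, U)) :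
    ContinuousAt (valueOrZero (s := s) U g) p := by
  rw [ContinuousAt, tendsto_nhds]
  intro V hV hp
  refine Filter.mem_of_superset ((isOpen_value U g V hV).mem_nhds ⟨h, ?_⟩) ?_
  · rwa [valueOrZero_eq h] at hp
  · rintro q ⟨hq, hqV⟩
    rwa [Set.mem_preimage, valueOrZero_eq hq]

end RealLocusTopology

section ProjSmoothQuotient

open HomogeneousLocalization

variable {A : Type} [CommRing A] [Algebra ℝ A] {𝒜 : ℕ → Submodule ℝ A} [GradedAlgebra 𝒜]

/-- If `ψ f = 1`, then dehomogenization with respect to `f` does not change the values of `ψ`, on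
nonhomogeneous elements as well. -/
theorem awayEval_dehomog_of_eq_one {K : Type} [CommRing K] [Algebra ℝ K] (ψ : A →ₐ[ℝ] K) (f : A)
    (hf : f ∈ 𝒜 1) (h : IsUnit (ψ f)) (h1 : ψ f = 1) (a : A) :
    awayEval 𝒜 ψ f h (dehomog f hf a) = ψ a := by
  induction a using DirectSum.Decomposition.inductionOn 𝒜 with
  | zero => simp
  | homogeneous a =>
    have := awayEval_comp_dehomog ψ f hf h a.2
    simpa [h1] using this
  | add a b ha hb => simp [ha, hb]

variable {E H : Type*} [NormedAddCommGroup E] [NormedSpace ℝ E] [TopologicalSpace H]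
  {I : ModelWithCorners ℝ E H} {N : Type*} [TopologicalSpace N] [ChartedSpace H N]

/-- If the homogeneous coordinates `ψ n` of a real point depend smoothly on `n`, then so do the
values of regular functions at this point. -/
theorem exists_local_value (ψ : N → A →ₐ[ℝ] ℝ) (hψ : ∀ n, Nondegenerate 𝒜 (ψ n))
    (hsm : ∀ a, ContMDiff I 𝓘(ℝ, ℝ) ∞ fun n => ψ n a) (U : (Proj 𝒜).Opens) (g : Γ(Proj 𝒜, U))
    (n₀ : N) (h₀ : (evalPoint (ψ n₀) (hψ n₀)).IsIn U) :
    ContMDiffAt I 𝓘(ℝ, ℝ) ∞ (fun n => valueOrZero U g (evalPoint (ψ n) (hψ n))) n₀ ∧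
      ∀ᶠ n in nhds n₀, (evalPoint (ψ n) (hψ n)).IsIn U := by
  obtain ⟨m, f, k, a, hm, hf, hp, H⟩ := exists_fraction U g _ h₀
  rw [evalPoint_isIn_iff _ _ hf hm] at hp
  have hne : ∀ᶠ n in nhds n₀, ψ n f ≠ 0 :=
    (hsm f).continuous.continuousAt.eventually_ne hp
  constructor
  · have h1 : ContMDiffAt I 𝓘(ℝ, ℝ) ∞ (fun n => ψ n a / ψ n f ^ k) n₀ :=
      (hsm a).contMDiffAt.div₀ ((hsm f).contMDiffAt.pow k) (pow_ne_zero _ hp)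
    refine h1.congr_of_eventuallyEq ?_
    filter_upwards [hne] with n hn
    obtain ⟨hU, h⟩ := H _ (hψ n) hn
    rw [valueOrZero_eq hU, h]
  · filter_upwards [hne] with n hn
    exact (H _ (hψ n) hn).1

theorem continuous_evalPoint (ψ : N → A →ₐ[ℝ] ℝ) (hψ : ∀ n, Nondegenerate 𝒜 (ψ n))
    (hsm : ∀ a, ContMDiff I 𝓘(ℝ, ℝ) ∞ fun n => ψ n a) :
    Continuous fun n => evalPoint (ψ n) (hψ n) := by
  refine continuous_generateFrom_iff.mpr ?_
  rintro _ ⟨U, g, V, hV, rfl⟩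
  rw [isOpen_iff_mem_nhds]
  rintro n₀ ⟨h₀, hv⟩
  obtain ⟨h1, h2⟩ := exists_local_value ψ hψ hsm U g n₀ h₀
  rw [← valueOrZero_eq] at hv
  filter_upwards [h2, h1.continuousAt.eventually (hV.mem_nhds hv)] with n hn hn'
  exact ⟨hn, by rwa [← valueOrZero_eq]⟩

/-- A criterion for a map from a manifold to the real locus of `Proj 𝒜`, given in homogeneous
coordinates `ψ n` that depend smoothly on `n`, to be a smooth quotient. It is enough that the real
locus is covered by charts `f i = 1` and that, on each chart, finitely many regular functions `b i
j` take values in an open set `O` on which a smooth map `κ` recovers a preimage of the point: then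
`κ ∘ b i` is a local section of the map, which is smooth as a function of regular functions. Here
the `b i j` may be nonhomogeneous; they stand for their dehomogenizations. -/
theorem isSmoothQuotient_evalPoint (ψ : N → A →ₐ[ℝ] ℝ) (hψ : ∀ n, Nondegenerate 𝒜 (ψ n))
    (hsm : ∀ a, ContMDiff I 𝓘(ℝ, ℝ) ∞ fun n => ψ n a)
    {ι : Type*} (f : ι → A) (hf : ∀ i, f i ∈ 𝒜 1)
    (hcov : ∀ p : RealLocus (projToSpecR 𝒜), ∃ i, p.IsIn (Proj.basicOpen 𝒜 (f i)))
    {τ : Type*} [Fintype τ] (b : ι → τ → A) (O : Set (τ → ℝ)) (hO : IsOpen O) (κ : (τ → ℝ) → N)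
    (hκ : ContMDiffOn 𝓘(ℝ, τ → ℝ) I ∞ κ O)
    (hloc : ∀ i (χ : A →ₐ[ℝ] ℝ), χ (f i) = 1 →
      (fun j => χ (b i j)) ∈ O ∧ Proportional 𝒜 χ (ψ (κ fun j => χ (b i j)))) :
    IsSmoothQuotient I (RealLocus.SmoothOn (projToSpecR 𝒜))
      fun n => evalPoint (ψ n) (hψ n) := by
  set π : N → RealLocus (projToSpecR 𝒜) := fun n => evalPoint (ψ n) (hψ n) with hπ
  have hπc : Continuous π := continuous_evalPoint ψ hψ hsm
  -- The local coordinates on the chart of `f i`, and the local section of `π` they define.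
  let y : ∀ i : ι, τ → Γ(Proj 𝒜, Proj.basicOpen 𝒜 (f i)) := fun i j =>
    (Proj.awayToSection 𝒜 (f i)).hom (dehomog (f i) (hf i) (b i j))
  let c : ι → RealLocus (projToSpecR 𝒜) → τ → ℝ := fun i p j => valueOrZero _ (y i j) p
  have hc : ∀ i p, p.IsIn (Proj.basicOpen 𝒜 (f i)) → c i p ∈ O ∧ π (κ (c i p)) = p := by
    intro i p hp
    obtain ⟨χ, hχ, h1, rfl⟩ := exists_eq_evalPoint p (hf i) hp
    have h2 : c i (evalPoint χ hχ) = fun j => χ (b i j) := by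
      funext j
      simp only [c, y]
      rw [valueOrZero_eq hp, value_awayToSection χ hχ (hf i) one_pos (by simp [h1]),
        awayEval_dehomog_of_eq_one _ _ _ _ h1]
    obtain ⟨h3, h4⟩ := hloc i χ h1
    rw [h2]
    exact ⟨h3, (h4.evalPoint_eq hχ (hψ _)).symm⟩
  have hcc : ∀ i p, p.IsIn (Proj.basicOpen 𝒜 (f i)) → ContinuousAt (c i) p := fun i p hp =>
    continuousAt_pi.mpr fun j => continuousAt_valueOrZero hp _
  constructor
  · refine ⟨.of_isOpen_preimage_iff_isOpen fun V => ⟨fun h => ?_, fun h => h.preimage hπc⟩,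
      fun p => ?_⟩
    rotate_left
    · obtain ⟨i, hi⟩ := hcov p
      exact ⟨_, (hc i p hi).2⟩
    · rw [isOpen_iff_mem_nhds]
      intro p hp
      obtain ⟨i, hi⟩ := hcov p
      obtain ⟨h1, h2⟩ := hc i p hi
      have h3 : ContinuousAt (fun q => κ (c i q)) p :=
        ContinuousAt.comp (hκ.continuousOn.continuousAt (hO.mem_nhds h1)) (hcc i p hi)
      have h4 : κ (c i p) ∈ π ⁻¹' V := by
        rw [Set.mem_preimage, h2]
        exact hp
      filter_upwards [h3.eventually (h.mem_nhds h4), (isOpen_isIn _).mem_nhds hi] with q hq hq'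
      rw [← (hc i q hq').2]
      exact hq
  · intro W hW g
    constructor
    -- A smooth function of regular functions is smooth on `N`, as the regular functions are.
    · intro hg n₀ hn₀
      obtain ⟨U, n, f', O', φ, hO', hφ, hev⟩ := hg (π n₀) hn₀
      obtain ⟨hU, hmem, -⟩ := hev.self_of_nhds
      have h1 : ContMDiffAt I 𝓘(ℝ, Fin n → ℝ) ∞ (fun x i => valueOrZero U (f' i) (π x)) n₀ :=
        contMDiffAt_pi_space.mpr fun i => (exists_local_value ψ hψ hsm U (f' i) n₀ hU).1
      have h2 : (fun i => valueOrZero U (f' i) (π n₀)) ∈ O' := by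
        simpa only [valueOrZero_eq hU] using hmem
      have h3 : ContMDiffAt I 𝓘(ℝ, ℝ) ∞ (fun x => φ fun i => valueOrZero U (f' i) (π x)) n₀ :=
        ContMDiffAt.comp (g := φ) n₀ (hφ.contDiffAt (hO'.mem_nhds h2)).contMDiffAt h1
      refine (h3.congr_of_eventuallyEq ?_).contMDiffWithinAt
      filter_upwards [hπc.continuousAt.eventually hev] with x ⟨hx, _, hgx⟩
      simp only [Function.comp_apply, hgx, valueOrZero_eq hx]
    -- Conversely, `g` is the function `g ∘ π ∘ κ` of the local coordinates.
    · intro hg p hp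
      obtain ⟨i, hi⟩ := hcov p
      -- `SmoothOn` asks for regular functions indexed by `Fin n`.
      let e := Fintype.equivFin τ
      let l : (Fin (Fintype.card τ) → ℝ) → τ → ℝ := fun x j => x (e j)
      have hl : ContDiff ℝ ∞ l := contDiff_pi.mpr fun j => contDiff_apply ℝ ℝ (e j)
      have hO' : IsOpen (O ∩ κ ⁻¹' (π ⁻¹' W)) :=
        hκ.continuousOn.isOpen_inter_preimage hO (hW.preimage hπc)
      refine ⟨Proj.basicOpen 𝒜 (f i), Fintype.card τ, fun j => y i (e.symm j),
        l ⁻¹' (O ∩ κ ⁻¹' (π ⁻¹' W)), fun x => g (π (κ (l x))), hO'.preimage hl.continuous, ?_, ?_⟩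
      · rw [← contMDiffOn_iff_contDiffOn]
        exact ContMDiffOn.comp (g := g ∘ π) hg
          (ContMDiffOn.comp (g := κ) hκ hl.contMDiff.contMDiffOn fun x hx => hx.1)
          fun x hx => hx.2
      · filter_upwards [(isOpen_isIn _).mem_nhds hi, hW.mem_nhds hp] with q hq hqW
        obtain ⟨h1, h2⟩ := hc i q hq
        have h3 : (l fun j => RealLocus.value _ q hq (y i (e.symm j))) = c i q := by
          funext j
          simp only [l, c, Equiv.symm_apply_apply]
          rw [valueOrZero_eq hq]
        refine ⟨hq, ?_, ?_⟩
        · rw [Set.mem_preimage, h3]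
          exact ⟨h1, by rw [Set.mem_preimage, Set.mem_preimage, h2]; exact hqW⟩
        · rw [h3, h2]

end ProjSmoothQuotient

/-! ### The twisted product and `S¹ × ℙ²(ℝ)` as smooth quotients -/

section ManifoldQuotient

variable {E H : Type*} [NormedAddCommGroup E] [NormedSpace ℝ E] [TopologicalSpace H]
  {I : ModelWithCorners ℝ E H} {N : Type*} [TopologicalSpace N] [ChartedSpace H N]
  {M : Type*} [TopologicalSpace M] [ChartedSpace H M]

/-- If the chart of `M` at `m` is a local section `s` of `π` followed by the chart of `N` at `s m`,
then smoothness at `m` can be read off on `N`. -/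
theorem contMDiffAt_iff_comp_lift {π : N → M} {m : M} (s : OpenPartialHomeomorph M N)
    (hs : ⇑s.symm = π) (hchart : chartAt H m = s ≫ₕ chartAt H (s m))
    (g : M → ℝ) : ContMDiffAt I 𝓘(ℝ, ℝ) ∞ g m ↔ ContMDiffAt I 𝓘(ℝ, ℝ) ∞ (g ∘ π) (s m) := by
  rw [contMDiffAt_iff_source, contMDiffAt_iff_source]
  have h1 : extChartAt I m m = extChartAt I (s m) (s m) := by
    simp [extChartAt, hchart]
  have h2 : ⇑(extChartAt I m).symm = π ∘ (extChartAt I (s m)).symm := by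
    funext x
    simp [extChartAt, hchart, hs]
  rw [h1, h2]
  rfl

/-- A quotient map whose charts are lifted from `N` through local sections, and whose fibres are
related by smooth deck transformations, is a smooth quotient. -/
theorem isSmoothQuotient_of_chart_lift {π : N → M} (hπ : Topology.IsQuotientMap π)
    (hchart : ∀ m, ∃ s : OpenPartialHomeomorph M N, m ∈ s.source ∧ ⇑s.symm = π ∧
      chartAt H m = s ≫ₕ chartAt H (s m))
    (htrans : ∀ n n', π n = π n' → ∃ τ : N → N, ContMDiff I I ∞ τ ∧ τ n = n' ∧ π ∘ τ = π) :
    IsSmoothQuotient I (fun (W : Set M) (g : M → ℝ) => ContMDiffOn I 𝓘(ℝ, ℝ) ∞ g W) π := by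
  refine ⟨hπ, fun W hW g => ⟨fun h n hn => ?_, fun h m hm => ?_⟩⟩
  · obtain ⟨s, hs, hsπ, hsc⟩ := hchart (π n)
    have h1 := (contMDiffAt_iff_comp_lift s hsπ hsc g).mp (h.contMDiffAt (hW.mem_nhds hn))
    have h2 : π (s (π n)) = π n := by
      rw [← hsπ]
      exact s.left_inv (hsπ ▸ hs)
    -- The section used by the chart at `π n` need not pass through `n`: a deck transformation moves
    -- `n` to the point where it does.
    obtain ⟨τ, hτ, hτn, hτπ⟩ := htrans n (s (π n)) h2.symm
    rw [← hτn] at h1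
    have h3 := ContMDiffAt.comp n h1 hτ.contMDiffAt
    rw [Function.comp_assoc, hτπ] at h3
    exact h3.contMDiffWithinAt
  · obtain ⟨s, hs, hsπ, hsc⟩ := hchart m
    refine ((contMDiffAt_iff_comp_lift s hsπ hsc g).mpr
      (h.contMDiffAt ((hW.preimage hπ.continuous).mem_nhds ?_))).contMDiffWithinAt
    have h2 : π (s m) = m := by
      rw [← hsπ]
      exact s.left_inv hs
    rwa [Set.mem_preimage, h2]

variable {G : Type*} [Group G] [MulAction G N] [ProperlyDiscontinuousSMul G N]
  [ContinuousConstSMul G N] [IsCancelSMul G N] [T2Space N] [LocallyCompactSpace N]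

/-- The charts of the quotient by a free properly discontinuous action are the charts of the total
space, lifted through local inverses of the quotient map. -/
theorem quotient_chart_lift (m : MulAction.orbitRel.Quotient G N) :
    ∃ s : OpenPartialHomeomorph (MulAction.orbitRel.Quotient G N) N,
      m ∈ s.source ∧ ⇑s.symm = Quotient.mk'' ∧ chartAt H m = s ≫ₕ chartAt H (s m) := by
  have hl := (isQuotientCoveringMap_quotientMk_of_properlyDiscontinuousSMul (G := G)
    (E := N)).isCoveringMap.isLocalHomeomorph
  have hr := (Quotient.mk_surjective (s := MulAction.orbitRel G N)).hasRightInverse.choose_spec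
  set r := (Quotient.mk_surjective (s := MulAction.orbitRel G N)).hasRightInverse.choose
  have h1 : m ∈ (hl.localInverseAt (r m)).source := by
    have := hl.apply_self_mem_localInverseAt_source (x := r m)
    rwa [hr m] at this
  have h2 : hl.localInverseAt (r m) m = r m := by
    have := hl.localInverseAt_apply_self (x := r m)
    rwa [hr m] at this
  refine ⟨hl.localInverseAt (r m), h1, hl.localInverseAt_symm _, ?_⟩
  rw [h2]
  rfl

end ManifoldQuotient

section Spheres

theorem contMDiff_units_smul_sphere (n : ℕ) (ε : ℤˣ) :
    ContMDiff (𝓡 n) (𝓡 n) ∞ fun x : UnitSphere n => ε • x := by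
  rcases Int.units_eq_one_or ε with rfl | rfl
  · simp only [one_smul]
    exact contMDiff_id
  · simp only [neg_one_smul_sphere]
    have : Fact (Module.finrank ℝ (EuclideanSpace ℝ (Fin (n + 1))) = n + 1) :=
      ⟨finrank_euclideanSpace_fin⟩
    exact contMDiff_neg_sphere

theorem isSmoothQuotient_twistedProduct :
    IsSmoothQuotient ((𝓡 1).prod (𝓡 2))
      (fun (W : Set TwistedProduct) (g : TwistedProduct → ℝ) =>
        ContMDiffOn ((𝓡 1).prod (𝓡 2)) 𝓘(ℝ, ℝ) ∞ g W)
      (Quotient.mk'' : UnitSphere 1 × UnitSphere 2 → TwistedProduct) := by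
  refine isSmoothQuotient_of_chart_lift isQuotientMap_quotient_mk' quotient_chart_lift
    fun n n' h => ?_
  obtain ⟨ε, rfl⟩ := Quotient.exact h.symm
  refine ⟨fun x => ε • x, ?_, rfl, ?_⟩
  · exact ((contMDiff_units_smul_sphere 1 ε).comp contMDiff_fst).prodMk
      ((contMDiff_units_smul_sphere 2 ε).comp contMDiff_snd)
  · funext x
    exact Quotient.sound ⟨ε, rfl⟩

theorem isSmoothQuotient_prod_projectivePlane :
    IsSmoothQuotient ((𝓡 1).prod (𝓡 2))
      (fun (W : Set (UnitSphere 1 × RealProjectivePlane))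
          (g : UnitSphere 1 × RealProjectivePlane → ℝ) =>
        ContMDiffOn ((𝓡 1).prod (𝓡 2)) 𝓘(ℝ, ℝ) ∞ g W)
      (Prod.map id Quotient.mk'' : UnitSphere 1 × UnitSphere 2 →
        UnitSphere 1 × RealProjectivePlane) := by
  refine isSmoothQuotient_of_chart_lift ?_ ?_ ?_
  · exact (IsOpenQuotientMap.id.prodMap MulAction.isOpenQuotientMap_quotientMk).isQuotientMap
  · rintro ⟨c, m⟩
    obtain ⟨s, hs, hsπ, hsc⟩ := quotient_chart_lift (H := EuclideanSpace ℝ (Fin 2)) m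
    refine ⟨(OpenPartialHomeomorph.refl _).prod s, ⟨trivial, hs⟩, ?_, ?_⟩
    · funext x
      simp [Prod.map, hsπ]
    · rw [prodChartedSpace_chartAt, prodChartedSpace_chartAt, OpenPartialHomeomorph.prod_trans, hsc]
      simp
  · rintro ⟨c, v⟩ ⟨c', v'⟩ h
    simp only [Prod.map, Prod.mk.injEq, id] at h
    obtain ⟨rfl, h⟩ := h
    obtain ⟨ε, rfl⟩ := Quotient.exact h.symm
    refine ⟨Prod.map id (ε • ·), contMDiff_id.prodMap (contMDiff_units_smul_sphere 2 ε), rfl, ?_⟩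
    funext x
    exact Prod.ext rfl (Quotient.sound ⟨ε, rfl⟩)

end Spheres

/-! ### Section rings of bigraded algebras -/

open MvPolynomial

section WeightedAeval

variable {τ : Type} {w : τ → ℕ × ℕ}

/-- A form of bidegree `a` scales by `l ^ a.1 * m ^ a.2` under the action of the two-dimensional
torus whose weights are the bidegrees of the variables. -/
theorem aeval_weighted {K : Type*} [CommRing K] [Algebra ℝ K] (l m : K) (y : τ → K)
    {G : MvPolynomial τ ℝ} {a : ℕ × ℕ} (hG : IsWeightedHomogeneous w G a) :
    aeval (fun j => l ^ (w j).1 * m ^ (w j).2 * y j) G = l ^ a.1 * m ^ a.2 * aeval y G := by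
  rw [aeval_def, aeval_def, eval₂_eq, eval₂_eq, Finset.mul_sum]
  refine Finset.sum_congr rfl fun α hα => ?_
  have h1 := hG (mem_support_iff.mp hα)
  rw [Finsupp.weight_apply, Finsupp.sum] at h1
  have h2 : (∏ i ∈ α.support, (l ^ (w i).1 * m ^ (w i).2 * y i) ^ α i) =
      l ^ a.1 * m ^ a.2 * ∏ i ∈ α.support, y i ^ α i := by
    rw [← h1, Prod.fst_sum, Prod.snd_sum, ← Finset.prod_pow_eq_pow_sum,
      ← Finset.prod_pow_eq_pow_sum, ← Finset.prod_mul_distrib, ← Finset.prod_mul_distrib]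
    refine Finset.prod_congr rfl fun i _ => ?_
    simp only [Prod.smul_fst, Prod.smul_snd, smul_eq_mul, mul_pow, ← pow_mul]
    ring
  rw [h2]
  ring

end WeightedAeval

section WeightedRing

variable {τ : Type} (w : τ → ℕ × ℕ) (w₀ : ℕ × ℕ) (J : Ideal (MvPolynomial τ ℝ))

/-- The image in `ℝ[X] / J` of the forms of bidegree `k w₀`, where the variables have the bidegrees
`w`. -/
def weightedGrading (k : ℕ) : Submodule ℝ (MvPolynomial τ ℝ ⧸ J) :=
  (weightedHomogeneousSubmodule ℝ w (k • w₀)).map (Ideal.Quotient.mkₐ ℝ J).toLinearMap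

instance : SetLike.GradedMonoid (weightedGrading w w₀ J) where
  one_mem := ⟨1, by
    rw [zero_smul]
    exact isWeightedHomogeneous_one ℝ _, by simp⟩
  mul_mem := by
    rintro i j _ _ ⟨f, hf, rfl⟩ ⟨g, hg, rfl⟩
    refine ⟨f * g, ?_, by simp⟩
    rw [add_smul]
    exact IsWeightedHomogeneous.mul hf hg

/-- The homogeneous coordinate ring, for the line bundle of bidegree `w₀`, of the variety with
bihomogeneous coordinate ring `ℝ[X] / J`: the ring `⨁ k, (ℝ[X] / J)_{k w₀}`. -/
abbrev WeightedRing : Type := sectionRing (weightedGrading w w₀ J)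

/-- The grading of `⨁ k, (ℝ[X] / J)_{k w₀}` by `k`. -/
abbrev weightedRingGrading : ℕ → Submodule ℝ (WeightedRing w w₀ J) :=
  sectionGrading (weightedGrading w w₀ J)

variable {w w₀} in
/-- The element of degree `k` of `⨁ k, (ℝ[X] / J)_{k w₀}` defined by a form of bidegree `k w₀`. -/
def form (k : ℕ) (G : MvPolynomial τ ℝ) (hG : IsWeightedHomogeneous w G (k • w₀)) :
    WeightedRing w w₀ J :=
  ⟨Polynomial.monomial k (Ideal.Quotient.mk J G), fun l => by
    rw [Polynomial.coeff_monomial]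
    split_ifs with h
    · subst h
      exact ⟨G, hG, rfl⟩
    · exact Submodule.zero_mem _⟩

variable {w w₀ J}

theorem coe_form (k : ℕ) (G : MvPolynomial τ ℝ) (hG : IsWeightedHomogeneous w G (k • w₀)) :
    (form J k G hG : Polynomial (MvPolynomial τ ℝ ⧸ J)) =
      Polynomial.monomial k (Ideal.Quotient.mk J G) := rfl

theorem form_mem (k : ℕ) (G : MvPolynomial τ ℝ) (hG : IsWeightedHomogeneous w G (k • w₀)) :
    form J k G hG ∈ weightedRingGrading w w₀ J k := fun l hl => by
  simp [coe_form, Polynomial.coeff_monomial, hl.symm]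

theorem exists_eq_form {k : ℕ} {a : WeightedRing w w₀ J} (ha : a ∈ weightedRingGrading w w₀ J k) :
    ∃ G hG, a = form J k G hG := by
  obtain ⟨G, hG, h⟩ := a.2 k
  have hG' : IsWeightedHomogeneous w G (k • w₀) := hG
  refine ⟨G, hG', Subtype.ext <| Polynomial.ext fun l => ?_⟩
  rw [coe_form, Polynomial.coeff_monomial]
  split_ifs with hl
  · subst hl
    exact h.symm
  · exact ha l (Ne.symm hl)

theorem form_induction {P : WeightedRing w w₀ J → Prop} (h0 : P 0)
    (hadd : ∀ a b, P a → P b → P (a + b)) (hform : ∀ k G hG, P (form J k G hG)) (a) : P a := by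
  induction a using DirectSum.Decomposition.inductionOn (weightedRingGrading w w₀ J) with
  | zero => exact h0
  | homogeneous a =>
    obtain ⟨G, hG, h⟩ := exists_eq_form a.2
    rw [h]
    exact hform _ _ _
  | add a b ha hb => exact hadd _ _ ha hb

variable {K : Type} [CommRing K] [Algebra ℝ K]

variable (w w₀) in
/-- The evaluation at a point `v` of the affine cone `J = 0` in the space of the variables. -/
def evalRing (v : τ → K) (hv : ∀ P ∈ J, aeval v P = 0) : WeightedRing w w₀ J →ₐ[ℝ] K :=
  (((Polynomial.aeval (1 : K)).restrictScalars ℝ).comp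
    (Polynomial.mapAlgHom (Ideal.Quotient.liftₐ J (aeval v) hv))).comp
      (sectionRing (weightedGrading w w₀ J)).val

theorem evalRing_form (v : τ → K) (hv : ∀ P ∈ J, aeval v P = 0) (k : ℕ) (G : MvPolynomial τ ℝ)
    (hG : IsWeightedHomogeneous w G (k • w₀)) :
    evalRing w w₀ v hv (form J k G hG) = aeval v G := by
  simp only [evalRing, AlgHom.comp_apply, Subalgebra.coe_val, coe_form]
  rw [Polynomial.coe_mapAlgHom, Polynomial.map_monomial, AlgHom.restrictScalars_apply,
    Polynomial.aeval_monomial, one_pow, mul_one]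
  exact Ideal.Quotient.lift_mk J (aeval v : MvPolynomial τ ℝ →ₐ[ℝ] K).toRingHom hv

/-- If the elements `b j` are the variables rescaled by an element `(l, m)` of the torus, then forms
evaluated at `b` are rescaled according to their bidegree. Here `l` and `m` need not lie in the
section ring, so the identity lives in the larger ring `(ℝ[X] / J)[T]`. -/
theorem coe_aeval_eq_mul (b : τ → WeightedRing w w₀ J)
    (l m : Polynomial (MvPolynomial τ ℝ ⧸ J))
    (hb : ∀ j, (b j : Polynomial (MvPolynomial τ ℝ ⧸ J)) =
      l ^ (w j).1 * m ^ (w j).2 * Polynomial.C (Ideal.Quotient.mk J (X j)))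
    {a : ℕ × ℕ} (G : MvPolynomial τ ℝ) (hG : IsWeightedHomogeneous w G a) :
    ((aeval b G : WeightedRing w w₀ J) : Polynomial (MvPolynomial τ ℝ ⧸ J)) =
      l ^ a.1 * m ^ a.2 * Polynomial.C (Ideal.Quotient.mk J G) := by
  have h1 : ((aeval b G : WeightedRing w w₀ J) : Polynomial (MvPolynomial τ ℝ ⧸ J)) =
      aeval (fun j => (b j : Polynomial (MvPolynomial τ ℝ ⧸ J))) G :=
    comp_aeval_apply b (sectionRing (weightedGrading w w₀ J)).val G
  have h2 : aeval (fun j => Polynomial.C (Ideal.Quotient.mk J (X j))) G =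
      Polynomial.C (Ideal.Quotient.mk J G) := by
    have : aeval (fun j => Polynomial.C (Ideal.Quotient.mk J (X j))) =
        (Polynomial.CAlgHom (R := ℝ)).comp (Ideal.Quotient.mkₐ ℝ J) := by
      ext j
      simp
    rw [this]
    rfl
  rw [h1, funext hb, aeval_weighted _ _ _ hG, h2]

/-- Homogenization: if rescaling the variables by `(l, m)` gives elements `b j` of the section ring
and turns the bidegree `w₀` into the factor `f ^ r`, then a form of bidegree `k w₀` becomes
`f ^ (r * k)` times itself when evaluated at `b`. -/
theorem aeval_eq_pow_mul_form (f : WeightedRing w w₀ J) (b : τ → WeightedRing w w₀ J)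
    (l m : Polynomial (MvPolynomial τ ℝ ⧸ J)) (r : ℕ)
    (hb : ∀ j, (b j : Polynomial (MvPolynomial τ ℝ ⧸ J)) =
      l ^ (w j).1 * m ^ (w j).2 * Polynomial.C (Ideal.Quotient.mk J (X j)))
    (hf : l ^ w₀.1 * m ^ w₀.2 = (f : Polynomial (MvPolynomial τ ℝ ⧸ J)) ^ r * Polynomial.X)
    (k : ℕ) (G : MvPolynomial τ ℝ) (hG : IsWeightedHomogeneous w G (k • w₀)) :
    aeval b G = f ^ (r * k) * form J k G hG := by
  apply Subtype.ext
  rw [coe_aeval_eq_mul b l m hb G hG, MulMemClass.coe_mul, coe_form,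
    ← Polynomial.C_mul_X_pow_eq_monomial, Prod.smul_fst, Prod.smul_snd, smul_eq_mul, smul_eq_mul,
    SubmonoidClass.coe_pow]
  have h1 : l ^ (k * w₀.1) * m ^ (k * w₀.2) = (l ^ w₀.1 * m ^ w₀.2) ^ k := by ring
  rw [h1, hf]
  ring

/-- The elements `b j` satisfy the bihomogeneous equations in `J`. -/
theorem aeval_eq_zero_of_mem (b : τ → WeightedRing w w₀ J)
    (l m : Polynomial (MvPolynomial τ ℝ ⧸ J))
    (hb : ∀ j, (b j : Polynomial (MvPolynomial τ ℝ ⧸ J)) =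
      l ^ (w j).1 * m ^ (w j).2 * Polynomial.C (Ideal.Quotient.mk J (X j)))
    {a : ℕ × ℕ} (G : MvPolynomial τ ℝ) (hG : IsWeightedHomogeneous w G a) (hJ : G ∈ J) :
    aeval b G = 0 := by
  apply Subtype.ext
  rw [coe_aeval_eq_mul b l m hb G hG, Ideal.Quotient.eq_zero_iff_mem.mpr hJ]
  simp

/-- On the chart `f = 1` every form is a polynomial in the coordinates `b j`: the value of a form
under a homomorphism `χ` with `χ f = 1` is obtained by evaluating it at the point `(χ (b j))`. -/
theorem map_form (f : WeightedRing w w₀ J) (b : τ → WeightedRing w w₀ J)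
    (l m : Polynomial (MvPolynomial τ ℝ ⧸ J)) (r : ℕ)
    (hb : ∀ j, (b j : Polynomial (MvPolynomial τ ℝ ⧸ J)) =
      l ^ (w j).1 * m ^ (w j).2 * Polynomial.C (Ideal.Quotient.mk J (X j)))
    (hf : l ^ w₀.1 * m ^ w₀.2 = (f : Polynomial (MvPolynomial τ ℝ ⧸ J)) ^ r * Polynomial.X)
    (χ : WeightedRing w w₀ J →ₐ[ℝ] K) (hχ : χ f = 1)
    (k : ℕ) (G : MvPolynomial τ ℝ) (hG : IsWeightedHomogeneous w G (k • w₀)) :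
    χ (form J k G hG) = aeval (fun j => χ (b j)) G := by
  have h := congrArg χ (aeval_eq_pow_mul_form f b l m r hb hf k G hG)
  rw [map_mul, map_pow, hχ, one_pow, one_mul] at h
  rw [← h]
  exact (MvPolynomial.comp_aeval_apply b χ G)

theorem contMDiff_aeval {E H : Type*} [NormedAddCommGroup E] [NormedSpace ℝ E]
    [TopologicalSpace H] {I : ModelWithCorners ℝ E H} {N : Type*} [TopologicalSpace N]
    [ChartedSpace H N] {σ : Type*} (v : N → σ → ℝ)
    (hsm : ∀ j, ContMDiff I 𝓘(ℝ, ℝ) ∞ fun n => v n j) (G : MvPolynomial σ ℝ) :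
    ContMDiff I 𝓘(ℝ, ℝ) ∞ fun n => aeval (v n) G := by
  induction G using MvPolynomial.induction_on with
  | C a => simpa only [aeval_C] using contMDiff_const
  | add p q hp hq =>
    simp only [map_add]
    exact hp.add hq
  | mul_X p j hp =>
    simp only [map_mul, aeval_X]
    exact hp.mul (hsm j)

theorem contMDiff_evalRing {E H : Type*} [NormedAddCommGroup E] [NormedSpace ℝ E]
    [TopologicalSpace H] {I : ModelWithCorners ℝ E H} {N : Type*} [TopologicalSpace N]
    [ChartedSpace H N] (v : N → τ → ℝ) (hv : ∀ n, ∀ P ∈ J, aeval (v n) P = 0)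
    (hsm : ∀ j, ContMDiff I 𝓘(ℝ, ℝ) ∞ fun n => v n j) (a : WeightedRing w w₀ J) :
    ContMDiff I 𝓘(ℝ, ℝ) ∞ fun n => evalRing w w₀ (v n) (hv n) a := by
  induction a using form_induction with
  | h0 => simpa only [map_zero] using contMDiff_const
  | hadd a b ha hb =>
    simp only [map_add]
    exact ha.add hb
  | hform k G hG =>
    simp only [evalRing_form]
    exact contMDiff_aeval v hsm G

theorem isWeightedHomogeneous_monomial_one {α : τ →₀ ℕ} {a : ℕ × ℕ}
    (h : Finsupp.weight w α = a) : IsWeightedHomogeneous w (monomial α (1 : ℝ)) a :=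
  isWeightedHomogeneous_monomial _ _ _ h

variable (w w₀ J) in
/-- The element of degree `k` of the section ring defined by a monomial of bidegree `k w₀`. -/
def monomialForm (k : ℕ) (α : τ →₀ ℕ) (h : Finsupp.weight w α = k • w₀) : WeightedRing w w₀ J :=
  form J k (monomial α 1) (isWeightedHomogeneous_monomial_one h)

theorem monomialForm_add {k l : ℕ} {α β : τ →₀ ℕ} (hα : Finsupp.weight w α = k • w₀)
    (hβ : Finsupp.weight w β = l • w₀) (h : Finsupp.weight w (α + β) = (k + l) • w₀) :
    monomialForm w w₀ J (k + l) (α + β) h =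
      monomialForm w w₀ J k α hα * monomialForm w w₀ J l β hβ := by
  apply Subtype.ext
  simp only [monomialForm, MulMemClass.coe_mul, coe_form, Polynomial.monomial_mul_monomial,
    ← map_mul, monomial_mul, mul_one]

/-- The elements of degree `k` are spanned by the monomials. -/
theorem form_mem_of_monomialForm_mem {P : Submodule ℝ (WeightedRing w w₀ J)} {k : ℕ}
    (hP : ∀ α h, monomialForm w w₀ J k α h ∈ P) (G : MvPolynomial τ ℝ)
    (hG : IsWeightedHomogeneous w G (k • w₀)) : form J k G hG ∈ P := by
  have h1 : form J k G hG = ∑ α : G.support, G.coeff α •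
      monomialForm w w₀ J k α (hG (mem_support_iff.mp α.2)) := by
    apply Subtype.ext
    rw [AddSubmonoidClass.coe_finsetSum]
    simp only [monomialForm, SetLike.val_smul, coe_form, Polynomial.smul_monomial, ← map_sum]
    congr 1
    conv_lhs => rw [G.as_sum]
    rw [map_sum, ← Finset.sum_coe_sort]
    refine Finset.sum_congr rfl fun α _ => ?_
    rw [← Ideal.Quotient.mkₐ_eq_mk ℝ, ← map_smul, smul_monomial, smul_eq_mul, mul_one]
  rw [h1]
  exact Submodule.sum_mem _ fun α _ => P.smul_mem _ (hP _ _)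

/-- The sets `D₊` of the monomials of positive degree cover `Proj`. -/
theorem exists_monomialForm_notMem (x : Proj (weightedRingGrading w w₀ J)) :
    ∃ k α h, 0 < k ∧ x ∈ Proj.basicOpen _ (monomialForm w w₀ J k α h) := by
  obtain ⟨k, a, hk, ha, hx⟩ := exists_mem_basicOpen x
  obtain ⟨G, hG, rfl⟩ := exists_eq_form ha
  by_contra! H
  refine hx (form_mem_of_monomialForm_mem
    (P := (x.asHomogeneousIdeal.toIdeal).restrictScalars ℝ) (fun α h => ?_) G hG)
  by_contra hα
  exact H k α h hk hα

end WeightedRing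

/-! ### Maps to spheres -/

section SphereMaps

open Classical in
/-- The radial projection `x ↦ x / ‖x‖` to the unit sphere, with an arbitrary value at `0`. -/
def normalizeSphere (n : ℕ) (x : EuclideanSpace ℝ (Fin (n + 1))) : UnitSphere n :=
  if h : x = 0 then ⟨EuclideanSpace.single 0 1, by simp⟩
  else ⟨‖x‖⁻¹ • x, by simp [norm_smul, h]⟩

theorem coe_normalizeSphere {n : ℕ} {x : EuclideanSpace ℝ (Fin (n + 1))} (h : x ≠ 0) :
    (normalizeSphere n x : EuclideanSpace ℝ (Fin (n + 1))) = ‖x‖⁻¹ • x := by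
  simp [normalizeSphere, h]

theorem contMDiffOn_normalizeSphere (n : ℕ) :
    ContMDiffOn 𝓘(ℝ, EuclideanSpace ℝ (Fin (n + 1))) (𝓡 n) ∞ (normalizeSphere n) {x | x ≠ 0} := by
  have : Fact (Module.finrank ℝ (EuclideanSpace ℝ (Fin (n + 1))) = n + 1) :=
    ⟨finrank_euclideanSpace_fin⟩
  let U : TopologicalSpace.Opens (EuclideanSpace ℝ (Fin (n + 1))) := ⟨{x | x ≠ 0}, isOpen_ne⟩
  have h1 : ContMDiff 𝓘(ℝ, EuclideanSpace ℝ (Fin (n + 1))) 𝓘(ℝ, EuclideanSpace ℝ (Fin (n + 1))) ∞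
      fun x : U => ‖(x : EuclideanSpace ℝ (Fin (n + 1)))‖⁻¹ • (x : EuclideanSpace ℝ (Fin (n + 1))) := by
    intro x
    refine (contMDiffAt_subtype_iff (f := fun x : EuclideanSpace ℝ (Fin (n + 1)) =>
      ‖x‖⁻¹ • x)).mpr ?_
    exact (((contDiffAt_norm ℝ x.2).inv (norm_ne_zero_iff.mpr x.2)).smul contDiffAt_id).contMDiffAt
  have h0 (x : U) : ‖(x : EuclideanSpace ℝ (Fin (n + 1)))‖⁻¹ •
      (x : EuclideanSpace ℝ (Fin (n + 1))) ∈ Metric.sphere (0 : EuclideanSpace ℝ (Fin (n + 1))) 1 := by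
    have := x.2
    simp only [mem_sphere_iff_norm, sub_zero, norm_smul, norm_inv, norm_norm]
    exact inv_mul_cancel₀ (norm_ne_zero_iff.mpr this)
  have h2 := ContMDiff.codRestrict_sphere (n := n) h1 h0
  intro x hx
  refine ContMDiffAt.contMDiffWithinAt ?_
  rw [← contMDiffAt_subtype_iff (U := U) (x := ⟨x, hx⟩)]
  have h3 : (fun y : U => normalizeSphere n y) = Set.codRestrict (fun y : U =>
      ‖(y : EuclideanSpace ℝ (Fin (n + 1)))‖⁻¹ • (y : EuclideanSpace ℝ (Fin (n + 1)))) _ h0 := by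
    funext y
    apply Subtype.ext
    rw [coe_normalizeSphere y.2]
    rfl
  rw [h3]
  exact h2 ⟨x, hx⟩

theorem contMDiff_sphere_coord (n : ℕ) (i : Fin (n + 1)) :
    ContMDiff (𝓡 n) 𝓘(ℝ, ℝ) ∞
      fun x : UnitSphere n => (x : EuclideanSpace ℝ (Fin (n + 1))) i := by
  have : Fact (Module.finrank ℝ (EuclideanSpace ℝ (Fin (n + 1))) = n + 1) :=
    ⟨finrank_euclideanSpace_fin⟩
  exact ((EuclideanSpace.proj (𝕜 := ℝ) i).contDiff.contMDiff).comp contMDiff_coe_sphere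

theorem sphere_sum_sq {n : ℕ} (x : UnitSphere n) :
    ∑ i, (x : EuclideanSpace ℝ (Fin (n + 1))) i ^ 2 = 1 := by
  have h := EuclideanSpace.norm_sq_eq (x : EuclideanSpace ℝ (Fin (n + 1)))
  have h2 : ‖(x : EuclideanSpace ℝ (Fin (n + 1)))‖ = 1 := by simp
  rw [h2] at h
  simpa using h.symm

theorem sphere_coord_ne_zero {n : ℕ} (x : UnitSphere n) :
    (fun i => (x : EuclideanSpace ℝ (Fin (n + 1))) i) ≠ 0 := by
  intro h
  have h1 := sphere_sum_sq x
  simp [show ∀ i, (x : EuclideanSpace ℝ (Fin (n + 1))) i = 0 from congrFun h] at h1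

/-- Two proportional points of the unit sphere are equal up to sign. -/
theorem exists_units_smul_eq {n : ℕ} {x y : UnitSphere n} {t : ℝ}
    (h : ∀ i, (y : EuclideanSpace ℝ (Fin (n + 1))) i = t * (x : EuclideanSpace ℝ (Fin (n + 1))) i) :
    ∃ ε : ℤˣ, t = ((ε : ℤ) : ℝ) ∧ y = ε • x := by
  have h1 : t ^ 2 = 1 := by
    have h2 := sphere_sum_sq y
    simp only [h, mul_pow, ← Finset.mul_sum, sphere_sum_sq, mul_one] at h2
    exact h2
  rcases sq_eq_one_iff.mp h1 with rfl | rfl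
  · refine ⟨1, by simp, Subtype.ext <| PiLp.ext fun i => ?_⟩
    rw [h, one_smul, one_mul]
  · refine ⟨-1, by simp, Subtype.ext <| PiLp.ext fun i => ?_⟩
    rw [h, neg_one_smul_sphere, neg_one_mul]
    rfl

theorem units_smul_sphere_apply {n : ℕ} (ε : ℤˣ) (x : UnitSphere n) (i : Fin (n + 1)) :
    ((ε • x : UnitSphere n) : EuclideanSpace ℝ (Fin (n + 1))) i =
      ((ε : ℤ) : ℝ) * (x : EuclideanSpace ℝ (Fin (n + 1))) i := by
  rcases Int.units_eq_one_or ε with rfl | rfl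
  · simp
  · rw [neg_one_smul_sphere]
    simp

end SphereMaps

/-! ### Charts of the conic bundle -/

section MonomialCover

variable {τ : Type} {w : τ → ℕ × ℕ} {w₀ : ℕ × ℕ} {J : Ideal (MvPolynomial τ ℝ)}

theorem aeval_eq_zero_of_mem_span {σ K : Type*} [CommRing K] [Algebra ℝ K] {g : MvPolynomial σ ℝ}
    {v : σ → K} (h : aeval v g = 0) : ∀ P ∈ Ideal.span {g}, aeval v P = 0 := by
  intro P hP
  obtain ⟨a, rfl⟩ := Ideal.mem_span_singleton'.mp hP
  rw [map_mul, h, mul_zero]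

theorem monomialForm_nsmul {k : ℕ} {α : τ →₀ ℕ} (h : Finsupp.weight w α = k • w₀) (n : ℕ)
    (hn : Finsupp.weight w (n • α) = (n * k) • w₀) :
    monomialForm w w₀ J (n * k) (n • α) hn = monomialForm w w₀ J k α h ^ n := by
  apply Subtype.ext
  simp only [monomialForm, SubmonoidClass.coe_pow, coe_form, Polynomial.monomial_pow,
    ← map_pow, monomial_pow, one_pow, mul_comm]

/-- If a monomial `X ^ γ` of degree `1` divides a power of the monomial `X ^ α`, then
`D₊(X ^ α) ⊆ D₊(X ^ γ)`. -/
theorem mem_basicOpen_of_le_nsmul {x : Proj (weightedRingGrading w w₀ J)} {k : ℕ} {α : τ →₀ ℕ}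
    (h : Finsupp.weight w α = k • w₀) (hx : x ∈ Proj.basicOpen _ (monomialForm w w₀ J k α h))
    (n : ℕ) (hn : 0 < n) (hk : 0 < k) {γ : τ →₀ ℕ} (hγ : γ ≤ n • α)
    (h1 : Finsupp.weight w γ = 1 • w₀) :
    x ∈ Proj.basicOpen _ (monomialForm w w₀ J 1 γ h1) := by
  obtain ⟨β, hβ⟩ := exists_add_of_le hγ
  have h2 : Finsupp.weight w (n • α) = (n * k) • w₀ := by rw [map_nsmul, h, smul_smul]
  obtain ⟨m, hm⟩ : ∃ m, n * k = 1 + m := Nat.exists_eq_add_of_le (Nat.mul_pos hn hk)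
  have h3 : Finsupp.weight w β = m • w₀ := by
    have h4 := h2
    rw [hβ, map_add, h1, hm, add_smul] at h4
    exact add_left_cancel h4
  have h5 : monomialForm w w₀ J k α h ^ n =
      monomialForm w w₀ J 1 γ h1 * monomialForm w w₀ J m β h3 := by
    rw [← monomialForm_nsmul h n h2, ← monomialForm_add h1 h3 (by rw [map_add, h1, h3, add_smul])]
    apply Subtype.ext
    simp only [monomialForm, coe_form, hβ, hm]
  have h6 : x ∈ Proj.basicOpen _ (monomialForm w w₀ J k α h ^ n) := by
    rwa [Proj.basicOpen_pow _ _ n hn]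
  rw [h5, Proj.basicOpen_mul] at h6
  exact h6.1

end MonomialCover

section ConicBundleChart

variable {d : ℕ} {F : MvPolynomial (Fin 3) ℝ}

theorem isWeightedHomogeneous_rename {σ τ : Type*} {w : τ → ℕ × ℕ} {e : σ → τ} {a : ℕ × ℕ}
    (hw : ∀ i, w (e i) = a) {G : MvPolynomial σ ℝ} {n : ℕ} (hG : G.IsHomogeneous n) :
    IsWeightedHomogeneous w (rename e G) (n • a) := by
  rw [G.as_sum, map_sum]
  refine Submodule.sum_mem (weightedHomogeneousSubmodule ℝ w (n • a)) fun α hα => ?_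
  rw [rename_monomial]
  refine isWeightedHomogeneous_monomial _ _ _ ?_
  have h1 := hG (mem_support_iff.mp hα)
  rw [Finsupp.weight_apply, Finsupp.sum_mapDomain_index (by simp) (by intros; rw [add_smul])]
  simp only [hw]
  rw [← h1, Finsupp.weight_apply, Finsupp.sum, Finsupp.sum, Finset.sum_smul]
  simp

theorem equation_isWeightedHomogeneous (hF : F.IsHomogeneous (2 * d)) :
    IsWeightedHomogeneous (bidegree d) (equation F) (2 * d, 2) := by
  have h (i : Fin 3 ⊕ Fin 3) : IsWeightedHomogeneous (bidegree d) (X i ^ 2 : CoxRing)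
      (2 • bidegree d i) := (isWeightedHomogeneous_X ℝ _ i).pow 2
  have h1 := isWeightedHomogeneous_rename (w := bidegree d) (e := Sum.inl) (a := (1, 0))
    (fun i => rfl) hF
  have h2 := (h (Sum.inr 2)).mul h1
  have h0 := h (Sum.inr 0)
  have h0' := h (Sum.inr 1)
  simp only [bidegree, Sum.elim_inr] at h0 h0' h2
  have e1 : 2 • ((0, 1) : ℕ × ℕ) + (2 * d) • ((1, 0) : ℕ × ℕ) = (2 * d, 2) := by ext <;> simp
  have e2 : 2 • ((d, 1) : ℕ × ℕ) = (2 * d, 2) := by ext <;> simp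
  simp only [Matrix.cons_val] at h0 h0' h2
  rw [e1] at h2
  rw [e2] at h0 h0'
  exact Submodule.sub_mem (weightedHomogeneousSubmodule ℝ (bidegree d) (2 * d, 2))
    (Submodule.add_mem _ h0 h0') h2

/-- The value of the equation of the conic bundle is `s² + t² - u² F(x, y, z)`. -/
theorem aeval_equation {K : Type*} [CommRing K] [Algebra ℝ K] (v : Fin 3 ⊕ Fin 3 → K) :
    aeval v (equation F) = v (Sum.inr 0) ^ 2 + v (Sum.inr 1) ^ 2 -
      v (Sum.inr 2) ^ 2 * aeval (fun i => v (Sum.inl i)) F := by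
  simp only [equation, map_sub, map_add, map_mul, map_pow, aeval_X, aeval_rename]
  rfl

variable (d F) in
/-- The homogeneous coordinate ring of the conic bundle `s² + t² = u² F` for the line bundle of
bidegree `(d + 1, 1)`. -/
abbrev ConicBundleRing : Type := WeightedRing (bidegree d) (d + 1, 1) (Ideal.span {equation F})

theorem isWeightedHomogeneous_inl_mul {g : CoxRing}
    (hg : IsWeightedHomogeneous (bidegree d) g (d, 1)) (j : Fin 3) :
    IsWeightedHomogeneous (bidegree d) (X (Sum.inl j) * g) (1 • (d + 1, 1)) := by
  have h := (isWeightedHomogeneous_X ℝ (bidegree d) (Sum.inl j)).mul hg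
  convert h using 1
  simp [bidegree, add_comm]

theorem isWeightedHomogeneous_inl_pow_mul (l : Fin 3) :
    IsWeightedHomogeneous (bidegree d) (X (Sum.inl l) ^ (d + 1) * X (Sum.inr 2) : CoxRing)
      (1 • (d + 1, 1)) := by
  have h := ((isWeightedHomogeneous_X ℝ (bidegree d) (Sum.inl l)).pow (d + 1)).mul
    (isWeightedHomogeneous_X ℝ (bidegree d) (Sum.inr 2))
  convert h using 1
  simp [bidegree]

theorem isWeightedHomogeneous_inr {i : Fin 3} (hi : i ≠ 2) :
    IsWeightedHomogeneous (bidegree d) (X (Sum.inr i) : CoxRing) (d, 1) := by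
  have h := isWeightedHomogeneous_X ℝ (bidegree d) (Sum.inr i)
  convert h using 1
  fin_cases i <;> simp_all [bidegree]

variable (F) in
/-- The section `x_j g` of the line bundle of bidegree `(d + 1, 1)`, for a form `g` of bidegree
`(d, 1)`; here `x_0, x_1, x_2` are the coordinates of `ℙ²`. -/
def chartForm {g : CoxRing} (hg : IsWeightedHomogeneous (bidegree d) g (d, 1)) (j : Fin 3) :
    ConicBundleRing d F :=
  form _ 1 (X (Sum.inl j) * g) (isWeightedHomogeneous_inl_mul hg j)

variable (d F) in
/-- The section `x_l ^ (d + 1) u` of the line bundle of bidegree `(d + 1, 1)`. -/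
def baseForm (l : Fin 3) : ConicBundleRing d F :=
  form _ 1 (X (Sum.inl l) ^ (d + 1) * X (Sum.inr 2)) (isWeightedHomogeneous_inl_pow_mul l)

variable (F) in
/-- The coordinates `x_j g`, `(x_l g) ^ d (x_l s)`, `(x_l g) ^ d (x_l t)`, `x_l ^ (d + 1) u` on the
chart `x_l g ≠ 0`, for a form `g` of bidegree `(d, 1)`. They are the variables rescaled by the
element `(g, x_l ^ (d + 1))` of the torus. -/
def chartCoord {g : CoxRing} (hg : IsWeightedHomogeneous (bidegree d) g (d, 1)) (l : Fin 3) :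
    Fin 3 ⊕ Fin 3 → ConicBundleRing d F :=
  Sum.elim (fun j => chartForm F hg j) ![
    chartForm F hg l ^ d * chartForm F (isWeightedHomogeneous_inr (i := 0) (by decide)) l,
    chartForm F hg l ^ d * chartForm F (isWeightedHomogeneous_inr (i := 1) (by decide)) l,
    baseForm d F l]

section

variable {g : CoxRing} (hg : IsWeightedHomogeneous (bidegree d) g (d, 1)) (l : Fin 3)

theorem coe_chartCoord (j : Fin 3 ⊕ Fin 3) :
    (chartCoord F hg l j : Polynomial (CoordRing F)) =
      Polynomial.monomial 1 (Ideal.Quotient.mk _ g) ^ (bidegree d j).1 *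
        Polynomial.monomial 1 (Ideal.Quotient.mk _ (X (Sum.inl l) ^ (d + 1))) ^ (bidegree d j).2 *
        Polynomial.C (Ideal.Quotient.mk (Ideal.span {equation F}) (X j)) := by
  have h (i : Fin 3) (hi : i ≠ 2) : ((chartForm F hg l ^ d *
      chartForm F (isWeightedHomogeneous_inr hi) l : ConicBundleRing d F) :
        Polynomial (CoordRing F)) = Polynomial.monomial 1 (Ideal.Quotient.mk _ g) ^ d *
      Polynomial.monomial 1 (Ideal.Quotient.mk _ (X (Sum.inl l) ^ (d + 1))) ^ 1 *
      Polynomial.C (Ideal.Quotient.mk (Ideal.span {equation F}) (X (Sum.inr i))) := by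
    rw [MulMemClass.coe_mul, SubmonoidClass.coe_pow]
    simp only [chartForm, coe_form, ← Polynomial.C_mul_X_eq_monomial, map_mul, map_pow]
    ring
  rcases j with j | j
  · refine (coe_form 1 _ (isWeightedHomogeneous_inl_mul hg j)).trans ?_
    simp only [bidegree, Sum.elim_inl, ← Polynomial.C_mul_X_eq_monomial, map_mul]
    ring
  · fin_cases j
    · exact h 0 (by decide)
    · exact h 1 (by decide)
    · refine (coe_form 1 _ (isWeightedHomogeneous_inl_pow_mul l)).trans ?_
      simp [bidegree, ← Polynomial.C_mul_X_eq_monomial]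
      ring

theorem chart_weight :
    (Polynomial.monomial 1 (Ideal.Quotient.mk (Ideal.span {equation F}) g)) ^ (d + 1, 1).1 *
        Polynomial.monomial 1 (Ideal.Quotient.mk _ (X (Sum.inl l) ^ (d + 1))) ^ (d + 1, 1).2 =
      (chartForm F hg l : Polynomial (CoordRing F)) ^ (d + 1) * Polynomial.X := by
  simp only [chartForm, coe_form, ← Polynomial.C_mul_X_eq_monomial, map_mul, map_pow]
  ring

theorem map_form_chart {K : Type} [CommRing K] [Algebra ℝ K] (χ : ConicBundleRing d F →ₐ[ℝ] K)
    (hχ : χ (chartForm F hg l) = 1) (k : ℕ) (G : CoxRing)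
    (hG : IsWeightedHomogeneous (bidegree d) G (k • (d + 1, 1))) :
    χ (form _ k G hG) = aeval (fun j => χ (chartCoord F hg l j)) G :=
  map_form _ _ _ _ _ (coe_chartCoord hg l) (chart_weight hg l) χ hχ k G hG

theorem chart_equation (hF : F.IsHomogeneous (2 * d)) (χ : ConicBundleRing d F →ₐ[ℝ] ℝ) :
    χ (chartCoord F hg l (Sum.inr 0)) ^ 2 + χ (chartCoord F hg l (Sum.inr 1)) ^ 2 =
      χ (chartCoord F hg l (Sum.inr 2)) ^ 2 *
        aeval (fun i => χ (chartCoord F hg l (Sum.inl i))) F := by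
  have h := aeval_eq_zero_of_mem (chartCoord F hg l) _ _ (coe_chartCoord hg l) (equation F)
    (equation_isWeightedHomogeneous hF) (Ideal.subset_span rfl)
  have h1 := (MvPolynomial.comp_aeval_apply (chartCoord F hg l) χ (equation F)).symm
  rw [h, map_zero, aeval_equation] at h1
  linarith

end

end ConicBundleChart

/-! ### Real points of the conic bundle -/

section ConicBundleCover

variable {d : ℕ} {F : MvPolynomial (Fin 3) ℝ}

/-- The conic bundle is covered by the charts `x_l ^ (d + 1) u ≠ 0`, `x_l s ≠ 0` and `x_l t ≠ 0`. -/
theorem exists_mem_basicOpen_chartForm (x : Proj (weightedRingGrading (bidegree d) (d + 1, 1)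
      (Ideal.span {equation F}))) :
    (∃ l, x ∈ Proj.basicOpen _ (baseForm d F l)) ∨
      ∃ (i : Fin 3) (hi : i ≠ 2) (l : Fin 3),
        x ∈ Proj.basicOpen _ (chartForm F (isWeightedHomogeneous_inr hi) l) := by
  obtain ⟨k, α, h, hk, hx⟩ := exists_monomialForm_notMem x
  have h' := h
  rw [Finsupp.weight_apply, Finsupp.sum_fintype _ _ (by simp), Fintype.sum_sum_type,
    Fin.sum_univ_three, Fin.sum_univ_three, Prod.ext_iff] at h'
  obtain ⟨h1, h2⟩ := h'
  simp [bidegree] at h1 h2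
  -- A monomial involving `s` or `t` has positive degree in `x, y, z` too, so is divisible by some
  -- `x_l s` or `x_l t`.
  by_cases hst : ∃ i : Fin 3, i ≠ 2 ∧ α (Sum.inr i) ≠ 0
  · obtain ⟨i, hi, hαi⟩ := hst
    obtain ⟨l, hl⟩ : ∃ l : Fin 3, α (Sum.inl l) ≠ 0 := by
      by_contra! H
      rw [H 0, H 1, H 2] at h1
      nlinarith
    right
    refine ⟨i, hi, l, ?_⟩
    have hγ : Finsupp.weight (bidegree d) (Finsupp.single (Sum.inl l) 1 +
        Finsupp.single (Sum.inr i) 1) = 1 • (d + 1, 1) := by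
      rw [map_add, Finsupp.weight_single, Finsupp.weight_single]
      fin_cases i <;> simp_all [bidegree, add_comm]
    have h3 := mem_basicOpen_of_le_nsmul h hx 1 one_pos hk (γ := Finsupp.single (Sum.inl l) 1 +
      Finsupp.single (Sum.inr i) 1) (fun j => by
        rw [one_smul, Finsupp.add_apply, Finsupp.single_apply, Finsupp.single_apply]
        split_ifs with h4 h5 h5
        · exact absurd (h4.trans h5.symm) (by simp)
        · subst h4; omega
        · subst h5; omega
        · omega) hγ
    convert h3 using 2
    apply Subtype.ext
    simp only [chartForm, monomialForm, coe_form, X, monomial_mul, mul_one]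
  -- A monomial in `x, y, z, u` only has degree `k` in `u` and `k (d + 1)` in `x, y, z`, so some
  -- `x_l` has exponent at least `(d + 1) / 3`, and the cube is divisible by `x_l ^ (d + 1) u`.
  · push Not at hst
    have hs := hst 0 (by decide)
    have ht := hst 1 (by decide)
    rw [hs, ht] at h1 h2
    obtain ⟨l, hl⟩ : ∃ l : Fin 3, d + 1 ≤ 3 * α (Sum.inl l) := by
      by_contra! H
      have := H 0
      have := H 1
      have := H 2
      nlinarith
    left
    refine ⟨l, ?_⟩
    have hγ : Finsupp.weight (bidegree d) (Finsupp.single (Sum.inl l) (d + 1) +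
        Finsupp.single (Sum.inr 2) 1) = 1 • (d + 1, 1) := by
      rw [map_add, Finsupp.weight_single, Finsupp.weight_single]
      simp [bidegree]
    have h3 := mem_basicOpen_of_le_nsmul h hx 3 (by decide) hk
      (γ := Finsupp.single (Sum.inl l) (d + 1) + Finsupp.single (Sum.inr 2) 1) (fun j => by
        rw [Finsupp.smul_apply, smul_eq_mul, Finsupp.add_apply, Finsupp.single_apply,
          Finsupp.single_apply]
        split_ifs with h4 h5 h5
        · exact absurd (h4.trans h5.symm) (by simp)
        · subst h4; omega
        · subst h5; omega
        · omega) hγ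
    convert h3 using 2
    apply Subtype.ext
    simp only [baseForm, monomialForm, coe_form, X_pow_eq_monomial]
    simp only [X, monomial_mul, mul_one]

theorem baseForm_mem (l : Fin 3) : baseForm d F l ∈
    weightedRingGrading (bidegree d) (d + 1, 1) (Ideal.span {equation F}) 1 := form_mem _ _ _

theorem chartForm_mem {g : CoxRing} (hg : IsWeightedHomogeneous (bidegree d) g (d, 1))
    (j : Fin 3) : chartForm F hg j ∈
      weightedRingGrading (bidegree d) (d + 1, 1) (Ideal.span {equation F}) 1 := form_mem _ _ _

/-- The real points all lie in the charts `x_l ^ (d + 1) u ≠ 0`, since `u = 0` would force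
`s² + t² = 0`. -/
theorem isIn_basicOpen_baseForm (hF : F.IsHomogeneous (2 * d))
    (p : RealLocus (projToSpecR (weightedRingGrading (bidegree d) (d + 1, 1)
      (Ideal.span {equation F})))) :
    ∃ l, p.IsIn (Proj.basicOpen _ (baseForm d F l)) := by
  simp only [isIn_iff_mem]
  rcases exists_mem_basicOpen_chartForm (p.1 (⊥ : PrimeSpectrum ℝ)) with h | ⟨i, hi, l, h⟩
  · exact h
  · refine ⟨l, ?_⟩
    rw [← isIn_iff_mem] at h ⊢
    obtain ⟨χ, hχ, h1, rfl⟩ :=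
      exists_eq_evalPoint p (chartForm_mem (isWeightedHomogeneous_inr hi) l) h
    rw [evalPoint_isIn_iff χ hχ (baseForm_mem l) one_pos]
    have h2 := chart_equation (isWeightedHomogeneous_inr hi) l hF χ
    intro h0
    have hu : χ (chartCoord F (isWeightedHomogeneous_inr hi) l (Sum.inr 2)) = 0 := h0
    rw [hu] at h2
    have h3 : χ (chartCoord F (isWeightedHomogeneous_inr hi) l (Sum.inr i)) = 1 := by
      fin_cases i
      · change χ (_ * _) = 1
        rw [map_mul, map_pow]
        erw [h1]
        simp
      · change χ (_ * _) = 1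
        rw [map_mul, map_pow]
        erw [h1]
        simp
      · exact absurd rfl hi
    fin_cases i
    · rw [show χ (chartCoord F _ l (Sum.inr 0)) = 1 from h3] at h2
      nlinarith
    · rw [show χ (chartCoord F _ l (Sum.inr 1)) = 1 from h3] at h2
      nlinarith
    · exact absurd rfl hi

end ConicBundleCover

section ConicBundlePoints

variable {d : ℕ} {F : MvPolynomial (Fin 3) ℝ}

theorem aeval_mul_of_isHomogeneous {σ : Type} {G : MvPolynomial σ ℝ} {n : ℕ}
    (hG : G.IsHomogeneous n) (t : ℝ) (v : σ → ℝ) :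
    aeval (fun i => t * v i) G = t ^ n * aeval v G := by
  have h := isWeightedHomogeneous_rename (w := fun _ : σ => ((1, 0) : ℕ × ℕ)) (e := id)
    (a := (1, 0)) (fun _ => rfl) hG
  rw [rename_id_apply] at h
  simpa using aeval_weighted t 1 v h

variable (F) in
/-- The point `(v, √F(v) c, 1)` of the affine cone over the conic bundle, for `c` in the circle and
`v` in the sphere. -/
def conicLift (n : UnitSphere 1 × UnitSphere 2) : Fin 3 ⊕ Fin 3 → ℝ :=
  Sum.elim (fun i => (n.2 : EuclideanSpace ℝ (Fin 3)) i)
    ![√(aeval (fun i => (n.2 : EuclideanSpace ℝ (Fin 3)) i) F) *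
        (n.1 : EuclideanSpace ℝ (Fin 2)) 0,
      √(aeval (fun i => (n.2 : EuclideanSpace ℝ (Fin 3)) i) F) *
        (n.1 : EuclideanSpace ℝ (Fin 2)) 1, 1]

theorem aeval_conicLift (hpos : ∀ v : Fin 3 → ℝ, v ≠ 0 → 0 < aeval v F)
    (n : UnitSphere 1 × UnitSphere 2) :
    ∀ P ∈ Ideal.span {equation F}, aeval (conicLift F n) P = 0 := by
  refine aeval_eq_zero_of_mem_span ?_
  rw [aeval_equation]
  have h := sphere_sum_sq n.1
  rw [Fin.sum_univ_two] at h
  have h1 := Real.sq_sqrt (hpos _ (sphere_coord_ne_zero n.2)).le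
  simp only [conicLift, Sum.elim_inl, Sum.elim_inr, Matrix.cons_val, mul_pow, h1]
  rw [← mul_add, h]
  ring

variable (d) in
/-- The evaluation of the homogeneous coordinate ring of the conic bundle at `(v, √F(v) c, 1)`. -/
def conicEval (hpos : ∀ v : Fin 3 → ℝ, v ≠ 0 → 0 < aeval v F)
    (n : UnitSphere 1 × UnitSphere 2) : ConicBundleRing d F →ₐ[ℝ] ℝ :=
  evalRing (bidegree d) (d + 1, 1) (conicLift F n) (aeval_conicLift hpos n)

theorem isWeightedHomogeneous_base (l : Fin 3) :
    IsWeightedHomogeneous (bidegree d) (X (Sum.inl l) ^ d * X (Sum.inr 2) : CoxRing) (d, 1) := by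
  have h := ((isWeightedHomogeneous_X ℝ (bidegree d) (Sum.inl l)).pow d).mul
    (isWeightedHomogeneous_X ℝ (bidegree d) (Sum.inr 2))
  convert h using 1
  simp [bidegree]

/-- The chart `x_l ^ (d + 1) u ≠ 0` is the chart of the form `g = x_l ^ d u` of bidegree `(d, 1)`.
-/
theorem chartForm_base (l : Fin 3) :
    chartForm F (isWeightedHomogeneous_base (d := d) l) l = baseForm d F l := by
  apply Subtype.ext
  simp only [chartForm, baseForm, coe_form]
  congr 2
  ring

theorem conicEval_chartForm (hpos : ∀ v : Fin 3 → ℝ, v ≠ 0 → 0 < aeval v F)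
    (n : UnitSphere 1 × UnitSphere 2) {g : CoxRing}
    (hg : IsWeightedHomogeneous (bidegree d) g (d, 1)) (j : Fin 3) :
    conicEval d hpos n (chartForm F hg j) =
      (n.2 : EuclideanSpace ℝ (Fin 3)) j * aeval (conicLift F n) g := by
  rw [conicEval, chartForm, evalRing_form, map_mul, aeval_X]
  rfl

theorem conicEval_nondegenerate (hpos : ∀ v : Fin 3 → ℝ, v ≠ 0 → 0 < aeval v F)
    (n : UnitSphere 1 × UnitSphere 2) :
    Nondegenerate (weightedRingGrading (bidegree d) (d + 1, 1) (Ideal.span {equation F}))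
      (conicEval d hpos n) := by
  obtain ⟨l, hl⟩ := Function.ne_iff.mp (sphere_coord_ne_zero n.2)
  refine ⟨chartForm F (isWeightedHomogeneous_base l) l, chartForm_mem _ _, ?_⟩
  rw [conicEval_chartForm, map_mul, map_pow, aeval_X, aeval_X]
  exact mul_ne_zero hl (mul_ne_zero (pow_ne_zero _ hl) one_ne_zero)

variable (d) in
/-- The real point of the conic bundle with coordinates `(x, y, z) = v` and `(s, t, u) =
(√F(v) c, 1)`. -/
def conicPoint (hpos : ∀ v : Fin 3 → ℝ, v ≠ 0 → 0 < aeval v F)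
    (n : UnitSphere 1 × UnitSphere 2) : RealLocus (projToSpecR
    (weightedRingGrading (bidegree d) (d + 1, 1) (Ideal.span {equation F}))) :=
  evalPoint (conicEval d hpos n) (conicEval_nondegenerate hpos n)

/-- If two points of the affine cone differ by an element `(t, r)` of the torus, then their
evaluations are proportional, with factor `t ^ w₀.1 * r ^ w₀.2`. -/
theorem proportional_evalRing {τ : Type} {w : τ → ℕ × ℕ} {w₀ : ℕ × ℕ}
    {J : Ideal (MvPolynomial τ ℝ)} (χ : WeightedRing w w₀ J →ₐ[ℝ] ℝ) (θ v : τ → ℝ)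
    (hv : ∀ P ∈ J, aeval v P = 0) (hχ : ∀ k G hG, χ (form J k G hG) = aeval θ G) {t r : ℝ}
    (ht : t ≠ 0) (hr : r ≠ 0) (h : ∀ j, v j = t ^ (w j).1 * r ^ (w j).2 * θ j) :
    Proportional (weightedRingGrading w w₀ J) χ (evalRing w w₀ v hv) := by
  refine ⟨t ^ w₀.1 * r ^ w₀.2, by positivity, fun k a ha => ?_⟩
  obtain ⟨G, hG, rfl⟩ := exists_eq_form ha
  rw [evalRing_form, hχ, funext h, aeval_weighted t r θ hG]
  simp only [Prod.smul_fst, Prod.smul_snd, smul_eq_mul]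
  ring

/-- The fibres of `S¹ × S² → X(ℝ)`: the point `-v` of the sphere defines the same point of `ℙ²` as
`v`, and `s, t` are forms of degree `d` with respect to `v`, so `(c, v)` and `((-1) ^ d c, -v)`
define the same point. -/
theorem conicPoint_eq_iff (hpos : ∀ v : Fin 3 → ℝ, v ≠ 0 → 0 < aeval v F)
    (hF : F.IsHomogeneous (2 * d)) (n n' : UnitSphere 1 × UnitSphere 2) :
    conicPoint d hpos n = conicPoint d hpos n' ↔
      ∃ ε : ℤˣ, n'.1 = ε ^ d • n.1 ∧ n'.2 = ε • n.2 := by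
  have hFε (ε : ℤˣ) (v : UnitSphere 2) :
      aeval (fun i => ((ε • v : UnitSphere 2) : EuclideanSpace ℝ (Fin 3)) i) F =
        aeval (fun i => (v : EuclideanSpace ℝ (Fin 3)) i) F := by
    simp only [units_smul_sphere_apply]
    rw [aeval_mul_of_isHomogeneous hF, pow_mul]
    rcases Int.units_eq_one_or ε with rfl | rfl <;> simp
  constructor
  · intro H
    obtain ⟨e, he, H⟩ := proportional_of_evalPoint_eq _ _ H
    obtain ⟨l, hl⟩ := Function.ne_iff.mp (sphere_coord_ne_zero n.2)
    have h1 (j : Fin 3) := H 1 _ (chartForm_mem (isWeightedHomogeneous_base l) j)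
    have h2 (i : Fin 3) (hi : i ≠ 2) := H 1 _ (chartForm_mem (isWeightedHomogeneous_inr hi) l)
    simp only [conicEval_chartForm, map_mul, map_pow, aeval_X, pow_one] at h1 h2
    have hu (m : UnitSphere 1 × UnitSphere 2) : conicLift F m (Sum.inr 2) = 1 := rfl
    have hx (m : UnitSphere 1 × UnitSphere 2) (i : Fin 3) :
      conicLift F m (Sum.inl i) = (m.2 : EuclideanSpace ℝ (Fin 3)) i := rfl
    simp only [hu, hx, mul_one] at h1
    have hl' : (n.2 : EuclideanSpace ℝ (Fin 3)) l ≠ 0 := hl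
    have hl'' : (n'.2 : EuclideanSpace ℝ (Fin 3)) l ^ d ≠ 0 := by
      intro h0
      have h3 := h1 l
      rw [h0, mul_zero] at h3
      exact (mul_ne_zero he (mul_ne_zero hl' (pow_ne_zero d hl'))) h3.symm
    obtain ⟨ε, hε, h3⟩ := exists_units_smul_eq (x := n.2) (y := n'.2)
      (t := e * (n.2 : EuclideanSpace ℝ (Fin 3)) l ^ d /
        (n'.2 : EuclideanSpace ℝ (Fin 3)) l ^ d) fun j => by
        rw [div_mul_eq_mul_div, eq_div_iff hl'', h1 j]
        ring
    have he' : e = ((ε : ℤ) : ℝ) * ((ε : ℤ) : ℝ) ^ d := by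
      rw [div_eq_iff hl'', h3, units_smul_sphere_apply, mul_pow, ← mul_assoc] at hε
      exact mul_right_cancel₀ (pow_ne_zero d hl') hε
    refine ⟨ε, Subtype.ext <| PiLp.ext fun i => ?_, h3⟩
    have h4 (a a' r : ℝ) (hr : r ≠ 0) (h : ((ε : ℤ) : ℝ) * (n.2 : EuclideanSpace ℝ (Fin 3)) l *
        (r * a') = e * ((n.2 : EuclideanSpace ℝ (Fin 3)) l * (r * a))) :
        a' = ((ε : ℤ) : ℝ) ^ d * a := by
      have h5 : ((ε : ℤ) : ℝ) ≠ 0 := by simp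
      rw [he'] at h
      refine mul_left_cancel₀ (mul_ne_zero (mul_ne_zero h5 hl') hr) ?_
      linear_combination h
    have hr : √(aeval (fun i => (n.2 : EuclideanSpace ℝ (Fin 3)) i) F) ≠ 0 :=
      (Real.sqrt_pos.mpr (hpos _ (sphere_coord_ne_zero n.2))).ne'
    rw [units_smul_sphere_apply]
    rw [h3] at h2
    fin_cases i
    · have h5 := h2 0 (by decide)
      simp only [conicLift, Sum.elim_inr, Matrix.cons_val, h3, hFε] at h5
      simp only [units_smul_sphere_apply] at h5
      simpa using h4 _ _ _ hr h5
    · have h5 := h2 1 (by decide)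
      simp only [conicLift, Sum.elim_inr, Matrix.cons_val, h3, hFε] at h5
      simp only [units_smul_sphere_apply] at h5
      simpa using h4 _ _ _ hr h5
  · rintro ⟨ε, h1, h2⟩
    have hP : Proportional (weightedRingGrading _ _ _) (conicEval d hpos n)
        (conicEval d hpos n') := by
      refine proportional_evalRing _ (conicLift F n) _ _
        (fun k G hG => evalRing_form _ _ k G hG) (t := ((ε : ℤ) : ℝ)) (r := 1) ?_ one_ne_zero ?_
      · simp
      · rintro (j | j)
        · simp [conicLift, bidegree, h2, units_smul_sphere_apply]
        · fin_cases j <;> simp only [conicLift, bidegree, h1, h2, hFε]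
          · simp [units_smul_sphere_apply]
            ring
          · simp [units_smul_sphere_apply]
            ring
          · simp
    exact hP.evalPoint_eq _ _

theorem contDiff_toLp_comp {τ ι : Type*} [Fintype τ] [Fintype ι] (e : ι → τ) :
    ContDiff ℝ ∞ fun θ : τ → ℝ => (WithLp.toLp 2 fun i => θ (e i) : EuclideanSpace ℝ ι) :=
  (PiLp.contDiff_toLp (p := 2)).comp (contDiff_pi.mpr fun i => contDiff_apply ℝ ℝ (e i))

theorem contDiff_toLp_pair {τ : Type*} [Fintype τ] (i j : τ) :
    ContDiff ℝ ∞ fun θ : τ → ℝ => (WithLp.toLp 2 ![θ i, θ j] : EuclideanSpace ℝ (Fin 2)) := by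
  convert contDiff_toLp_comp ![i, j] using 3 with θ
  funext k
  fin_cases k <;> rfl

/-- A point `θ = (x, s, t, 1)` of the affine cone differs from a point `(v, √F(v) c, 1)` by the
torus element `(‖x‖⁻¹, 1)`: take `v = x / ‖x‖`, and for `c` the normalization of `(s, t)`. The
reason is that `√F(v) = ‖x‖ ^ (-d) √F(x)`, where `F(x) = s² + t²`. -/
theorem conicLift_normalizeSphere (hF : F.IsHomogeneous (2 * d)) (θ : Fin 3 ⊕ Fin 3 → ℝ)
    (hu : θ (Sum.inr 2) = 1)
    (h : θ (Sum.inr 0) ^ 2 + θ (Sum.inr 1) ^ 2 = aeval (fun i => θ (Sum.inl i)) F)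
    (hx' : WithLp.toLp 2 (fun i => θ (Sum.inl i)) ≠ 0)
    (hs' : WithLp.toLp 2 ![θ (Sum.inr 0), θ (Sum.inr 1)] ≠ 0) (j) :
    conicLift F (normalizeSphere 1 (WithLp.toLp 2 ![θ (Sum.inr 0), θ (Sum.inr 1)]),
      normalizeSphere 2 (WithLp.toLp 2 fun i => θ (Sum.inl i))) j =
    ‖(WithLp.toLp 2 (fun i => θ (Sum.inl i)) : EuclideanSpace ℝ (Fin 3))‖⁻¹ ^ (bidegree d j).1 *
      1 ^ (bidegree d j).2 * θ j := by
  set x : EuclideanSpace ℝ (Fin 3) := WithLp.toLp 2 (fun i => θ (Sum.inl i)) with hxd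
  set s : EuclideanSpace ℝ (Fin 2) := WithLp.toLp 2 ![θ (Sum.inr 0), θ (Sum.inr 1)] with hsd
  have hv (i) : (normalizeSphere 2 x : EuclideanSpace ℝ (Fin 3)) i = ‖x‖⁻¹ * θ (Sum.inl i) := by
    rw [coe_normalizeSphere hx']
    rfl
  have hn : ‖s‖ ^ 2 = θ (Sum.inr 0) ^ 2 + θ (Sum.inr 1) ^ 2 := by
    rw [EuclideanSpace.norm_sq_eq, Fin.sum_univ_two, Real.norm_eq_abs, Real.norm_eq_abs, sq_abs,
      sq_abs]
    rfl
  have hr : √(aeval (fun i => (normalizeSphere 2 x : EuclideanSpace ℝ (Fin 3)) i) F) =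
      ‖x‖⁻¹ ^ d * ‖s‖ := by
    simp only [hv]
    rw [aeval_mul_of_isHomogeneous hF, ← h, ← hn,
      show ‖x‖⁻¹ ^ (2 * d) * ‖s‖ ^ 2 = (‖x‖⁻¹ ^ d * ‖s‖) ^ 2 by ring,
      Real.sqrt_sq (by positivity)]
  have hs : ‖s‖ ≠ 0 := norm_ne_zero_iff.mpr hs'
  have hc (i) : (normalizeSphere 1 s : EuclideanSpace ℝ (Fin 2)) i =
      ‖s‖⁻¹ * ![θ (Sum.inr 0), θ (Sum.inr 1)] i := by
    rw [coe_normalizeSphere hs']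
    rfl
  rcases j with j | j
  · simp [conicLift, bidegree, hv]
  · fin_cases j
    · simp only [conicLift, bidegree, hr, hc]
      simp
      field_simp
    · simp only [conicLift, bidegree, hr, hc]
      simp
      field_simp
    · simp [conicLift, bidegree, hu]

/-- The real locus of the conic bundle is a smooth quotient of `S¹ × S²`. -/
theorem isSmoothQuotient_conicPoint (hpos : ∀ v : Fin 3 → ℝ, v ≠ 0 → 0 < aeval v F)
    (hF : F.IsHomogeneous (2 * d)) :
    IsSmoothQuotient ((𝓡 1).prod (𝓡 2)) (RealLocus.SmoothOn (projToSpecR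
    (weightedRingGrading (bidegree d) (d + 1, 1) (Ideal.span {equation F}))))
      (conicPoint d hpos) := by
  refine isSmoothQuotient_evalPoint (conicEval d hpos) (conicEval_nondegenerate hpos) ?_
    (fun l => baseForm d F l) baseForm_mem (isIn_basicOpen_baseForm hF)
    (fun l => chartCoord F (isWeightedHomogeneous_base l) l)
    ({θ | WithLp.toLp 2 (fun i => θ (Sum.inl i)) ≠ 0} ∩
      {θ | WithLp.toLp 2 ![θ (Sum.inr 0), θ (Sum.inr 1)] ≠ 0}) ?_
    (fun θ => (normalizeSphere 1 (WithLp.toLp 2 ![θ (Sum.inr 0), θ (Sum.inr 1)]),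
      normalizeSphere 2 (WithLp.toLp 2 fun i => θ (Sum.inl i)))) ?_ ?_
  · refine contMDiff_evalRing _ _ fun j => ?_
    rcases j with j | j
    · exact (contMDiff_sphere_coord 2 j).comp contMDiff_snd
    · have h1 : ContMDiff ((𝓡 1).prod (𝓡 2)) 𝓘(ℝ, ℝ) ∞ fun n : UnitSphere 1 × UnitSphere 2 =>
          aeval (fun i => (n.2 : EuclideanSpace ℝ (Fin 3)) i) F :=
        contMDiff_aeval _ (fun j => (contMDiff_sphere_coord 2 j).comp contMDiff_snd) F
      have h2 : ContMDiff ((𝓡 1).prod (𝓡 2)) 𝓘(ℝ, ℝ) ∞ fun n : UnitSphere 1 × UnitSphere 2 =>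
          √(aeval (fun i => (n.2 : EuclideanSpace ℝ (Fin 3)) i) F) := fun n =>
        (Real.contDiffAt_sqrt (hpos _ (sphere_coord_ne_zero n.2)).ne').contMDiffAt.comp n (h1 n)
      have h3 (i : Fin 2) := h2.mul ((contMDiff_sphere_coord 1 i).comp
        (contMDiff_fst (I := 𝓡 1) (J := 𝓡 2) (M := UnitSphere 1) (N := UnitSphere 2)))
      fin_cases j
      · exact h3 0
      · exact h3 1
      · exact contMDiff_const
  · refine IsOpen.inter ?_ ?_
    · exact isOpen_ne.preimage (contDiff_toLp_comp _).continuous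
    · refine isOpen_ne.preimage (contDiff_toLp_pair _ _).continuous
  · refine ContMDiffOn.prodMk ?_ ?_
    · refine (contMDiffOn_normalizeSphere 1).comp (ContMDiff.contMDiffOn ?_) fun θ hθ => hθ.2
      exact (contDiff_toLp_pair _ _).contMDiff
    · refine (contMDiffOn_normalizeSphere 2).comp (ContMDiff.contMDiffOn ?_) fun θ hθ => hθ.1
      exact (contDiff_toLp_comp _).contMDiff
  · intro l χ hχ
    rw [← chartForm_base] at hχ
    have h0 := map_form_chart (isWeightedHomogeneous_base l) l χ hχ
    have h1 := chart_equation (isWeightedHomogeneous_base l) l hF χ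
    have hu : χ (chartCoord F (isWeightedHomogeneous_base l) l (Sum.inr 2)) = 1 := by
      rw [← hχ, chartForm_base]
      rfl
    have hl : χ (chartCoord F (isWeightedHomogeneous_base l) l (Sum.inl l)) = 1 := hχ
    rw [hu, one_pow, one_mul] at h1
    have hx : (fun i => χ (chartCoord F (isWeightedHomogeneous_base l) l (Sum.inl i))) ≠ 0 :=
      fun h => one_ne_zero (hl.symm.trans (congrFun h l))
    have hx' : WithLp.toLp 2
        (fun i => χ (chartCoord F (isWeightedHomogeneous_base l) l (Sum.inl i))) ≠ 0 :=
      fun h => hx (congrArg WithLp.ofLp h)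
    have hs' : WithLp.toLp 2 ![χ (chartCoord F (isWeightedHomogeneous_base l) l (Sum.inr 0)),
        χ (chartCoord F (isWeightedHomogeneous_base l) l (Sum.inr 1))] ≠ 0 := by
      intro h
      have h2 := congrFun (congrArg WithLp.ofLp h) 0
      have h3 := congrFun (congrArg WithLp.ofLp h) 1
      simp only [Matrix.cons_val, WithLp.ofLp_zero, Pi.zero_apply] at h2 h3
      have h4 := hpos _ hx
      rw [← h1, h2, h3] at h4
      simp at h4
    exact ⟨⟨hx', hs'⟩, proportional_evalRing χ _ _ _ h0 (inv_ne_zero (norm_ne_zero_iff.mpr hx'))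
      one_ne_zero (conicLift_normalizeSphere hF
        (fun j => χ (chartCoord F (isWeightedHomogeneous_base l) l j)) hu h1 hx' hs')⟩

end ConicBundlePoints

/-! ### Charts of the product of a projective space and a quadric -/

open HomogeneousLocalization

section QuadricChart

variable (p q : ℕ)

/-- The variables `y_i` for `i < p`, `s_0, s_1`, and `x_k` for `k < q`. -/
abbrev QuadricVar : Type := Fin p ⊕ (Fin 2 ⊕ Fin q)

/-- The variables `y_i` have bidegree `(1, 0)`, the variables `s_j` and `x_k` bidegree `(0, 1)`. -/
def quadricWeight : QuadricVar p q → ℕ × ℕ := Sum.elim (fun _ => (1, 0)) fun _ => (0, 1)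

/-- The equation `s_0² + s_1² - ∑ x_k²` of a quadric in `ℙ^(q + 1)`. -/
def quadricEquation : MvPolynomial (QuadricVar p q) ℝ :=
  ∑ j, X (Sum.inr (Sum.inl j)) ^ 2 - ∑ k, X (Sum.inr (Sum.inr k)) ^ 2

/-- The homogeneous coordinate ring, for the line bundle `𝒪(1, 1)`, of the product of `ℙ^(p - 1)`
with the quadric `s_0² + s_1² = ∑ x_k²`. -/
abbrev QuadricRing : Type :=
  WeightedRing (quadricWeight p q) (1, 1) (Ideal.span {quadricEquation p q})

/-- The grading of `QuadricRing p q`. -/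
abbrev quadricGrading : ℕ → Submodule ℝ (QuadricRing p q) :=
  weightedRingGrading (quadricWeight p q) (1, 1) (Ideal.span {quadricEquation p q})

variable {p q}

theorem quadricEquation_isWeightedHomogeneous :
    IsWeightedHomogeneous (quadricWeight p q) (quadricEquation p q) (0, 2) := by
  have h (z : Fin 2 ⊕ Fin q) : IsWeightedHomogeneous (quadricWeight p q)
      (X (Sum.inr z) ^ 2 : MvPolynomial (QuadricVar p q) ℝ) (0, 2) :=
    (isWeightedHomogeneous_X ℝ (quadricWeight p q) (Sum.inr z)).pow 2
  exact Submodule.sub_mem (weightedHomogeneousSubmodule ℝ (quadricWeight p q) (0, 2))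
    (Submodule.sum_mem _ fun j _ => h _) (Submodule.sum_mem _ fun k _ => h _)

theorem aeval_quadricEquation {K : Type*} [CommRing K] [Algebra ℝ K] (v : QuadricVar p q → K) :
    aeval v (quadricEquation p q) =
      ∑ j, v (Sum.inr (Sum.inl j)) ^ 2 - ∑ k, v (Sum.inr (Sum.inr k)) ^ 2 := by
  simp [quadricEquation]

theorem isWeightedHomogeneous_quadric_inl (i : Fin p) : IsWeightedHomogeneous (quadricWeight p q)
    (X (Sum.inl i) : MvPolynomial (QuadricVar p q) ℝ) (1, 0) :=
  isWeightedHomogeneous_X ℝ (quadricWeight p q) (Sum.inl i)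

theorem isWeightedHomogeneous_quadric_inr (z : Fin 2 ⊕ Fin q) :
    IsWeightedHomogeneous (quadricWeight p q)
    (X (Sum.inr z) : MvPolynomial (QuadricVar p q) ℝ) (0, 1) :=
  isWeightedHomogeneous_X ℝ (quadricWeight p q) (Sum.inr z)

variable (p q) in
/-- An index of the charts `y_i (s_j + ε x_k) ≠ 0`. Since `s_j + ε x_k = 0` is a hyperplane tangent
to the quadric, the chart is an affine space. -/
structure QuadricChart where
  i : Fin p
  j : Fin 2
  k : Fin q
  ε : ℤˣ

namespace QuadricChart

variable (c : QuadricChart p q)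

/-- The sign `ε` as a real number. -/
def sign : ℝ := ((c.ε : ℤ) : ℝ)

theorem sign_mul_self : c.sign * c.sign = 1 := by
  rcases Int.units_eq_one_or c.ε with h | h <;> simp [sign, h]

/-- The linear form `s_j + ε x_k`. -/
def linear : MvPolynomial (QuadricVar p q) ℝ :=
  X (Sum.inr (Sum.inl c.j)) + C c.sign * X (Sum.inr (Sum.inr c.k))

theorem isWeightedHomogeneous_linear :
    IsWeightedHomogeneous (quadricWeight p q) c.linear (0, 1) := by
  refine Submodule.add_mem (weightedHomogeneousSubmodule ℝ (quadricWeight p q) (0, 1))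
    (isWeightedHomogeneous_quadric_inr _) ?_
  rw [← smul_eq_C_mul]
  exact Submodule.smul_mem _ _ (isWeightedHomogeneous_quadric_inr _)

theorem isWeightedHomogeneous_inl_mul_linear (i : Fin p) : IsWeightedHomogeneous
    (quadricWeight p q) (X (Sum.inl i) * c.linear) (1 • (1, 1)) :=
  (isWeightedHomogeneous_quadric_inl i).mul c.isWeightedHomogeneous_linear

theorem isWeightedHomogeneous_mul_inr (z : Fin 2 ⊕ Fin q) : IsWeightedHomogeneous
    (quadricWeight p q) (X (Sum.inl c.i) * X (Sum.inr z) : MvPolynomial (QuadricVar p q) ℝ)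
      (1 • (1, 1)) :=
  (isWeightedHomogeneous_quadric_inl c.i).mul (isWeightedHomogeneous_quadric_inr z)

/-- The sections `y_a (s_j + ε x_k)` and `y_i z` of `𝒪(1, 1)`, where `z` runs through the variables
`s` and `x`: the coordinates on the chart `y_i (s_j + ε x_k) ≠ 0`. -/
def coord : QuadricVar p q → QuadricRing p q :=
  Sum.elim
    (fun i => form _ 1 (X (Sum.inl i) * c.linear) (c.isWeightedHomogeneous_inl_mul_linear i))
    (fun z => form _ 1 (X (Sum.inl c.i) * X (Sum.inr z)) (c.isWeightedHomogeneous_mul_inr z))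

/-- The section `y_i (s_j + ε x_k)` of `𝒪(1, 1)` which defines the chart. -/
def denom : QuadricRing p q := c.coord (Sum.inl c.i)

theorem coord_mem (a : QuadricVar p q) : c.coord a ∈ quadricGrading p q 1 := by
  rcases a with a | a
  · exact form_mem 1 _ (c.isWeightedHomogeneous_inl_mul_linear a)
  · exact form_mem 1 _ (c.isWeightedHomogeneous_mul_inr a)

theorem denom_mem : c.denom ∈ quadricGrading p q 1 := c.coord_mem _

theorem coe_coord (a : QuadricVar p q) :
    (c.coord a : Polynomial (MvPolynomial (QuadricVar p q) ℝ ⧸ Ideal.span {quadricEquation p q})) =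
      Polynomial.monomial 1 (Ideal.Quotient.mk _ c.linear) ^ (quadricWeight p q a).1 *
      Polynomial.monomial 1 (Ideal.Quotient.mk _ (X (Sum.inl c.i))) ^ (quadricWeight p q a).2 *
        Polynomial.C (Ideal.Quotient.mk _ (X a)) := by
  rcases a with a | a
  · refine (coe_form (J := Ideal.span {quadricEquation p q}) 1 _
      (c.isWeightedHomogeneous_inl_mul_linear a)).trans ?_
    simp [quadricWeight, ← Polynomial.C_mul_X_eq_monomial]
    ring
  · refine (coe_form (J := Ideal.span {quadricEquation p q}) 1 _
      (c.isWeightedHomogeneous_mul_inr a)).trans ?_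
    simp [quadricWeight, ← Polynomial.C_mul_X_eq_monomial]
    ring

theorem coord_weight :
    Polynomial.monomial 1 (Ideal.Quotient.mk (Ideal.span {quadricEquation p q}) c.linear) ^
        ((1, 1) : ℕ × ℕ).1 *
      Polynomial.monomial 1 (Ideal.Quotient.mk _ (X (Sum.inl c.i))) ^ ((1, 1) : ℕ × ℕ).2 =
    (c.denom : Polynomial (MvPolynomial (QuadricVar p q) ℝ ⧸ Ideal.span {quadricEquation p q})) ^ 1
      * Polynomial.X := by
  have h := c.coe_coord (Sum.inl c.i)
  rw [denom, pow_one, h]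
  simp [quadricWeight, ← Polynomial.C_mul_X_eq_monomial]
  ring

theorem map_form_coord {K : Type} [CommRing K] [Algebra ℝ K] (χ : QuadricRing p q →ₐ[ℝ] K)
    (hχ : χ c.denom = 1) (k : ℕ) (G : MvPolynomial (QuadricVar p q) ℝ)
    (hG : IsWeightedHomogeneous (quadricWeight p q) G (k • (1, 1))) :
    χ (form _ k G hG) = aeval (fun a => χ (c.coord a)) G :=
  map_form _ _ _ _ _ c.coe_coord c.coord_weight χ hχ k G hG

theorem sum_sq_coord {K : Type} [CommRing K] [Algebra ℝ K] (χ : QuadricRing p q →ₐ[ℝ] K) :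
    ∑ j, χ (c.coord (Sum.inr (Sum.inl j))) ^ 2 = ∑ k, χ (c.coord (Sum.inr (Sum.inr k))) ^ 2 := by
  have h := aeval_eq_zero_of_mem c.coord _ _ c.coe_coord (quadricEquation p q)
    quadricEquation_isWeightedHomogeneous (Ideal.subset_span rfl)
  have h1 := (MvPolynomial.comp_aeval_apply c.coord χ (quadricEquation p q)).symm
  rw [h, map_zero, aeval_quadricEquation] at h1
  exact sub_eq_zero.mp h1

theorem map_denom_eq {K : Type} [CommRing K] [Algebra ℝ K] (χ : QuadricRing p q →ₐ[ℝ] K) :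
    χ c.denom = χ (c.coord (Sum.inr (Sum.inl c.j))) +
      algebraMap ℝ K c.sign * χ (c.coord (Sum.inr (Sum.inr c.k))) := by
  have h : c.denom = c.coord (Sum.inr (Sum.inl c.j)) +
      c.sign • c.coord (Sum.inr (Sum.inr c.k)) := by
    apply Subtype.ext
    change Polynomial.monomial 1 (Ideal.Quotient.mk _ (X (Sum.inl c.i) * c.linear)) =
      Polynomial.monomial 1 (Ideal.Quotient.mk _ (X (Sum.inl c.i) * X (Sum.inr (Sum.inl c.j)))) +
        c.sign • Polynomial.monomial 1
          (Ideal.Quotient.mk _ (X (Sum.inl c.i) * X (Sum.inr (Sum.inr c.k))))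
    rw [Polynomial.smul_monomial, ← map_add, ← Ideal.Quotient.mkₐ_eq_mk ℝ, ← map_smul, ← map_add,
      smul_eq_C_mul, linear]
    congr 2
    ring
  rw [h, map_add, map_smul, Algebra.smul_def]

/-- The variables other than `y_i`, `s_j`, `x_k`; they are the coordinates of the chart as an affine
space. -/
abbrev FreeVar : Type :=
  {a : QuadricVar p q // a ≠ Sum.inl c.i ∧ a ≠ Sum.inr (Sum.inl c.j) ∧ a ≠ Sum.inr (Sum.inr c.k)}

/-- The remaining variable `s`. -/
def freeS (j : {j : Fin 2 // j ≠ c.j}) : c.FreeVar :=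
  ⟨Sum.inr (Sum.inl j), by simpa using j.2⟩

/-- The remaining variables `x`. -/
def freeX (k : {k : Fin q // k ≠ c.k}) : c.FreeVar :=
  ⟨Sum.inr (Sum.inr k), by simpa using k.2⟩

/-- The difference `s_j² - x_k²`, expressed by the remaining variables through the equation of the
quadric. -/
def diffSq {K : Type*} [CommRing K] (v : c.FreeVar → K) : K :=
  ∑ k, v (c.freeX k) ^ 2 - ∑ j, v (c.freeS j) ^ 2

/-- The point of the affine cone with given remaining coordinates and with `y_i = s_j + ε x_k = 1`.
Then `s_j - ε x_k = s_j² - x_k²` is the polynomial `diffSq` in the remaining coordinates, and `s_j`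
and `x_k` are found by solving these two linear equations. -/
def extend {K : Type*} [CommRing K] [Algebra ℝ K] (v : c.FreeVar → K) : QuadricVar p q → K :=
  fun a => if h : a ≠ Sum.inl c.i ∧ a ≠ Sum.inr (Sum.inl c.j) ∧ a ≠ Sum.inr (Sum.inr c.k) then
    v ⟨a, h⟩ else Sum.elim (fun _ => 1) (Sum.elim
      (fun _ => algebraMap ℝ K 2⁻¹ * (1 + c.diffSq v))
      (fun _ => algebraMap ℝ K (c.sign * 2⁻¹) * (1 - c.diffSq v))) a

theorem sum_sq_eq_add {K : Type*} [CommRing K] {n : ℕ} (f : Fin n → K) (a : Fin n) :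
    ∑ i, f i ^ 2 = f a ^ 2 + ∑ i : {i // i ≠ a}, f i ^ 2 := by
  rw [← Finset.add_sum_erase _ _ (Finset.mem_univ a)]
  congr 1
  exact Finset.sum_subtype _ (by simp) _

section

variable {K : Type*} [CommRing K] [Algebra ℝ K] (v : c.FreeVar → K)

theorem extend_free (a : c.FreeVar) : c.extend v a = v a := dif_pos a.2

theorem extend_i : c.extend v (Sum.inl c.i) = 1 := dif_neg (by simp)

theorem extend_j : c.extend v (Sum.inr (Sum.inl c.j)) =
    algebraMap ℝ K 2⁻¹ * (1 + c.diffSq v) := dif_neg (by simp)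

theorem extend_k : c.extend v (Sum.inr (Sum.inr c.k)) =
    algebraMap ℝ K (c.sign * 2⁻¹) * (1 - c.diffSq v) := dif_neg (by simp)

theorem algebraMap_half : algebraMap ℝ K 2⁻¹ * 2 = 1 := by
  rw [← map_ofNat (algebraMap ℝ K) 2, ← map_mul]
  norm_num

theorem algebraMap_sign : algebraMap ℝ K c.sign * algebraMap ℝ K c.sign = 1 := by
  rw [← map_mul, sign_mul_self, map_one]

/-- The parametrization lands in the affine cone over the quadric. -/
theorem aeval_extend : ∀ P ∈ Ideal.span {quadricEquation p q}, aeval (c.extend v) P = 0 := by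
  refine aeval_eq_zero_of_mem_span ?_
  rw [aeval_quadricEquation, sum_sq_eq_add _ c.j, sum_sq_eq_add _ c.k, extend_j, extend_k]
  have h1 : ∑ j : {j : Fin 2 // j ≠ c.j}, c.extend v (Sum.inr (Sum.inl j)) ^ 2 =
      ∑ j, v (c.freeS j) ^ 2 :=
    Finset.sum_congr rfl fun j _ => congrArg (· ^ 2) (c.extend_free v (c.freeS j))
  have h2 : ∑ k : {k : Fin q // k ≠ c.k}, c.extend v (Sum.inr (Sum.inr k)) ^ 2 =
      ∑ k, v (c.freeX k) ^ 2 :=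
    Finset.sum_congr rfl fun k _ => congrArg (· ^ 2) (c.extend_free v (c.freeX k))
  rw [h1, h2]
  have h3 : c.diffSq v = ∑ k, v (c.freeX k) ^ 2 - ∑ j, v (c.freeS j) ^ 2 := rfl
  have h4 := algebraMap_half (K := K)
  have h5 := c.algebraMap_sign (K := K)
  rw [map_mul]
  generalize algebraMap ℝ K 2⁻¹ = t at *
  generalize algebraMap ℝ K c.sign = e at *
  generalize c.diffSq v = E at *
  rw [← sub_eq_zero] at h3
  linear_combination (-t ^ 2 * (1 - E) ^ 2) * h5 + E * (2 * t + 1) * h4 + h3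

theorem aeval_extend_linear : aeval (c.extend v) c.linear = 1 := by
  rw [linear, map_add, map_mul, aeval_X, aeval_X, aeval_C, extend_j, extend_k, map_mul]
  linear_combination algebraMap ℝ K 2⁻¹ * (1 - c.diffSq v) * c.algebraMap_sign (K := K) +
    algebraMap_half (K := K)

end

theorem map_extend {K L : Type*} [CommRing K] [Algebra ℝ K] [CommRing L] [Algebra ℝ L]
    (φ : K →ₐ[ℝ] L) (v : c.FreeVar → K) (a : QuadricVar p q) :
    φ (c.extend v a) = c.extend (fun b => φ (v b)) a := by
  have h : φ (c.diffSq v) = c.diffSq fun b => φ (v b) := by simp [diffSq]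
  by_cases ha : a ≠ Sum.inl c.i ∧ a ≠ Sum.inr (Sum.inl c.j) ∧ a ≠ Sum.inr (Sum.inr c.k)
  · rw [c.extend_free v ⟨a, ha⟩, c.extend_free _ ⟨a, ha⟩]
  · have ha' : a = Sum.inl c.i ∨ a = Sum.inr (Sum.inl c.j) ∨ a = Sum.inr (Sum.inr c.k) := by
      tauto
    rcases ha' with rfl | rfl | rfl
    · simp only [extend_i, map_one]
    · simp only [extend_j, map_mul, map_add, map_one, h, AlgHom.commutes]
    · simp only [extend_k, map_mul, map_sub, map_one, h, AlgHom.commutes]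

/-- Every point of the chart is given by the parametrization. -/
theorem coord_eq_extend {K : Type} [CommRing K] [Algebra ℝ K] (χ : QuadricRing p q →ₐ[ℝ] K)
    (hχ : χ c.denom = 1) (a : QuadricVar p q) :
    χ (c.coord a) = c.extend (fun b : c.FreeVar => χ (c.coord b)) a := by
  have h1 := c.sum_sq_coord χ
  have h2 := c.map_denom_eq χ
  rw [sum_sq_eq_add _ c.j, sum_sq_eq_add _ c.k] at h1
  have h3 : c.diffSq (fun b : c.FreeVar => χ (c.coord b)) =
    ∑ k : {k : Fin q // k ≠ c.k}, χ (c.coord (Sum.inr (Sum.inr k))) ^ 2 -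
    ∑ j : {j : Fin 2 // j ≠ c.j}, χ (c.coord (Sum.inr (Sum.inl j))) ^ 2 := rfl
  have h4 := algebraMap_half (K := K)
  have h5 := c.algebraMap_sign (K := K)
  rw [hχ] at h2
  by_cases ha : a ≠ Sum.inl c.i ∧ a ≠ Sum.inr (Sum.inl c.j) ∧ a ≠ Sum.inr (Sum.inr c.k)
  · exact (c.extend_free (fun b : c.FreeVar => χ (c.coord b)) ⟨a, ha⟩).symm
  · have ha' : a = Sum.inl c.i ∨ a = Sum.inr (Sum.inl c.j) ∨ a = Sum.inr (Sum.inr c.k) := by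
      tauto
    rcases ha' with rfl | rfl | rfl
    · rw [extend_i]
      exact hχ
    · rw [extend_j, h3]
      generalize algebraMap ℝ K c.sign = e at *
      generalize algebraMap ℝ K 2⁻¹ = t at *
      generalize χ (c.coord (Sum.inr (Sum.inl c.j))) = S at *
      generalize χ (c.coord (Sum.inr (Sum.inr c.k))) = x at *
      linear_combination -S * h4 + t * h1 + t * (S - e * x - 1) * h2 - t * x ^ 2 * h5
    · rw [extend_k, h3]
      rw [map_mul]
      generalize algebraMap ℝ K 2⁻¹ = t at *
      generalize algebraMap ℝ K c.sign = e at *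
      generalize χ (c.coord (Sum.inr (Sum.inl c.j))) = S at *
      generalize χ (c.coord (Sum.inr (Sum.inr c.k))) = x at *
      linear_combination -e * t * h1 - e * t * (1 + S - e * x) * h2 + e * t * x ^ 2 * h5 -
        x * h4 - 2 * t * x * h5

/-- Pullback along the parametrization of the chart by its remaining coordinates. -/
def toPolynomial : QuadricRing p q →ₐ[ℝ] MvPolynomial c.FreeVar ℝ :=
  evalRing (quadricWeight p q) (1, 1) (c.extend X) (c.aeval_extend X)

theorem toPolynomial_inl (i : Fin p) :
    c.toPolynomial (c.coord (Sum.inl i)) = c.extend X (Sum.inl i) := by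
  refine (evalRing_form _ _ _ _ (c.isWeightedHomogeneous_inl_mul_linear i)).trans ?_
  rw [map_mul, aeval_extend_linear, aeval_X, mul_one]

theorem toPolynomial_inr (z : Fin 2 ⊕ Fin q) :
    c.toPolynomial (c.coord (Sum.inr z)) = c.extend X (Sum.inr z) := by
  refine (evalRing_form _ _ _ _ (c.isWeightedHomogeneous_mul_inr z)).trans ?_
  rw [map_mul, aeval_X, aeval_X, extend_i, one_mul]

theorem toPolynomial_denom : c.toPolynomial c.denom = 1 :=
  (c.toPolynomial_inl c.i).trans (c.extend_i X)

theorem isUnit_toPolynomial_denom : IsUnit (c.toPolynomial c.denom) := by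
  rw [toPolynomial_denom]
  exact isUnit_one

theorem toPolynomial_coord (a : c.FreeVar) : c.toPolynomial (c.coord a) = X a := by
  rw [← c.extend_free X a]
  rcases a with ⟨a | a, ha⟩
  · exact c.toPolynomial_inl a
  · exact c.toPolynomial_inr a

theorem ofPolynomial_comp_toPolynomial (x : QuadricRing p q) :
    aeval (fun a : c.FreeVar => dehomog c.denom c.denom_mem (c.coord a)) (c.toPolynomial x) =
      dehomog c.denom c.denom_mem x := by
  induction x using form_induction with
  | h0 => simp
  | hadd a b ha hb => simp only [map_add, ha, hb]
  | hform k G hG =>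
    rw [c.map_form_coord _ (dehomog_self _ c.denom_mem), toPolynomial, evalRing_form,
      comp_aeval_apply]
    congr 2
    funext a
    rw [c.coord_eq_extend _ (dehomog_self _ c.denom_mem), map_extend]
    simp only [aeval_X]

/-- The remaining coordinates as functions on the chart. -/
def ofPolynomial : MvPolynomial c.FreeVar ℝ →ₐ[ℝ] Away (quadricGrading p q) c.denom :=
  aeval fun a : c.FreeVar => dehomog c.denom c.denom_mem (c.coord a)

/-- Pullback of the functions on the chart along its parametrization. -/
def ofAway : Away (quadricGrading p q) c.denom →ₐ[ℝ] MvPolynomial c.FreeVar ℝ :=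
  awayEval (quadricGrading p q) c.toPolynomial c.denom c.isUnit_toPolynomial_denom

theorem ofAway_dehomog (x : QuadricRing p q) :
    c.ofAway (dehomog c.denom c.denom_mem x) = c.toPolynomial x :=
  awayEval_dehomog_of_eq_one c.toPolynomial c.denom c.denom_mem c.isUnit_toPolynomial_denom
    c.toPolynomial_denom x

theorem ofAway_ofPolynomial (P : MvPolynomial c.FreeVar ℝ) : c.ofAway (c.ofPolynomial P) = P := by
  have h : c.ofAway.comp c.ofPolynomial = AlgHom.id ℝ _ := MvPolynomial.algHom_ext fun a => by
    rw [AlgHom.comp_apply, ofPolynomial, aeval_X, ofAway_dehomog, toPolynomial_coord]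
    rfl
  exact DFunLike.congr_fun h P

theorem ofPolynomial_ofAway (x : Away (quadricGrading p q) c.denom) :
    c.ofPolynomial (c.ofAway x) = x := by
  obtain ⟨x, rfl⟩ := dehomog_surjective c.denom c.denom_mem x
  rw [ofAway_dehomog]
  exact c.ofPolynomial_comp_toPolynomial x

/-- The chart `y_i (s_j + ε x_k) ≠ 0` is an affine space: its coordinate ring is a polynomial ring.
-/
def awayEquiv : Away (quadricGrading p q) c.denom ≃ₐ[ℝ] MvPolynomial c.FreeVar ℝ :=
  { c.ofAway with
    invFun := c.ofPolynomial
    left_inv := c.ofPolynomial_ofAway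
    right_inv := c.ofAway_ofPolynomial }

end QuadricChart

end QuadricChart

/-! ### Smoothness and rationality from charts -/

section PolynomialCharts

variable {A : Type} [CommRing A] [Algebra ℝ A] {𝒜 : ℕ → Submodule ℝ A} [GradedAlgebra 𝒜]

/-- The cover of `Proj 𝒜` by the charts `D₊(f i)`. -/
def chartCover {ι : Type} (f : ι → A) (hf : ∀ i, f i ∈ 𝒜 1)
    (hcov : ∀ x : Proj 𝒜, ∃ i, x ∈ Proj.basicOpen 𝒜 (f i)) : (Proj 𝒜).OpenCover where
  I₀ := ι
  X i := Spec (.of (Away 𝒜 (f i)))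
  f i := Proj.awayι 𝒜 (f i) (hf i) one_pos
  mem₀ := by
    rw [Scheme.presieve₀_mem_precoverage_iff]
    refine ⟨fun x => ?_, inferInstance⟩
    obtain ⟨i, hi⟩ := hcov x
    rw [← Proj.opensRange_awayι 𝒜 (f i) (hf i) one_pos] at hi
    exact ⟨i, hi⟩

theorem smooth_projToSpecR {ι : Type} (f : ι → A) (hf : ∀ i, f i ∈ 𝒜 1)
    (hcov : ∀ x : Proj 𝒜, ∃ i, x ∈ Proj.basicOpen 𝒜 (f i)) (σ : ι → Type) [∀ i, Finite (σ i)]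
    (e : ∀ i, Away 𝒜 (f i) ≃ₐ[ℝ] MvPolynomial (σ i) ℝ) : Smooth (projToSpecR 𝒜) := by
  have : IsZariskiLocalAtSource @Smooth.{0} :=
    HasRingHomProperty.instIsZariskiLocalAtSource (Q := RingHom.Smooth)
  rw [IsZariskiLocalAtSource.iff_of_openCover (P := @Smooth.{0}) (chartCover f hf hcov)]
  intro (i : ι)
  change Smooth (Proj.awayι 𝒜 (f i) (hf i) one_pos ≫ projToSpecR 𝒜)
  rw [awayι_projToSpecR, HasRingHomProperty.Spec_iff (P := @Smooth.{0})]
  have : Algebra.Smooth ℝ (MvPolynomial (σ i) ℝ) :=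
    { formallySmooth := inferInstance
      finitePresentation := Algebra.FinitePresentation.mvPolynomial ℝ ℝ (σ i) }
  have : Algebra.Smooth ℝ (Away 𝒜 (f i)) := Algebra.Smooth.of_equiv (e i).symm
  exact RingHom.smooth_algebraMap.mpr this

/-- If `Proj 𝒜` is covered by charts that are affine spaces, and a real point lies in all of them,
then `Proj 𝒜` is rational: as the charts are irreducible and meet each other, one of them is dense.
-/
theorem isRationalOver_projToSpecR {ι : Type} (f : ι → A) (hf : ∀ i, f i ∈ 𝒜 1)
    (hcov : ∀ x : Proj 𝒜, ∃ i, x ∈ Proj.basicOpen 𝒜 (f i)) (σ : ι → Type)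
    (e : ∀ i, Away 𝒜 (f i) ≃ₐ[ℝ] MvPolynomial (σ i) ℝ) (i₀ : ι)
    (ψ : A →ₐ[ℝ] ℝ) (hψ : ∀ i, ψ (f i) ≠ 0) : Scheme.IsRationalOver (projToSpecR 𝒜) := by
  have hdense : IsDominant (Proj.awayι 𝒜 (f i₀) (hf i₀) one_pos) := by
    refine ⟨fun x => mem_closure_iff.mpr fun U hU hx => ?_⟩
    obtain ⟨i, hi⟩ := hcov x
    have : IsDomain (Away 𝒜 (f i)) := (e i).toMulEquiv.isDomain _
    let j := Proj.awayι 𝒜 (f i) (hf i) one_pos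
    have h1 : ((⟨U, hU⟩ : (Proj 𝒜).Opens) ⊓ Proj.basicOpen 𝒜 (f i)).1.Nonempty := ⟨x, hx, hi⟩
    let p := evalPoint ψ ⟨f i, hf i, hψ i⟩
    have h2 : p.1 (⊥ : PrimeSpectrum ℝ) ∈ Proj.basicOpen 𝒜 (f i) ⊓ Proj.basicOpen 𝒜 (f i₀) :=
      ⟨(isIn_iff_mem p _).mp ((evalPoint_isIn_iff ψ _ (hf i) one_pos).mpr (hψ i)),
        (isIn_iff_mem p _).mp ((evalPoint_isIn_iff ψ _ (hf i₀) one_pos).mpr (hψ i₀))⟩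
    have h3 : IsPreirreducible (Proj.basicOpen 𝒜 (f i) : Set (Proj 𝒜)) := by
      rw [← Proj.opensRange_awayι 𝒜 (f i) (hf i) one_pos]
      change IsPreirreducible (Set.range _)
      rw [← Set.image_univ]
      exact (PreirreducibleSpace.isPreirreducible_univ).image _
        (Proj.awayι 𝒜 (f i) (hf i) one_pos).continuous.continuousOn
    obtain ⟨y, -, hy⟩ := h3 U (Proj.basicOpen 𝒜 (f i₀)) hU (Proj.basicOpen 𝒜 (f i₀)).2
      ⟨x, hi, hx⟩ ⟨_, h2⟩
    refine ⟨y, hy.1, ?_⟩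
    have := hy.2
    rw [← Proj.opensRange_awayι 𝒜 (f i₀) (hf i₀) one_pos] at this
    exact this
  let E : Spec (.of (Away 𝒜 (f i₀))) ≅ 𝔸(σ i₀; SpecR) :=
    Scheme.Spec.mapIso (e i₀).symm.toRingEquiv.toCommRingCatIso.op ≪≫
      (AffineSpace.SpecIso (σ i₀) (CommRingCat.of ℝ)).symm
  refine ⟨σ i₀, ?_⟩
  have h1 := Scheme.Hom.birationalOver (E.inv ≫ Proj.awayι 𝒜 (f i₀) (hf i₀) one_pos)
    (projToSpecR 𝒜) (𝔸(σ i₀; SpecR) ↘ SpecR) ?_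
  · exact h1.symm
  · rw [Category.assoc, awayι_projToSpecR, Iso.inv_comp_eq]
    simp only [E, Iso.trans_hom, Functor.mapIso_hom, Iso.symm_hom, Category.assoc]
    rw [AffineSpace.SpecIso_inv_over]
    change _ = Spec.map _ ≫ Spec.map _
    rw [← Spec.map_comp]
    congr 1
    refine CommRingCat.hom_ext (RingHom.ext fun r => ?_)
    exact ((e i₀).symm.commutes r).symm

end PolynomialCharts

/-! ### Projectivity from generators of degree one -/

section Projective

attribute [local instance] MvPolynomial.gradedAlgebra

variable {A B : Type} [CommRing A] [Algebra ℝ A] {𝒜 : ℕ → Submodule ℝ A} [GradedAlgebra 𝒜]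
  [CommRing B] [Algebra ℝ B] {ℬ : ℕ → Submodule ℝ B} [GradedAlgebra ℬ]

theorem irrelevant_le_map_of_surjective (φ : 𝒜 →+*ᵍ ℬ)
    (hφ : ∀ k, ∀ b ∈ ℬ k, ∃ a ∈ 𝒜 k, φ a = b) :
    HomogeneousIdeal.irrelevant ℬ ≤ (HomogeneousIdeal.irrelevant 𝒜).map φ := by
  refine (HomogeneousIdeal.toIdeal_irrelevant_le _).mpr fun k hk b hb => ?_
  obtain ⟨a, ha, rfl⟩ := hφ k b hb
  exact Ideal.mem_map_of_mem _ (HomogeneousIdeal.mem_irrelevant_of_mem 𝒜 hk ha)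

/-- Over the chart `D₊(s)`, the morphism of `Proj` induced by `φ` is the morphism of affine schemes
induced by `φ` on fractions of degree `0`. -/
theorem exists_iso_morphismRestrict_map (φ : 𝒜 →+*ᵍ ℬ)
    (h : HomogeneousIdeal.irrelevant ℬ ≤ (HomogeneousIdeal.irrelevant 𝒜).map φ) {k : ℕ} (hk : 0 < k)
    (s : A) (hs : s ∈ 𝒜 k) :
    ∃ e : Spec (.of (Away ℬ (φ s))) ≅ (Proj.map φ h ⁻¹ᵁ Proj.basicOpen 𝒜 s).toScheme,
      e.hom ≫ (Proj.map φ h ∣_ Proj.basicOpen 𝒜 s) ≫ (Proj.basicOpenIsoSpec 𝒜 s hs hk).hom =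
        Spec.map (CommRingCat.ofHom (Away.map φ s)) := by
  refine ⟨(Proj.basicOpenIsoSpec ℬ (φ s) (φ.2 hs) hk).symm, ?_⟩
  rw [← cancel_mono (Proj.awayι 𝒜 s hs hk), ← Proj.awayι_comp_map φ h hk s hs]
  have h1 : ((Proj.map φ h ∣_ Proj.basicOpen 𝒜 s) ≫ (Proj.basicOpenIsoSpec 𝒜 s hs hk).hom) ≫
      Proj.awayι 𝒜 s hs hk = (Proj.map φ h ∣_ Proj.basicOpen 𝒜 s) ≫ (Proj.basicOpen 𝒜 s).ι := by
    rw [Category.assoc, Proj.awayι, Iso.hom_inv_id_assoc]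
  have h2 := h1.trans (morphismRestrict_ι (Proj.map φ h) (Proj.basicOpen 𝒜 s))
  exact (Category.assoc _ _ _).trans
    ((congrArg ((Proj.basicOpenIsoSpec ℬ (φ s) (φ.2 hs) hk).inv ≫ ·) h2).trans
      (Category.assoc _ _ _).symm)

/-- A graded homomorphism which is surjective in every degree induces a closed immersion of `Proj`.
-/
theorem isClosedImmersion_map (φ : 𝒜 →+*ᵍ ℬ)
    (hφ : ∀ k, ∀ b ∈ ℬ k, ∃ a ∈ 𝒜 k, φ a = b) :
    IsClosedImmersion (Proj.map φ (irrelevant_le_map_of_surjective φ hφ)) := by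
  set h := irrelevant_le_map_of_surjective φ hφ
  have hU : ⨆ f : (i : ℕ+) × 𝒜 i, Proj.basicOpen 𝒜 (f.2 : A) = ⊤ := by
    refine top_le_iff.mp fun x _ => ?_
    obtain ⟨m, f, hm, hf, hx⟩ := exists_mem_basicOpen x
    exact TopologicalSpace.Opens.mem_iSup.mpr ⟨⟨⟨m, hm⟩, ⟨f, hf⟩⟩, hx⟩
  refine IsZariskiLocalAtTarget.of_iSup_eq_top _ hU fun f => ?_
  obtain ⟨e, h1⟩ := exists_iso_morphismRestrict_map φ h f.1.pos f.2 f.2.2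
  have h2 : IsClosedImmersion (Spec.map (CommRingCat.ofHom (Away.map φ (f.2 : A)))) := by
    refine IsClosedImmersion.spec_of_surjective _ fun x => ?_
    obtain ⟨n, b, hb, rfl⟩ := Away.mk_surjective ℬ (φ.2 f.2.2) x
    obtain ⟨a, ha, rfl⟩ := hφ _ b hb
    exact ⟨Away.mk 𝒜 f.2.2 n a ha, Away.map_mk φ _ f.2.2 n a ha⟩
  rw [← h1] at h2
  exact (MorphismProperty.cancel_right_of_respectsIso @IsClosedImmersion.{0} _ _).mp
    ((MorphismProperty.cancel_left_of_respectsIso @IsClosedImmersion.{0} _ _).mp h2)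

theorem algebraMap_eq_awayMk {f : A} {m : ℕ} (hf : f ∈ 𝒜 m) (r : ℝ)
    (hr : algebraMap ℝ A r ∈ 𝒜 (0 • m)) :
    algebraMap ℝ (Away 𝒜 f) r = Away.mk 𝒜 hf 0 (algebraMap ℝ A r) hr := by
  apply val_injective
  rw [val_algebraMap_away, Away.val_mk, ← Localization.mk_one_eq_algebraMap]
  congr 1
  exact Subtype.ext (pow_zero f).symm

/-- The morphism of `Proj` induced by a graded homomorphism of `ℝ`-algebras is a morphism over `ℝ`.
-/
theorem map_projToSpecR (φ : 𝒜 →+*ᵍ ℬ) (hr : ∀ r : ℝ, φ (algebraMap ℝ A r) = algebraMap ℝ B r)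
    (h : HomogeneousIdeal.irrelevant ℬ ≤ (HomogeneousIdeal.irrelevant 𝒜).map φ) :
    Proj.map φ h ≫ projToSpecR 𝒜 = projToSpecR ℬ := by
  refine (Proj.mapAffineOpenCover φ h).openCover.hom_ext _ _ fun (s : (i : ℕ+) × 𝒜 i) => ?_
  change Proj.awayι ℬ (φ s.2) (φ.2 s.2.2) s.1.pos ≫ Proj.map φ h ≫ projToSpecR 𝒜 =
    Proj.awayι ℬ (φ s.2) (φ.2 s.2.2) s.1.pos ≫ projToSpecR ℬ
  rw [Proj.awayι_comp_map_assoc φ h s.1.pos _ s.2.2, awayι_projToSpecR, awayι_projToSpecR,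
    ← Spec.map_comp]
  congr 1
  refine CommRingCat.hom_ext (RingHom.ext fun r => ?_)
  change Away.map φ (s.2 : A) (algebraMap ℝ (Away 𝒜 (s.2 : A)) r) = algebraMap ℝ (Away ℬ _) r
  have h0 : algebraMap ℝ A r ∈ 𝒜 (0 • (s.1 : ℕ)) := by
    rw [zero_smul]
    exact SetLike.algebraMap_mem_graded 𝒜 r
  have h1 : algebraMap ℝ B r ∈ ℬ (0 • (s.1 : ℕ)) := by
    rw [zero_smul]
    exact SetLike.algebraMap_mem_graded ℬ r
  rw [algebraMap_eq_awayMk s.2.2 r h0, Away.map_mk]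
  refine Eq.trans ?_ (algebraMap_eq_awayMk (f := φ s.2) (φ.2 s.2.2) r h1).symm
  simp only [hr]

/-- `Proj` of an `ℝ`-algebra generated by finitely many elements of degree `1` is projective. The
index type is nonempty as `ℙⁿ` has `n + 1` homogeneous coordinates. -/
theorem isProjective_of_generators {ι : Type} [Finite ι] [Nonempty ι] (g : ι → A)
    (hg : ∀ i, g i ∈ 𝒜 1)
    (h : ∀ k, ∀ a ∈ 𝒜 k, ∃ P : MvPolynomial ι ℝ, P.IsHomogeneous k ∧ aeval g P = a) :
    IsProjective (projToSpecR 𝒜) := by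
  obtain ⟨n, ⟨e⟩⟩ := Finite.exists_equiv_fin ι
  obtain ⟨n, rfl⟩ : ∃ m, n = m + 1 := by
    refine Nat.exists_eq_succ_of_ne_zero ?_
    rintro rfl
    exact (e (Classical.arbitrary ι)).elim0
  let φ : homogeneousSubmodule (Fin (n + 1)) ℝ →+*ᵍ 𝒜 :=
    { (aeval fun m => g (e.symm m) : MvPolynomial (Fin (n + 1)) ℝ →ₐ[ℝ] A).toRingHom with
      map_mem := by
        intro k P hP
        change aeval (fun m => g (e.symm m)) P ∈ 𝒜 k
        rw [P.as_sum, map_sum]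
        refine Submodule.sum_mem _ fun α hα => ?_
        have h1 := hP (mem_support_iff.mp hα)
        rw [aeval_monomial, ← Algebra.smul_def]
        refine Submodule.smul_mem _ _ ?_
        rw [← h1, Finsupp.weight_apply, Finsupp.sum]
        exact SetLike.prod_pow_mem_graded 𝒜 _ _ _ fun m _ => hg _ }
  have hφ : ∀ k, ∀ b ∈ 𝒜 k, ∃ a ∈ homogeneousSubmodule (Fin (n + 1)) ℝ k, φ a = b := by
    intro k b hb
    obtain ⟨P, hP, rfl⟩ := h k b hb
    refine ⟨rename e P, hP.rename_isHomogeneous, ?_⟩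
    change aeval (fun m => g (e.symm m)) (rename e P) = _
    rw [aeval_rename]
    congr 2
    funext i
    simp
  exact ⟨n, Proj.map φ (irrelevant_le_map_of_surjective φ hφ), isClosedImmersion_map φ hφ,
    map_projToSpecR φ (fun r => (aeval fun m => g (e.symm m)).commutes r) _⟩

end Projective

/-! ### The product of a projective space and a quadric -/

section QuadricGlobal

variable {p q : ℕ}

theorem weight_quadricWeight (α : QuadricVar p q →₀ ℕ) :
    Finsupp.weight (quadricWeight p q) α =
      (∑ i, α (Sum.inl i), ∑ z, α (Sum.inr z)) := by
  rw [Finsupp.weight_apply, Finsupp.sum_fintype _ _ (by simp), Fintype.sum_sum_type]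
  ext <;> simp [quadricWeight, Prod.fst_sum, Prod.snd_sum]

theorem isWeightedHomogeneous_inl_mul_inr (i : Fin p) (z : Fin 2 ⊕ Fin q) : IsWeightedHomogeneous
    (quadricWeight p q) (X (Sum.inl i) * X (Sum.inr z) : MvPolynomial (QuadricVar p q) ℝ)
      (1 • (1, 1)) :=
  (isWeightedHomogeneous_quadric_inl i).mul (isWeightedHomogeneous_quadric_inr z)

/-- The section `y_i z` of `𝒪(1, 1)`, where `z` is one of the variables `s`, `x`. -/
def quadricGenerator (a : Fin p × (Fin 2 ⊕ Fin q)) : QuadricRing p q :=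
  form _ 1 (X (Sum.inl a.1) * X (Sum.inr a.2)) (isWeightedHomogeneous_inl_mul_inr a.1 a.2)

theorem quadricGenerator_mem (a : Fin p × (Fin 2 ⊕ Fin q)) :
    quadricGenerator a ∈ quadricGrading p q 1 :=
  form_mem 1 _ (isWeightedHomogeneous_inl_mul_inr a.1 a.2)

theorem weight_single_add_single (i : Fin p) (z : Fin 2 ⊕ Fin q) :
    Finsupp.weight (quadricWeight p q)
      (Finsupp.single (Sum.inl i) 1 + Finsupp.single (Sum.inr z) 1) = 1 • (1, 1) := by
  rw [map_add, Finsupp.weight_single, Finsupp.weight_single]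
  simp [quadricWeight]

theorem monomialForm_eq_quadricGenerator (i : Fin p) (z : Fin 2 ⊕ Fin q) :
    monomialForm _ _ _ 1 _ (weight_single_add_single i z) = quadricGenerator (i, z) := by
  apply Subtype.ext
  simp only [quadricGenerator, monomialForm, coe_form, X, monomial_mul, mul_one]

/-- A monomial of positive degree of the coordinate ring is divisible by one of degree one. -/
theorem exists_single_add_single_le {α : QuadricVar p q →₀ ℕ} {k : ℕ} (hk : 0 < k)
    (h : Finsupp.weight (quadricWeight p q) α = k • (1, 1)) :
    ∃ i z, Finsupp.single (Sum.inl i) 1 + Finsupp.single (Sum.inr z) 1 ≤ α := by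
  rw [weight_quadricWeight, Prod.ext_iff] at h
  simp only [Prod.smul_mk, smul_eq_mul, mul_one] at h
  obtain ⟨i, -, hi⟩ := Finset.exists_ne_zero_of_sum_ne_zero (h.1.trans_ne hk.ne')
  obtain ⟨z, -, hz⟩ := Finset.exists_ne_zero_of_sum_ne_zero (h.2.trans_ne hk.ne')
  refine ⟨i, z, fun a => ?_⟩
  rw [Finsupp.add_apply, Finsupp.single_apply, Finsupp.single_apply]
  split_ifs with h1 h2 h2
  · exact absurd (h1.trans h2.symm) (by simp)
  · subst h1; omega
  · subst h2; omega
  · omega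

theorem exists_mem_basicOpen_quadricGenerator (x : Proj (quadricGrading p q)) :
    ∃ a, x ∈ Proj.basicOpen _ (quadricGenerator a) := by
  obtain ⟨k, α, h, hk, hx⟩ := exists_monomialForm_notMem x
  obtain ⟨i, z, hiz⟩ := exists_single_add_single_le hk h
  refine ⟨(i, z), ?_⟩
  rw [← monomialForm_eq_quadricGenerator]
  exact mem_basicOpen_of_le_nsmul h hx 1 one_pos hk (by rwa [one_smul]) _

/-- The charts `y_i (s_j + ε x_k) ≠ 0` cover: the sections `y_i s_j` and `y_i x_k` are half the sum
and half the difference of those with `ε = 1` and `ε = -1`. For `y_i s_j` this takes at least one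
variable `x`. -/
theorem exists_mem_basicOpen_denom (k₀ : Fin q) (x : Proj (quadricGrading p q)) :
    ∃ c : QuadricChart p q, x ∈ Proj.basicOpen _ c.denom := by
  obtain ⟨⟨i, z⟩, hx⟩ := exists_mem_basicOpen_quadricGenerator x
  by_contra! H
  have H' (c : QuadricChart p q) : c.denom ∈ x.asHomogeneousIdeal.toIdeal := by
    by_contra h
    exact H c h
  have h (j : Fin 2) (k : Fin q) (ε : ℤˣ) : (⟨i, j, k, ε⟩ : QuadricChart p q).denom =
      quadricGenerator (i, Sum.inl j) +
        algebraMap ℝ _ ((ε : ℤ) : ℝ) * quadricGenerator (i, Sum.inr k) :=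
    (⟨i, j, k, ε⟩ : QuadricChart p q).map_denom_eq (AlgHom.id ℝ _)
  refine hx ?_
  change _ ∈ x.asHomogeneousIdeal.toIdeal
  have h2 : algebraMap ℝ (QuadricRing p q) 2⁻¹ * 2 = 1 := QuadricChart.algebraMap_half
  rcases z with j | k
  · have h1 := Ideal.mul_mem_left _ (algebraMap ℝ (QuadricRing p q) 2⁻¹)
      (Ideal.add_mem _ (H' ⟨i, j, k₀, 1⟩) (H' ⟨i, j, k₀, -1⟩))
    rw [h, h] at h1
    convert h1 using 1
    simp only [Units.val_one, Int.cast_one, map_one, Units.val_neg, Int.cast_neg, map_neg]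
    linear_combination -quadricGenerator (i, Sum.inl j) * h2
  · have h1 := Ideal.mul_mem_left _ (algebraMap ℝ (QuadricRing p q) 2⁻¹)
      (Ideal.sub_mem _ (H' ⟨i, 0, k, 1⟩) (H' ⟨i, 0, k, -1⟩))
    rw [h, h] at h1
    convert h1 using 1
    simp only [Units.val_one, Int.cast_one, map_one, Units.val_neg, Int.cast_neg, map_neg]
    linear_combination -quadricGenerator (i, Sum.inr k) * h2

/-- The homogeneous coordinate ring is generated by the sections `y_i z` of degree `1`. -/
theorem exists_aeval_quadricGenerator (k : ℕ) (a : QuadricRing p q)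
    (ha : a ∈ quadricGrading p q k) : ∃ P : MvPolynomial (Fin p × (Fin 2 ⊕ Fin q)) ℝ,
      P.IsHomogeneous k ∧ aeval quadricGenerator P = a := by
  obtain ⟨G, hG, rfl⟩ := exists_eq_form ha
  suffices h : ∀ (k : ℕ) (α) (h : Finsupp.weight (quadricWeight p q) α = k • (1, 1)),
      monomialForm _ _ _ k α h ∈ (homogeneousSubmodule (Fin p × (Fin 2 ⊕ Fin q)) ℝ k).map
        (aeval quadricGenerator : _ →ₐ[ℝ] QuadricRing p q).toLinearMap from
    form_mem_of_monomialForm_mem (h k) G hG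
  intro k
  induction k with
  | zero =>
    intro α h
    have hα : α = 0 := by
      rw [weight_quadricWeight, Prod.ext_iff] at h
      simp only [zero_smul, Prod.fst_zero, Prod.snd_zero, Finset.sum_eq_zero_iff,
        Finset.mem_univ, true_implies] at h
      ext a
      rcases a with a | a
      · exact h.1 a
      · exact h.2 a
    subst hα
    refine ⟨1, isHomogeneous_one _ _, ?_⟩
    apply Subtype.ext
    simp [monomialForm, coe_form]
  | succ k ih =>
    intro α h
    obtain ⟨i, z, hiz⟩ := exists_single_add_single_le k.succ_pos h
    obtain ⟨β, rfl⟩ := exists_add_of_le hiz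
    have hβ : Finsupp.weight (quadricWeight p q) β = k • (1, 1) := by
      rw [map_add, weight_single_add_single, add_comm k 1, add_smul] at h
      exact add_left_cancel h
    obtain ⟨P, hP, hPβ⟩ := ih β hβ
    refine ⟨X (i, z) * P, ?_, ?_⟩
    · rw [add_comm k 1]
      exact (isHomogeneous_X ℝ (i, z)).mul hP
    · change aeval _ (X (i, z) * P) = _
      change aeval _ P = _ at hPβ
      rw [map_mul, aeval_X, hPβ, ← monomialForm_eq_quadricGenerator, ← monomialForm_add _ _ (by
        rw [h, add_comm])]
      apply Subtype.ext
      simp only [monomialForm, coe_form, add_comm]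

theorem isProjective_quadric (hp : 0 < p) : IsProjective (projToSpecR (quadricGrading p q)) := by
  have : Nonempty (Fin p × (Fin 2 ⊕ Fin q)) := ⟨⟨0, hp⟩, Sum.inl 0⟩
  exact isProjective_of_generators quadricGenerator quadricGenerator_mem
    exists_aeval_quadricGenerator

theorem smooth_quadric (k₀ : Fin q) : Smooth (projToSpecR (quadricGrading p q)) :=
  smooth_projToSpecR (fun c : QuadricChart p q => c.denom) (fun c => c.denom_mem)
    (exists_mem_basicOpen_denom k₀) (fun c => c.FreeVar) fun c => c.awayEquiv

/-- The evaluation at a point `v` of the affine cone over the product of `ℙ^(p - 1)` and the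
quadric. -/
def quadricEval (v : QuadricVar p q → ℝ)
    (hv : ∑ j, v (Sum.inr (Sum.inl j)) ^ 2 = ∑ k, v (Sum.inr (Sum.inr k)) ^ 2) :
    QuadricRing p q →ₐ[ℝ] ℝ :=
  evalRing _ _ v (aeval_eq_zero_of_mem_span (by rw [aeval_quadricEquation, sub_eq_zero, hv]))

theorem quadricEval_generator (v : QuadricVar p q → ℝ)
    (hv : ∑ j, v (Sum.inr (Sum.inl j)) ^ 2 = ∑ k, v (Sum.inr (Sum.inr k)) ^ 2)
    (a : Fin p × (Fin 2 ⊕ Fin q)) :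
    quadricEval v hv (quadricGenerator a) = v (Sum.inl a.1) * v (Sum.inr a.2) := by
  refine (evalRing_form _ _ 1 _ (isWeightedHomogeneous_inl_mul_inr a.1 a.2)).trans ?_
  rw [map_mul, aeval_X, aeval_X]

/-- A real point on which no `y_i` and no `s_j ± x_k` vanishes lies in all the charts. -/
theorem isRationalOver_quadric (i₀ : Fin p) (k₀ : Fin q) (v : QuadricVar p q → ℝ)
    (hv : ∑ j, v (Sum.inr (Sum.inl j)) ^ 2 = ∑ k, v (Sum.inr (Sum.inr k)) ^ 2)
    (h0 : ∀ i, v (Sum.inl i) ≠ 0)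
    (h1 : ∀ j k, v (Sum.inr (Sum.inl j)) ^ 2 ≠ v (Sum.inr (Sum.inr k)) ^ 2) :
    Scheme.IsRationalOver (projToSpecR (quadricGrading p q)) := by
  refine isRationalOver_projToSpecR (fun c : QuadricChart p q => c.denom) (fun c => c.denom_mem)
    (exists_mem_basicOpen_denom k₀) (fun c => c.FreeVar) (fun c => c.awayEquiv)
    ⟨i₀, 0, k₀, 1⟩ (quadricEval v hv) fun c => ?_
  rw [c.map_denom_eq]
  change quadricEval v hv (quadricGenerator (c.i, Sum.inl c.j)) + c.sign *
    quadricEval v hv (quadricGenerator (c.i, Sum.inr c.k)) ≠ 0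
  rw [quadricEval_generator, quadricEval_generator]
  intro h
  have h2 : v (Sum.inr (Sum.inl c.j)) + c.sign * v (Sum.inr (Sum.inr c.k)) = 0 := by
    refine (mul_eq_zero.mp ?_).resolve_left (h0 c.i)
    linear_combination h
  refine h1 c.j c.k ?_
  linear_combination (v (Sum.inr (Sum.inl c.j)) - c.sign * v (Sum.inr (Sum.inr c.k))) * h2 +
    v (Sum.inr (Sum.inr c.k)) ^ 2 * c.sign_mul_self

theorem quadricEval_nondegenerate {v : QuadricVar p q → ℝ}
    (hv : ∑ j, v (Sum.inr (Sum.inl j)) ^ 2 = ∑ k, v (Sum.inr (Sum.inr k)) ^ 2)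
    (h : (fun i => v (Sum.inl i)) ≠ 0) (h' : (fun z => v (Sum.inr z)) ≠ 0) :
    Nondegenerate (quadricGrading p q) (quadricEval v hv) := by
  obtain ⟨i, hi⟩ := Function.ne_iff.mp h
  obtain ⟨z, hz⟩ := Function.ne_iff.mp h'
  refine ⟨quadricGenerator (i, z), quadricGenerator_mem _, ?_⟩
  rw [quadricEval_generator]
  exact mul_ne_zero hi hz

/-- The real point with bihomogeneous coordinates `v`. -/
def quadricPoint (v : QuadricVar p q → ℝ)
    (hv : ∑ j, v (Sum.inr (Sum.inl j)) ^ 2 = ∑ k, v (Sum.inr (Sum.inr k)) ^ 2)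
    (h : (fun i => v (Sum.inl i)) ≠ 0) (h' : (fun z => v (Sum.inr z)) ≠ 0) :
    RealLocus (projToSpecR (quadricGrading p q)) :=
  evalPoint (quadricEval v hv) (quadricEval_nondegenerate hv h h')

theorem exists_mul_eq_of_quadricPoint_eq {v v' : QuadricVar p q → ℝ} {hv h h' hv' g g'}
    (H : quadricPoint v hv h h' = quadricPoint v' hv' g g') :
    ∃ e : ℝ, ∀ i z, v' (Sum.inl i) * v' (Sum.inr z) = e * (v (Sum.inl i) * v (Sum.inr z)) := by
  obtain ⟨e, -, H⟩ := proportional_of_evalPoint_eq _ _ H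
  refine ⟨e, fun i z => ?_⟩
  have h1 := H 1 _ (quadricGenerator_mem (i, z))
  rwa [quadricEval_generator, quadricEval_generator, pow_one] at h1

theorem quadricPoint_eq {v v' : QuadricVar p q → ℝ} {hv h h' hv' g g'} {t r : ℝ}
    (ht : t ≠ 0) (hr : r ≠ 0) (h1 : ∀ i, v' (Sum.inl i) = t * v (Sum.inl i))
    (h2 : ∀ z, v' (Sum.inr z) = r * v (Sum.inr z)) :
    quadricPoint v hv h h' = quadricPoint v' hv' g g' := by
  have hP : Proportional (quadricGrading p q) (quadricEval v hv) (quadricEval v' hv') := by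
    refine proportional_evalRing _ v _ _ (fun k G hG => evalRing_form _ _ k G hG) ht hr ?_
    rintro (j | j)
    · simp [quadricWeight, h1]
    · simp [quadricWeight, h2]
  exact hP.evalPoint_eq _ _

/-- A map from a manifold to the real locus, given in bihomogeneous coordinates by a smooth map `v`,
is a smooth quotient as soon as there is a smooth map `κ`, defined where `y`, `s` and `x` are all
nonzero vectors, such that `v (κ θ)` and `θ` are equal up to scaling in both factors for `θ` in the
affine cone. -/
theorem isSmoothQuotient_quadricPoint {E H : Type*} [NormedAddCommGroup E] [NormedSpace ℝ E]
    [TopologicalSpace H] {I : ModelWithCorners ℝ E H} {N : Type*} [TopologicalSpace N]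
    [ChartedSpace H N] (k₀ : Fin q) (v : N → QuadricVar p q → ℝ)
    (hv : ∀ n, ∑ j, v n (Sum.inr (Sum.inl j)) ^ 2 = ∑ k, v n (Sum.inr (Sum.inr k)) ^ 2)
    (h : ∀ n, (fun i => v n (Sum.inl i)) ≠ 0) (h' : ∀ n, (fun z => v n (Sum.inr z)) ≠ 0)
    (hsm : ∀ a, ContMDiff I 𝓘(ℝ, ℝ) ∞ fun n => v n a)
    (κ : (QuadricVar p q → ℝ) → N)
    (hκ : ContMDiffOn 𝓘(ℝ, QuadricVar p q → ℝ) I ∞ κ {θ | (fun i => θ (Sum.inl i)) ≠ 0 ∧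
      (fun j => θ (Sum.inr (Sum.inl j))) ≠ 0 ∧ (fun k => θ (Sum.inr (Sum.inr k))) ≠ 0})
    (hvκ : ∀ θ : QuadricVar p q → ℝ, (fun i => θ (Sum.inl i)) ≠ 0 →
      (fun j => θ (Sum.inr (Sum.inl j))) ≠ 0 → (fun k => θ (Sum.inr (Sum.inr k))) ≠ 0 →
      ∑ j, θ (Sum.inr (Sum.inl j)) ^ 2 = ∑ k, θ (Sum.inr (Sum.inr k)) ^ 2 →
      ∃ t r : ℝ, t ≠ 0 ∧ r ≠ 0 ∧ (∀ i, v (κ θ) (Sum.inl i) = t * θ (Sum.inl i)) ∧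
        ∀ z, v (κ θ) (Sum.inr z) = r * θ (Sum.inr z)) :
    IsSmoothQuotient I (RealLocus.SmoothOn (projToSpecR (quadricGrading p q)))
      fun n => quadricPoint (v n) (hv n) (h n) (h' n) := by
  refine isSmoothQuotient_evalPoint (fun n => quadricEval (v n) (hv n))
    (fun n => quadricEval_nondegenerate (hv n) (h n) (h' n)) (contMDiff_evalRing _ _ hsm)
    (fun c : QuadricChart p q => c.denom) (fun c => c.denom_mem) (fun P => ?_)
    (fun c => c.coord) _ ?_ κ hκ fun c χ hχ => ?_
  · simp only [isIn_iff_mem]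
    exact exists_mem_basicOpen_denom k₀ _
  · exact (isOpen_ne.preimage (continuous_pi fun i => continuous_apply _)).inter
      ((isOpen_ne.preimage (continuous_pi fun i => continuous_apply _)).inter
        (isOpen_ne.preimage (continuous_pi fun i => continuous_apply _)))
  · have h1 := c.map_denom_eq χ
    have h2 := c.sum_sq_coord χ
    have h3 : (fun i => χ (c.coord (Sum.inl i))) ≠ 0 := fun h0 =>
      one_ne_zero (hχ.symm.trans (congrFun h0 c.i))
    -- Over the reals `s_0² + s_1² = ∑ x_k²` shows that `s = 0` implies `x = 0` and conversely, and
    -- both together contradict `s_j + ε x_k = 1`.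
    have h4 : (fun j => χ (c.coord (Sum.inr (Sum.inl j)))) ≠ 0 := by
      intro h0
      have h5 (k) : χ (c.coord (Sum.inr (Sum.inl k))) = 0 := congrFun h0 k
      simp only [h5] at h1 h2
      have h6 := (Finset.sum_eq_zero_iff_of_nonneg fun k _ => sq_nonneg _).mp
        (h2.symm.trans (by simp)) c.k (Finset.mem_univ _)
      rw [hχ, pow_eq_zero_iff two_ne_zero |>.mp h6] at h1
      simp at h1
    have h4' : (fun j => χ (c.coord (Sum.inr (Sum.inr j)))) ≠ 0 := by
      intro h0
      have h5 (k) : χ (c.coord (Sum.inr (Sum.inr k))) = 0 := congrFun h0 k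
      simp only [h5] at h1 h2
      have h6 := (Finset.sum_eq_zero_iff_of_nonneg fun k _ => sq_nonneg _).mp
        (h2.trans (by simp)) c.j (Finset.mem_univ _)
      rw [hχ, pow_eq_zero_iff two_ne_zero |>.mp h6] at h1
      simp at h1
    refine ⟨⟨h3, h4, h4'⟩, ?_⟩
    obtain ⟨t, r, ht, hr, h5, h6⟩ := hvκ (fun a => χ (c.coord a)) h3 h4 h4' h2
    refine proportional_evalRing χ (fun a => χ (c.coord a)) _ _ (c.map_form_coord χ hχ) ht hr ?_
    rintro (j | j)
    · simp [quadricWeight, h5]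
    · simp [quadricWeight, h6]

end QuadricGlobal

/-! ### The rational models and the diffeomorphisms -/

section RealQuadrics

theorem norm_toLp_sq {ι : Type*} [Fintype ι] (v : ι → ℝ) :
    ‖(WithLp.toLp 2 v : EuclideanSpace ℝ ι)‖ ^ 2 = ∑ i, v i ^ 2 := by
  simp [EuclideanSpace.norm_sq_eq]

theorem toLp_ne_zero {ι : Type*} {v : ι → ℝ} (h : v ≠ 0) :
    (WithLp.toLp 2 v : EuclideanSpace ℝ ι) ≠ 0 := fun h0 => h (congrArg WithLp.ofLp h0)

theorem normalizeSphere_toLp_apply {n : ℕ} {v : Fin (n + 1) → ℝ} (h : v ≠ 0) (i : Fin (n + 1)) :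
    (normalizeSphere n (WithLp.toLp 2 v) : EuclideanSpace ℝ (Fin (n + 1))) i =
      ‖(WithLp.toLp 2 v : EuclideanSpace ℝ (Fin (n + 1)))‖⁻¹ * v i := by
  rw [coe_normalizeSphere (toLp_ne_zero h)]
  rfl

/-- The point of the affine cone over `ℙ² × {s_0² + s_1² = x²}` with coordinates `y = v`, `s = c`,
`x = 1`. -/
def evenLift (n : UnitSphere 1 × UnitSphere 2) : QuadricVar 3 1 → ℝ :=
  Sum.elim (fun i => (n.2 : EuclideanSpace ℝ (Fin 3)) i)
    (Sum.elim (fun j => (n.1 : EuclideanSpace ℝ (Fin 2)) j) 1)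

/-- The point of the affine cone over `ℙ⁰ × {s_0² + s_1² = x_0² + x_1² + x_2²}` with coordinates
`y = 1`, `s = c`, `x = v`. -/
def oddLift (n : UnitSphere 1 × UnitSphere 2) : QuadricVar 1 3 → ℝ :=
  Sum.elim 1 (Sum.elim (fun j => (n.1 : EuclideanSpace ℝ (Fin 2)) j)
    (fun i => (n.2 : EuclideanSpace ℝ (Fin 3)) i))

/-- The map from `S¹ × S²` to the real points of `ℙ² × {s_0² + s_1² = x²}`, which is the product of
the quotient map `S² → ℙ²(ℝ)` and of the parametrization of a conic by the circle. -/
def evenPoint (n : UnitSphere 1 × UnitSphere 2) : RealLocus (projToSpecR (quadricGrading 3 1)) :=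
  quadricPoint (evenLift n) ((sphere_sum_sq n.1).trans (by simp [evenLift]))
    (sphere_coord_ne_zero n.2) fun h => one_ne_zero (congrFun h (Sum.inr 0))

/-- The map from `S¹ × S²` to the real points of the quadric `s_0² + s_1² = x_0² + x_1² + x_2²`. -/
def oddPoint (n : UnitSphere 1 × UnitSphere 2) : RealLocus (projToSpecR (quadricGrading 1 3)) :=
  quadricPoint (oddLift n) ((sphere_sum_sq n.1).trans (sphere_sum_sq n.2).symm)
    (fun h => one_ne_zero (congrFun h 0)) fun h =>
      sphere_coord_ne_zero n.2 (funext fun i => congrFun h (Sum.inr i))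

theorem evenPoint_eq_iff (n n' : UnitSphere 1 × UnitSphere 2) :
    evenPoint n = evenPoint n' ↔ ∃ ε : ℤˣ, n'.1 = n.1 ∧ n'.2 = ε • n.2 := by
  constructor
  · intro H
    obtain ⟨e, he⟩ := exists_mul_eq_of_quadricPoint_eq H
    obtain ⟨ε, rfl, h2⟩ := exists_units_smul_eq (x := n.2) (y := n'.2) (t := e) fun i => by
      have := he i (Sum.inr 0)
      simpa [evenLift] using this
    refine ⟨ε, Subtype.ext <| PiLp.ext fun j => ?_, h2⟩
    obtain ⟨i, hi⟩ := Function.ne_iff.mp (sphere_coord_ne_zero n.2)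
    have h3 := he i (Sum.inl j)
    simp only [evenLift, Sum.elim_inl, Sum.elim_inr, h2, units_smul_sphere_apply] at h3
    have h4 : ((ε : ℤ) : ℝ) ≠ 0 := by simp
    refine mul_left_cancel₀ (mul_ne_zero h4 hi) ?_
    linear_combination h3
  · rintro ⟨ε, h1, h2⟩
    refine quadricPoint_eq (t := ((ε : ℤ) : ℝ)) (r := 1) (by simp) one_ne_zero (fun i => ?_)
      fun z => ?_
    · simp [evenLift, h2, units_smul_sphere_apply]
    · rcases z with j | k <;> simp [evenLift, h1]

theorem oddPoint_eq_iff (n n' : UnitSphere 1 × UnitSphere 2) :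
    oddPoint n = oddPoint n' ↔ ∃ ε : ℤˣ, n'.1 = ε • n.1 ∧ n'.2 = ε • n.2 := by
  constructor
  · intro H
    obtain ⟨e, he⟩ := exists_mul_eq_of_quadricPoint_eq H
    obtain ⟨ε, rfl, h2⟩ := exists_units_smul_eq (x := n.2) (y := n'.2) (t := e) fun i => by
      have := he 0 (Sum.inr i)
      simpa [oddLift] using this
    refine ⟨ε, Subtype.ext <| PiLp.ext fun j => ?_, h2⟩
    have h3 := he 0 (Sum.inl j)
    simpa [oddLift, units_smul_sphere_apply] using h3
  · rintro ⟨ε, h1, h2⟩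
    refine quadricPoint_eq (t := 1) (r := ((ε : ℤ) : ℝ)) one_ne_zero (by simp) (fun i => ?_)
      fun z => ?_
    · simp [oddLift]
    · rcases z with j | k <;> simp [oddLift, h1, h2, units_smul_sphere_apply]

theorem isSmoothQuotient_evenPoint : IsSmoothQuotient ((𝓡 1).prod (𝓡 2))
    (RealLocus.SmoothOn (projToSpecR (quadricGrading 3 1))) evenPoint := by
  refine isSmoothQuotient_quadricPoint (0 : Fin 1) evenLift _ _ _ (fun a => ?_)
    (fun θ => (normalizeSphere 1 (WithLp.toLp 2 fun j =>
      (θ (Sum.inr (Sum.inr 0)))⁻¹ * θ (Sum.inr (Sum.inl j))),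
      normalizeSphere 2 (WithLp.toLp 2 fun i => θ (Sum.inl i)))) ?_ ?_
  · rcases a with i | j | k
    · exact (contMDiff_sphere_coord 2 i).comp contMDiff_snd
    · exact (contMDiff_sphere_coord 1 j).comp contMDiff_fst
    · exact contMDiff_const
  -- Scaling `s` to the unit circle is done by dividing by `x`, and not by `|x| = ‖s‖`, so that `x`
  -- becomes `1` and not `-1`.
  · have hx {θ : QuadricVar 3 1 → ℝ} (h : (fun k => θ (Sum.inr (Sum.inr k))) ≠ 0) :
        θ (Sum.inr (Sum.inr 0)) ≠ 0 := fun h0 => h (funext fun k => by rwa [Subsingleton.elim k 0])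
    refine ContMDiffOn.prodMk ?_ ?_
    · refine (contMDiffOn_normalizeSphere 1).comp (ContDiffOn.contMDiffOn ?_) fun θ hθ => ?_
      · refine PiLp.contDiff_toLp.comp_contDiffOn (contDiffOn_pi.mpr fun j => ?_)
        exact ((contDiff_apply ℝ ℝ _).contDiffOn.inv fun θ hθ => hx hθ.2.2).mul
          (contDiff_apply ℝ ℝ _).contDiffOn
      · refine toLp_ne_zero fun h0 => hθ.2.1 (funext fun j => ?_)
        exact (mul_eq_zero.mp (congrFun h0 j)).resolve_left (inv_ne_zero (hx hθ.2.2))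
    · exact (contMDiffOn_normalizeSphere 2).comp
        (contDiff_toLp_comp (Sum.inl : Fin 3 → QuadricVar 3 1)).contMDiff.contMDiffOn
        fun θ hθ => toLp_ne_zero hθ.1
  · intro θ h1 h2 h3 h4
    have hx : θ (Sum.inr (Sum.inr 0)) ≠ 0 :=
      fun h0 => h3 (funext fun k => by rwa [Subsingleton.elim k 0])
    have hc : (fun j => (θ (Sum.inr (Sum.inr 0)))⁻¹ * θ (Sum.inr (Sum.inl j))) ≠ 0 :=
      fun h0 => h2 (funext fun j => (mul_eq_zero.mp (congrFun h0 j)).resolve_left (inv_ne_zero hx))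
    have hn : ‖(WithLp.toLp 2 fun j => (θ (Sum.inr (Sum.inr 0)))⁻¹ * θ (Sum.inr (Sum.inl j)) :
        EuclideanSpace ℝ (Fin 2))‖ = 1 := by
      refine (sq_eq_sq₀ (norm_nonneg _) zero_le_one).mp ?_
      rw [norm_toLp_sq]
      simp only [mul_pow, ← Finset.mul_sum, h4]
      simp [hx]
    refine ⟨‖(WithLp.toLp 2 fun i => θ (Sum.inl i) : EuclideanSpace ℝ (Fin 3))‖⁻¹,
      (θ (Sum.inr (Sum.inr 0)))⁻¹, inv_ne_zero (norm_ne_zero_iff.mpr (toLp_ne_zero h1)),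
      inv_ne_zero hx, fun i => normalizeSphere_toLp_apply h1 i, fun z => ?_⟩
    rcases z with j | k
    · refine (normalizeSphere_toLp_apply hc j).trans ?_
      rw [hn, inv_one, one_mul]
    · rw [Subsingleton.elim k 0, inv_mul_cancel₀ hx]
      rfl

theorem isSmoothQuotient_oddPoint : IsSmoothQuotient ((𝓡 1).prod (𝓡 2))
    (RealLocus.SmoothOn (projToSpecR (quadricGrading 1 3))) oddPoint := by
  refine isSmoothQuotient_quadricPoint (0 : Fin 3) oddLift _ _ _ (fun a => ?_)
    (fun θ => (normalizeSphere 1 (WithLp.toLp 2 fun j => θ (Sum.inr (Sum.inl j))),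
      normalizeSphere 2 (WithLp.toLp 2 fun i => θ (Sum.inr (Sum.inr i))))) ?_ ?_
  · rcases a with i | j | k
    · exact contMDiff_const
    · exact (contMDiff_sphere_coord 1 j).comp contMDiff_fst
    · exact (contMDiff_sphere_coord 2 k).comp contMDiff_snd
  · refine ContMDiffOn.prodMk ?_ ?_
    · exact (contMDiffOn_normalizeSphere 1).comp
        (contDiff_toLp_comp
          (fun j : Fin 2 => (Sum.inr (Sum.inl j) : QuadricVar 1 3))).contMDiff.contMDiffOn
        fun θ hθ => toLp_ne_zero hθ.2.1
    · exact (contMDiffOn_normalizeSphere 2).comp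
        (contDiff_toLp_comp
          (fun j : Fin 3 => (Sum.inr (Sum.inr j) : QuadricVar 1 3))).contMDiff.contMDiffOn
        fun θ hθ => toLp_ne_zero hθ.2.2
  · intro θ h1 h2 h3 h4
    have hy : θ (Sum.inl 0) ≠ 0 :=
      fun h0 => h1 (funext fun k => by rwa [Subsingleton.elim k 0])
    have hn : ‖(WithLp.toLp 2 fun j => θ (Sum.inr (Sum.inl j)) : EuclideanSpace ℝ (Fin 2))‖ =
        ‖(WithLp.toLp 2 fun i => θ (Sum.inr (Sum.inr i)) : EuclideanSpace ℝ (Fin 3))‖ := by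
      refine (sq_eq_sq₀ (norm_nonneg _) (norm_nonneg _)).mp ?_
      rw [norm_toLp_sq, norm_toLp_sq, h4]
    refine ⟨(θ (Sum.inl 0))⁻¹,
      ‖(WithLp.toLp 2 fun j => θ (Sum.inr (Sum.inl j)) : EuclideanSpace ℝ (Fin 2))‖⁻¹,
      inv_ne_zero hy, inv_ne_zero (norm_ne_zero_iff.mpr (toLp_ne_zero h2)), fun i => ?_,
      fun z => ?_⟩
    · rw [Subsingleton.elim i 0, inv_mul_cancel₀ hy]
      rfl
    · rcases z with j | k
      · exact normalizeSphere_toLp_apply h2 j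
      · rw [hn]
        exact normalizeSphere_toLp_apply h3 k

theorem isRationalOver_even : Scheme.IsRationalOver (projToSpecR (quadricGrading 3 1)) := by
  -- The Pythagorean triple `3² + 4² = 5²`.
  refine isRationalOver_quadric 0 0 (Sum.elim 1 (Sum.elim ![3, 4] ![5])) ?_ ?_ ?_
  · norm_num [Fin.sum_univ_succ]
  · simp
  · intro j k
    fin_cases j <;> fin_cases k <;> norm_num

theorem isRationalOver_odd : Scheme.IsRationalOver (projToSpecR (quadricGrading 1 3)) := by
  -- `7² + 24² = 12² + 16² + 15²`, and both sides have no square in common.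
  refine isRationalOver_quadric 0 0 (Sum.elim 1 (Sum.elim ![7, 24] ![12, 16, 15])) ?_ ?_ ?_
  · norm_num [Fin.sum_univ_succ]
  · simp
  · intro j k
    fin_cases j <;> fin_cases k <;> norm_num

end RealQuadrics

section Diffeomorphisms

variable {d : ℕ} {F : MvPolynomial (Fin 3) ℝ}

/-- The section rings `WeightedRing` and `sectionRing (ampleGrading d F)` agree by definition. -/
theorem isSmoothQuotient_conicBundle (hpos : ∀ v : Fin 3 → ℝ, v ≠ 0 → 0 < aeval v F)
    (hF : F.IsHomogeneous (2 * d)) :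
    IsSmoothQuotient ((𝓡 1).prod (𝓡 2)) (RealLocus.SmoothOn (conicBundleToSpecR d F))
      (conicPoint d hpos) := isSmoothQuotient_conicPoint hpos hF

theorem conicPoint_eq_iff_of_even (hpos : ∀ v : Fin 3 → ℝ, v ≠ 0 → 0 < aeval v F)
    (hF : F.IsHomogeneous (2 * d)) (hd : Even d) (n n' : UnitSphere 1 × UnitSphere 2) :
    conicPoint d hpos n = conicPoint d hpos n' ↔ ∃ ε : ℤˣ, n'.1 = n.1 ∧ n'.2 = ε • n.2 := by
  rw [conicPoint_eq_iff hpos hF]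
  refine exists_congr fun ε => ?_
  rw [Int.units_pow_eq_pow_mod_two, Nat.even_iff.mp hd, pow_zero, one_smul]

theorem conicPoint_eq_iff_of_odd (hpos : ∀ v : Fin 3 → ℝ, v ≠ 0 → 0 < aeval v F)
    (hF : F.IsHomogeneous (2 * d)) (hd : Odd d) (n n' : UnitSphere 1 × UnitSphere 2) :
    conicPoint d hpos n = conicPoint d hpos n' ↔
      ∃ ε : ℤˣ, n'.1 = ε • n.1 ∧ n'.2 = ε • n.2 := by
  rw [conicPoint_eq_iff hpos hF]
  refine exists_congr fun ε => ?_
  rw [Int.units_pow_eq_pow_mod_two, Nat.odd_iff.mp hd, pow_one]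

theorem orbit_mk_eq_iff {α : Type} [MulAction ℤˣ α] (x x' : α) :
    (Quotient.mk'' x : MulAction.orbitRel.Quotient ℤˣ α) = Quotient.mk'' x' ↔
      ∃ ε : ℤˣ, x' = ε • x := by
  rw [Quotient.eq'', MulAction.orbitRel_apply]
  constructor
  · rintro ⟨ε, rfl⟩
    exact ⟨ε⁻¹, (inv_smul_smul ε x').symm⟩
  · rintro ⟨ε, rfl⟩
    exact ⟨ε⁻¹, inv_smul_smul ε x⟩

/-- The rational model is `ℙ² × {s_0² + s_1² = x²}` if `d` is even and the quadric threefold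
`s_0² + s_1² = x_0² + x_1² + x_2²` if `d` is odd. -/
theorem exists_rational_model (hpos : ∀ v : Fin 3 → ℝ, v ≠ 0 → 0 < aeval v F)
    (hF : F.IsHomogeneous (2 * d)) :
    ∃ (Y : Scheme.{0}) (sY : Y ⟶ SpecR), Smooth sY ∧ IsProjective sY ∧
      Scheme.IsRationalOver sY ∧ RealLociDiffeomorphic (conicBundleToSpecR d F) sY := by
  rcases Nat.even_or_odd d with hd | hd
  · exact ⟨_, projToSpecR (quadricGrading 3 1), smooth_quadric 0, isProjective_quadric (by decide),
      isRationalOver_even, (isSmoothQuotient_conicBundle hpos hF).diffeomorphic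
        isSmoothQuotient_evenPoint fun n n' =>
          (conicPoint_eq_iff_of_even hpos hF hd n n').trans (evenPoint_eq_iff n n').symm⟩
  · exact ⟨_, projToSpecR (quadricGrading 1 3), smooth_quadric 0, isProjective_quadric (by decide),
      isRationalOver_odd, (isSmoothQuotient_conicBundle hpos hF).diffeomorphic
        isSmoothQuotient_oddPoint fun n n' =>
          (conicPoint_eq_iff_of_odd hpos hF hd n n').trans (oddPoint_eq_iff n n').symm⟩

theorem realLocusDiffeomorphicTo_of_even (hpos : ∀ v : Fin 3 → ℝ, v ≠ 0 → 0 < aeval v F)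
    (hF : F.IsHomogeneous (2 * d)) (hd : Even d) :
    RealLocusDiffeomorphicTo (conicBundleToSpecR d F) ((𝓡 1).prod (𝓡 2))
      (UnitSphere 1 × RealProjectivePlane) := by
  refine (isSmoothQuotient_conicBundle hpos hF).diffeomorphic
    isSmoothQuotient_prod_projectivePlane fun n n' => ?_
  refine (conicPoint_eq_iff_of_even hpos hF hd n n').trans ?_
  rw [exists_and_left, ← orbit_mk_eq_iff, Prod.ext_iff]
  exact and_congr_left fun _ => eq_comm

theorem realLocusDiffeomorphicTo_of_odd (hpos : ∀ v : Fin 3 → ℝ, v ≠ 0 → 0 < aeval v F)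
    (hF : F.IsHomogeneous (2 * d)) (hd : Odd d) :
    RealLocusDiffeomorphicTo (conicBundleToSpecR d F) ((𝓡 1).prod (𝓡 2)) TwistedProduct := by
  refine (isSmoothQuotient_conicBundle hpos hF).diffeomorphic isSmoothQuotient_twistedProduct
    fun n n' => ?_
  refine (conicPoint_eq_iff_of_odd hpos hF hd n n').trans ?_
  rw [orbit_mk_eq_iff]
  refine exists_congr fun ε => ⟨fun h => Prod.ext h.1 h.2, ?_⟩
  rintro rfl
  exact ⟨rfl, rfl⟩

end Diffeomorphisms

end RealConicBundle

end

theorem proposition5p1 (d : ℕ) (hd : 1 ≤ d) (F : MvPolynomial (Fin 3) ℝ)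
    (hF : F.IsHomogeneous (2 * d)) (hC : RealConicBundle.IsSmoothPlaneCurve F)
    (hpos : ∀ v : Fin 3 → ℝ, v ≠ 0 → 0 < MvPolynomial.eval v F) :
    (∃ (Y : Scheme.{0}) (sY : Y ⟶ RealConicBundle.SpecR),
      Smooth sY ∧ RealConicBundle.IsProjective sY ∧ Scheme.IsRationalOver sY ∧
      RealConicBundle.RealLociDiffeomorphic (RealConicBundle.conicBundleToSpecR d F) sY) ∧
    (Even d →
      RealConicBundle.RealLocusDiffeomorphicTo (RealConicBundle.conicBundleToSpecR d F)
        ((𝓡 1).prod (𝓡 2)) (RealConicBundle.UnitSphere 1 × RealConicBundle.RealProjectivePlane)) ∧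
    (Odd d →
      RealConicBundle.RealLocusDiffeomorphicTo (RealConicBundle.conicBundleToSpecR d F)
        ((𝓡 1).prod (𝓡 2)) RealConicBundle.TwistedProduct) := by
  simp only [← MvPolynomial.aeval_eq_eval] at hpos
  exact ⟨RealConicBundle.exists_rational_model hpos hF,
    RealConicBundle.realLocusDiffeomorphicTo_of_even hpos hF,
    RealConicBundle.realLocusDiffeomorphicTo_of_odd hpos hF⟩
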